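/- **Setting.** Let $V$ be a vertex operator algebra over $\mathbb C$ ($\mathbb Z$-graded with finite-dimensional homogeneous subspaces $V_{(n)}$, $V_{(n)}=0$ for $n$ sufficiently negative, vertex operator map $Y(v,x)=\sum_{n\in\mathbb Z}Y_n(v)x^{-n-1}$, vacuum $\mathbf 1$, conformal vector $\omega$ with modes $L(n)$). Assume $V_{(0)}=\mathbb C\mathbf 1$ and $V_{(n)}=0$ for $n<0$. Let $g$ be an automorphism of $V$ and let $u\in V_{(1)}$ satisfy $L(1)u=0$ and $g(u)=u$. Put $g_u=e^{2\pi i Y_0(u)}$. For a locally finite operator $T=T_S+T_N$ (semisimple part plus nilpotent part) put $x^T=x^{T_S}e^{T_N\log x}$, and let $$\Delta_V^{(u)}(x)=x^{-Y_0(u)}\exp\Big(\sum_{m\ge 1}\frac{(-1)^m}{m}Y_m(u)x^{-m}\Big).$$ For an automorphism $h=\sigma h_{\mathcal U}$ (commuting semisimple and locally unipotent parts) let $\mathcal L_h=\mathcal S_h+\mathcal N_h$, where $\mathcal S_h$ is multiplication by $\alpha$ on the generalized eigenspace of $h$ with eigenvalue $e^{2\pi i\alpha}$, $0\le\Re\alpha<1$,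 and $\mathcal N_h=\frac1{2\pi i}\log h_{\mathcal U}$; thus $h=e^{2\pi i\mathcal L_h}$. Let $W=\coprod_{n,\alpha}W_{[n]}^{[\alpha]}$ be a vector space, $W_{[n]}=\coprod_\alpha W_{[n]}^{[\alpha]}$, $W^{[\alpha]}=\coprod_n W_{[n]}^{[\alpha]}$, with $n\in\mathbb C$. For a linear map $Y_W:V\otimes W\to W\{x\}[\log x]$ (polynomials in $\log x$ over formal series in complex powers of $x$) and an operator $h$ on $V$ consider the following properties, for all $v,v_1,v_2\in V$, $w\in W$. 1. *Identity:* $Y_W(\mathbf 1,x)w=w$. 2. *Lower truncation:* the coefficient of $x^a(\log x)^k$ in $Y_W(v,x)w$ is $0$ for all $k$ when $\Re a$ is sufficiently negative. 3. *$L(-1)$-derivative:* $\frac{d}{dx}Y_W(v,x)=Y_W(L(-1)v,x)$. 4. *Equivariance for $h$:* for $p\in\mathbb Z$ and $z\in\mathbb C^\times$ let $Y_W^{p}(v,z)w$ be obtained from $Y_W(v,x)w$ by $x^a=e^{a\,l_p(z)}$, $\log x=l_p(z)$, where $l_p(z)=\log|z|+i\arg z+2\pi i p$, $0\le\arg z<2\pi$.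 Then these are well-defined elements of $\prod_{n\in\mathbb C}W_{[n]}$ (only finitely many terms contribute to each component), and $Y_W^{p+1}(hv,z)w=Y_W^{p}(v,z)w$. 5. *Twisted Jacobi identity for $h$:* $$x_0^{-1}\delta\Big(\frac{x_1-x_2}{x_0}\Big)Y_W(v_1,x_1)Y_W(v_2,x_2)-x_0^{-1}\delta\Big(\frac{-x_2+x_1}{x_0}\Big)Y_W(v_2,x_2)Y_W(v_1,x_1)=x_1^{-1}\delta\Big(\frac{x_2+x_0}{x_1}\Big)Y_W\Big(Y\Big(\Big(\frac{x_2+x_0}{x_1}\Big)^{\mathcal L_h}v_1,x_0\Big)v_2,x_2\Big).$$ $W$ is a *$\mathbb C/\mathbb Z$-graded generalized $g$-twisted $V$-module* if $\alpha$ runs over $\mathbb C/\mathbb Z$, $W$ carries an action of $g$ and a map $Y_W^g$ satisfying 1–5 for $h=g$, every $w\in W_{[n]}$ is annihilated by a power of $L_W^g(0)-n$, where $L_W^g(0)=\mathrm{Res}_x\,xY_W^g(\omega,x)$, and every $w\in W^{[\alpha]}$ is annihilated by a power of $g-e^{2\pi i\alpha}$. It is *$\mathbb C$-graded* if the same holds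 with $\alpha\in\mathbb C$, $V=\coprod_{n\in\mathbb Z,\alpha\in\mathbb C}V_{(n)}^{[\alpha]}$ has an additional $\mathbb C$-grading such that $V^{[\alpha]}$ consists of generalized eigenvectors of $g$ with eigenvalue $e^{2\pi i\alpha}$, and all coefficients of $Y_W^g(v,x)w$ lie in $W^{[\alpha+\beta]}$ for $v\in V^{[\alpha]}$, $w\in W^{[\beta]}$. **Theorem.** Let $(W,Y_W^g)$ be a $\mathbb C/\mathbb Z$-graded or a $\mathbb C$-graded generalized $g$-twisted $V$-module. Then the map $Y_W^{gg_u}:V\otimes W\to W\{x\}[\log x]$ defined by $$Y_W^{gg_u}(v,x)w=Y_W^g(\Delta_V^{(u)}(x)v,x)w$$ satisfies the identity property, the lower truncation property, the $L(-1)$-derivative property, the equivariance property for $h=gg_u$ (with respect to the given spaces $W_{[n]}$) and the twisted Jacobi identity for $h=gg_u$ (with $\mathcal L_{gg_u}$). -/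

import Mathlib

noncomputable section

/-! ### Linear algebra: locally finite operators and their Jordan decomposition -/

theorem bijective_coeLinearMap {ι V : Type*} [DecidableEq ι] [AddCommGroup V] [Module ℂ V]
    (A : ι → Submodule ℂ V) (h : DirectSum.IsInternal A) :
    Function.Bijective (DirectSum.coeLinearMap A) := h

/-- If `V` is the internal direct sum of the submodules `A i`, this is the linear map on `V`
that agrees with `f i` on `A i` for every `i`. -/
def internalLift {ι V M : Type*} [DecidableEq ι] [AddCommGroup V] [Module ℂ V] [AddCommGroup M] [Module ℂ M]
    (A : ι → Submodule ℂ V) (h : DirectSum.IsInternal A) (f : ι → V →ₗ[ℂ] M) : V →ₗ[ℂ] M :=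
  DirectSum.toModule ℂ ι M (fun i => f i ∘ₗ (A i).subtype) ∘ₗ
    (LinearEquiv.ofBijective (DirectSum.coeLinearMap A) (bijective_coeLinearMap A h)).symm.toLinearMap

open scoped Classical in
/-- The linear map that agrees with `f μ` on the generalized eigenspace of `T` for the
eigenvalue `μ`, for every `μ`, when `V` is the direct sum of the generalized eigenspaces of `T`
(which holds for every operator preserving the finite-dimensional homogeneous subspaces of a
vertex operator algebra; the value is `0` otherwise). -/
def jordanLift {V M : Type*} [AddCommGroup V] [Module ℂ V] [AddCommGroup M] [Module ℂ M]
    (T : Module.End ℂ V) (f : ℂ → V →ₗ[ℂ] M) : V →ₗ[ℂ] M :=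
  if h : DirectSum.IsInternal (fun μ : ℂ => T.maxGenEigenspace μ) then
    internalLift (fun μ : ℂ => T.maxGenEigenspace μ) h f
  else 0

open scoped Classical in
/-- For a sequence of operators `F n` such that each vector is annihilated by all but finitely
many of them: the linear map sending `v` to the finitely supported family `n ↦ F n v`
(the value is `0` for other sequences). -/
def finsuppOfLocallyFinite {V : Type*} [AddCommGroup V] [Module ℂ V]
    (F : ℕ → Module.End ℂ V) : V →ₗ[ℂ] (ℕ →₀ V) :=
  if h : ∀ v, (Function.support fun n => F n v).Finite then
    { toFun := fun v => Finsupp.ofSupportFinite (fun n => F n v) (h v)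
      map_add' := fun v w => by ext n; exact map_add (F n) v w
      map_smul' := fun c v => by ext n; exact map_smul (F n) c v }
  else 0

/-- The operator `∑ₖ c k • Nᵏ` for a locally nilpotent operator `N`. -/
def nilSeries {V : Type*} [AddCommGroup V] [Module ℂ V] (c : ℕ → ℂ) (N : Module.End ℂ V) :
    Module.End ℂ V :=
  Finsupp.lsum ℂ (fun k => c k • (LinearMap.id : V →ₗ[ℂ] V)) ∘ₗ
    finsuppOfLocallyFinite (fun k => N ^ k)

/-- The semisimple part of `T`: multiplication by `μ` on the generalized eigenspace of `μ`. -/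
def semisimplePart {V : Type*} [AddCommGroup V] [Module ℂ V] (T : Module.End ℂ V) :
    Module.End ℂ V :=
  jordanLift T (fun μ => μ • LinearMap.id)

/-- The (locally) nilpotent part of `T`. -/
def nilpotentPart {V : Type*} [AddCommGroup V] [Module ℂ V] (T : Module.End ℂ V) :
    Module.End ℂ V :=
  T - semisimplePart T

/-- `x ^ T = x ^ (T_S) e ^ (T_N log x)`, where `T_S` and `T_N` are the semisimple and the
nilpotent part of `T`. For a vector `v`, the value `x ^ T v` is a finite sum of terms
`v_{a,k} x ^ a (log x) ^ k` with `a : ℂ` and `k : ℕ`; it is recorded as the finitely supported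
family `(a, k) ↦ v_{a,k}`. -/
def xPow {V : Type*} [AddCommGroup V] [Module ℂ V] (T : Module.End ℂ V) :
    V →ₗ[ℂ] (ℂ × ℕ →₀ V) :=
  jordanLift T fun μ =>
    Finsupp.lsum ℂ (fun k : ℕ => ((k.factorial : ℂ)⁻¹) • Finsupp.lsingle (μ, k)) ∘ₗ
      finsuppOfLocallyFinite (fun k => nilpotentPart T ^ k)

/-- `e ^ (2πi T) = e ^ (2πi T_S) e ^ (2πi T_N)`. -/
def expTwoPiI {V : Type*} [AddCommGroup V] [Module ℂ V] (T : Module.End ℂ V) :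
    Module.End ℂ V :=
  jordanLift T fun μ =>
    Complex.exp (2 * Real.pi * Complex.I * μ) •
      nilSeries (fun k => (2 * Real.pi * Complex.I) ^ k / k.factorial) (nilpotentPart T)

/-- For `μ ≠ 0`, the unique complex number `α` with `e ^ (2πi α) = μ` and `0 ≤ Re α < 1`. -/
def unitStripLog (μ : ℂ) : ℂ :=
  Complex.log μ / (2 * Real.pi * Complex.I) -
    (⌊(Complex.log μ / (2 * Real.pi * Complex.I)).re⌋ : ℤ)

/-- `𝓢_g`: multiplication by `α` on the generalized eigenspace of `g` with eigenvalue
`e ^ (2πi α)`, where `α ∈ [0,1) + iℝ`. -/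
def semisimpleLog {V : Type*} [AddCommGroup V] [Module ℂ V] (g : Module.End ℂ V) :
    Module.End ℂ V :=
  jordanLift g (fun μ => unitStripLog μ • LinearMap.id)

/-- The locally unipotent part of an invertible `g` in its multiplicative Jordan-Chevalley
decomposition. -/
def unipotentPart {V : Type*} [AddCommGroup V] [Module ℂ V] (g : Module.End ℂ V) :
    Module.End ℂ V :=
  jordanLift g (fun μ => μ⁻¹ • g)

/-- `𝓝_g = (2πi)⁻¹ log g_𝒰`, by the logarithm series in `g_𝒰 - 1`. -/
def nilpotentLog {V : Type*} [AddCommGroup V] [Module ℂ V] (g : Module.End ℂ V) :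
    Module.End ℂ V :=
  nilSeries (fun j => if j = 0 then 0 else (-1) ^ (j + 1) / (2 * Real.pi * Complex.I * j))
    (unipotentPart g - 1)

/-- `𝓛_g = 𝓢_g + 𝓝_g`, so that `g = e ^ (2πi 𝓛_g)`. -/
def twistLog {V : Type*} [AddCommGroup V] [Module ℂ V] (g : Module.End ℂ V) :
    Module.End ℂ V :=
  semisimpleLog g + nilpotentLog g

/-! ### Vertex operator algebras -/

/-- The `n`-th mode `Y_n(v)` of `Y(v, x) = ∑ Y_n(v) x ^ (-n-1)`. -/
def vertexMode {V : Type*} [AddCommGroup V] [Module ℂ V] (Y : V →ₗ[ℂ] VertexOperator ℂ V)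
    (v : V) (n : ℤ) : Module.End ℂ V :=
  VertexOperator.ncoeff (Y v) n

open scoped Classical in
/-- A vertex operator algebra (over `ℂ`, `ℤ`-graded, with finite-dimensional homogeneous
subspaces and grading bounded below). Lower truncation of `Y(v, x)w` is part of the type
`VertexOperator ℂ V`. -/
structure VertexOperatorAlgebra (V : Type*) [AddCommGroup V] [Module ℂ V] where
  /-- the homogeneous subspaces `V_(n)` -/
  grade : ℤ → Submodule ℂ V
  /-- the vertex operator map -/
  Y : V →ₗ[ℂ] VertexOperator ℂ V
  /-- the vacuum `𝟏` -/
  vac : V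
  /-- the conformal vector `ω` -/
  omega : V
  /-- the central charge -/
  centralCharge : ℂ
  grade_internal : DirectSum.IsInternal grade
  grade_finite : ∀ n, Module.Finite ℂ (grade n)
  grade_bounded : ∃ N : ℤ, ∀ n < N, grade n = ⊥
  vac_mem : vac ∈ grade 0
  omega_mem : omega ∈ grade 2
  /-- identity property -/
  vac_mode : ∀ n : ℤ, vertexMode Y vac n = if n = -1 then 1 else 0
  /-- creation property -/
  creation_nonneg : ∀ (v : V) (n : ℤ), 0 ≤ n → vertexMode Y v n vac = 0
  creation : ∀ v : V, vertexMode Y v (-1) vac = v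
  /-- the Jacobi identity: the coefficients of `x₀ ^ (-l-1) x₁ ^ (-m-1) x₂ ^ (-n-1)` -/
  jacobi : ∀ (a b c : V) (l m n : ℤ),
    ∑ᶠ i : ℕ, ((Ring.choose m i : ℤ) : ℂ) •
        vertexMode Y (vertexMode Y a (l + i) b) (m + n - i) c =
      (∑ᶠ i : ℕ, ((-1 : ℂ) ^ i * ((Ring.choose l i : ℤ) : ℂ)) •
        vertexMode Y a (l + m - i) (vertexMode Y b (n + i) c)) -
      ∑ᶠ i : ℕ, ((-1 : ℂ) ^ (l - i) * ((Ring.choose l i : ℤ) : ℂ)) •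
        vertexMode Y b (l + n - i) (vertexMode Y a (m + i) c)
  /-- the Virasoro relations for `L(n) = Y_{n+1}(ω)` -/
  virasoro : ∀ m n : ℤ,
    ⁅vertexMode Y omega (m + 1), vertexMode Y omega (n + 1)⁆ =
      ((m : ℂ) - n) • vertexMode Y omega (m + n + 1) +
        if m + n = 0 then (((m : ℂ) ^ 3 - m) / 12 * centralCharge) • (1 : Module.End ℂ V) else 0
  /-- `L(0)` acts on `V_(n)` as multiplication by `n` -/
  L_zero : ∀ (n : ℤ), ∀ v ∈ grade n, vertexMode Y omega 1 v = (n : ℂ) • v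
  /-- the `L(-1)`-derivative property -/
  L_neg_one : ∀ (v : V) (n : ℤ),
    vertexMode Y (vertexMode Y omega 0 v) n = (-(n : ℂ)) • vertexMode Y v (n - 1)

namespace VertexOperatorAlgebra

variable {V : Type*} [AddCommGroup V] [Module ℂ V]

/-- The mode `Y_n(v)`, the coefficient of `x ^ (-n-1)` in `Y(v, x)`. -/
def mode (𝒱 : VertexOperatorAlgebra V) (v : V) (n : ℤ) : Module.End ℂ V :=
  vertexMode 𝒱.Y v n

/-- The Virasoro operator `L(n)`. -/
def L (𝒱 : VertexOperatorAlgebra V) (n : ℤ) : Module.End ℂ V := 𝒱.mode 𝒱.omega (n + 1)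

/-- An automorphism of a vertex operator algebra. -/
structure Automorphism (𝒱 : VertexOperatorAlgebra V) extends V ≃ₗ[ℂ] V where
  map_mode : ∀ (a b : V) (n : ℤ),
    toLinearEquiv (𝒱.mode a n b) = 𝒱.mode (toLinearEquiv a) n (toLinearEquiv b)
  map_vac : toLinearEquiv 𝒱.vac = 𝒱.vac
  map_omega : toLinearEquiv 𝒱.omega = 𝒱.omega

/-- An automorphism as a linear operator on `V`. -/
def Automorphism.op {𝒱 : VertexOperatorAlgebra V} (g : 𝒱.Automorphism) : Module.End ℂ V :=
  g.toLinearEquiv.toLinearMap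

/-! ### The series `Δ` -/

/-- The series `-∫₀^{-x} Y^{≤ -2}(u, y) = ∑_{m ≥ 1} ((-1) ^ m / m) Y_m(u) x ^ (-m)`, as a power
series in `x⁻¹` with coefficients in `End V`. -/
def deltaExponent (𝒱 : VertexOperatorAlgebra V) (u : V) : PowerSeries (Module.End ℂ V) :=
  PowerSeries.mk fun m => if m = 0 then 0 else ((-1 : ℂ) ^ m / m) • 𝒱.mode u m

/-- The coefficient of `x ^ (-n)` in `exp (-∫₀^{-x} Y^{≤ -2}(u, y))`; as the exponent has no
constant term, only its powers up to the `n`-th contribute. -/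
def deltaExpCoeff (𝒱 : VertexOperatorAlgebra V) (u : V) (n : ℕ) : Module.End ℂ V :=
  ∑ k ∈ Finset.range (n + 1),
    ((k.factorial : ℂ)⁻¹) • PowerSeries.coeff n (𝒱.deltaExponent u ^ k)

/-- `Δ^{(u)}(x) = x ^ (-Y_0(u)) exp (-∫₀^{-x} Y^{≤ -2}(u, y))`. For a vector `v`, the value
`Δ^{(u)}(x) v` is a finite sum of terms `v_{a,k} x ^ a (log x) ^ k`, recorded as the finitely
supported family `(a, k) ↦ v_{a,k}`. -/
def Delta (𝒱 : VertexOperatorAlgebra V) (u : V) : V →ₗ[ℂ] (ℂ × ℕ →₀ V) :=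
  Finsupp.lsum ℂ (fun n : ℕ =>
      Finsupp.lmapDomain V ℂ (fun p : ℂ × ℕ => (p.1 - n, p.2)) ∘ₗ xPow (-(𝒱.mode u 0))) ∘ₗ
    finsuppOfLocallyFinite (𝒱.deltaExpCoeff u)

/-- The operator `g g_u` on `V`, where `g_u = e ^ (2πi Y_0(u))`. -/
def Automorphism.twist {𝒱 : VertexOperatorAlgebra V} (g : 𝒱.Automorphism) (u : V) :
    Module.End ℂ V :=
  g.op * expTwoPiI (𝒱.mode u 0)

end VertexOperatorAlgebra

/-! ### Twisted vertex operators -/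

/-- The space `W{x}[log x]` of polynomials in `log x` whose coefficients are formal series in
arbitrary complex powers of `x` with coefficients in `W`. The coefficient of
`x ^ a (log x) ^ k` in `f` is `f k a`. -/
abbrev LogSeries (W : Type*) [AddCommGroup W] := ℕ →₀ (ℂ → W)

section TwistedOperators

variable {V W : Type*} [AddCommGroup V] [Module ℂ V] [AddCommGroup W] [Module ℂ W]

/-- The coefficient of `x ^ a (log x) ^ k` in `Y(v, x)`. -/
def logCoeff (Y : V →ₗ[ℂ] W →ₗ[ℂ] LogSeries W) (v : V) (a : ℂ) (k : ℕ) : Module.End ℂ W :=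
  LinearMap.proj a ∘ₗ Finsupp.lapply k ∘ₗ Y v

/-- Multiplication by `x ^ b (log x) ^ j` on `W{x}[log x]`. -/
def mulMonomial (b : ℂ) (j : ℕ) : LogSeries W →ₗ[ℂ] LogSeries W :=
  Finsupp.lmapDomain (ℂ → W) ℂ (fun k => k + j) ∘ₗ
    Finsupp.mapRange.linearMap (LinearMap.funLeft ℂ W (fun a : ℂ => a - b))

/-- The map `(v, w) ↦ Y(Δ^{(u)}(x) v, x) w`. -/
def deltaTwist (𝒱 : VertexOperatorAlgebra V) (u : V) (Y : V →ₗ[ℂ] W →ₗ[ℂ] LogSeries W) :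
    V →ₗ[ℂ] W →ₗ[ℂ] LogSeries W :=
  Finsupp.lsum ℂ (fun p : ℂ × ℕ => Y.compr₂ (mulMonomial p.1 p.2)) ∘ₗ 𝒱.Delta u

/-- `Y(𝟏, x) w = w`. -/
def IdentityProperty (𝒱 : VertexOperatorAlgebra V) (Y : V →ₗ[ℂ] W →ₗ[ℂ] LogSeries W) : Prop :=
  ∀ (a : ℂ) (k : ℕ) (w : W), logCoeff Y 𝒱.vac a k w = if a = 0 ∧ k = 0 then w else 0

/-- The powers of `x` occurring in `Y(v, x) w` have real parts bounded from below. -/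
def LowerTruncationProperty (Y : V →ₗ[ℂ] W →ₗ[ℂ] LogSeries W) : Prop :=
  ∀ (v : V) (w : W), ∃ N : ℝ, ∀ a : ℂ, a.re < N → ∀ k : ℕ, logCoeff Y v a k w = 0

/-- `d/dx Y(v, x) = Y(L(-1) v, x)`. -/
def LDerivativeProperty (𝒱 : VertexOperatorAlgebra V) (Y : V →ₗ[ℂ] W →ₗ[ℂ] LogSeries W) :
    Prop :=
  ∀ (v : V) (w : W) (a : ℂ) (k : ℕ),
    (a + 1) • logCoeff Y v (a + 1) k w + ((k : ℂ) + 1) • logCoeff Y v (a + 1) (k + 1) w =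
      logCoeff Y (𝒱.L (-1) v) a k w

/-- `l_p(z) = log |z| + i arg z + 2πi p` with `0 ≤ arg z < 2π`. -/
def logBranch (p : ℤ) (z : ℂ) : ℂ :=
  Real.log ‖z‖ + toIcoMod Real.two_pi_pos 0 (Complex.arg z) * Complex.I +
    2 * Real.pi * Complex.I * p

/-- The component, in the homogeneous subspace onto which `π` projects, of the `p`-th analytic
branch `Y^p(v, z) w`: substitute `x ^ a = e ^ (a l_p(z))` and `log x = l_p(z)`. -/
def branchComponent (π : W →ₗ[ℂ] W) (Y : V →ₗ[ℂ] W →ₗ[ℂ] LogSeries W) (p : ℤ) (z : ℂ)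
    (v : V) (w : W) : W :=
  ∑ᶠ q : ℂ × ℕ, (Complex.exp (q.1 * logBranch p z) * logBranch p z ^ q.2) •
    π (logCoeff Y v q.1 q.2 w)

/-- The equivariance property `Y^{p+1}(h v, z) w = Y^p(v, z) w` for the operator `h`, where
`π n` is the projection of `W` onto `W_[n]`. Both sides are elements of the algebraic completion
`∏ₙ W_[n]`; the first part says that the analytic branches do define such elements. -/
def EquivarianceProperty (π : ℂ → W →ₗ[ℂ] W) (h : Module.End ℂ V)
    (Y : V →ₗ[ℂ] W →ₗ[ℂ] LogSeries W) : Prop :=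
  (∀ (v : V) (w : W) (n : ℂ), {q : ℂ × ℕ | π n (logCoeff Y v q.1 q.2 w) ≠ 0}.Finite) ∧
  ∀ (p : ℤ) (z : ℂ), z ≠ 0 → ∀ (v : V) (w : W) (n : ℂ),
    branchComponent (π n) Y (p + 1) z (h v) w = branchComponent (π n) Y p z v w

/-- The coefficient of `(x₀ / x₂) ^ j (log x₁) ^ k (log x₂) ^ l` in
`(1 + x₀ / x₂) ^ β (log (x₂ + x₀) - log x₁) ^ r`, where
`log (x₂ + x₀) = log x₂ + log (1 + x₀ / x₂)`; the outer polynomial variable is `log x₂`,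
the inner one is `log x₁`, the power series variable is `x₀ / x₂`. -/
def jacobiKernel (β : ℂ) (r j k l : ℕ) : ℂ :=
  PowerSeries.coeff j (Polynomial.coeff (Polynomial.coeff
    ((Polynomial.C (Polynomial.C (PowerSeries.binomialSeries ℂ β)) *
      (Polynomial.X + Polynomial.C (Polynomial.C (PowerSeries.log ℂ)) -
        Polynomial.C Polynomial.X) ^ r : Polynomial (Polynomial (PowerSeries ℂ)))) l) k)

/-- The coefficient of `x₀ ^ (-n-1) x₁ ^ b (log x₁) ^ k x₂ ^ c (log x₂) ^ l` in
`x₀⁻¹ δ((x₁ - x₂) / x₀) Y(v₁, x₁) Y(v₂, x₂) w`. -/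
def jacobiProduct (Y : V →ₗ[ℂ] W →ₗ[ℂ] LogSeries W) (v₁ v₂ : V) (w : W)
    (n : ℤ) (b c : ℂ) (k l : ℕ) : W :=
  ∑ᶠ j : ℕ, ((-1 : ℂ) ^ j * ((Ring.choose n j : ℤ) : ℂ)) •
    logCoeff Y v₁ (b - n + j) k (logCoeff Y v₂ (c - j) l w)

/-- The coefficient of `x₀ ^ (-n-1) x₁ ^ b (log x₁) ^ k x₂ ^ c (log x₂) ^ l` in
`x₀⁻¹ δ((-x₂ + x₁) / x₀) Y(v₂, x₂) Y(v₁, x₁) w`. -/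
def jacobiOppositeProduct (Y : V →ₗ[ℂ] W →ₗ[ℂ] LogSeries W) (v₁ v₂ : V) (w : W)
    (n : ℤ) (b c : ℂ) (k l : ℕ) : W :=
  ∑ᶠ j : ℕ, ((-1 : ℂ) ^ (n - j) * ((Ring.choose n j : ℤ) : ℂ)) •
    logCoeff Y v₂ (c - n + j) l (logCoeff Y v₁ (b - j) k w)

/-- The coefficient of `x₀ ^ (-n-1) x₁ ^ b (log x₁) ^ k x₂ ^ c (log x₂) ^ l` in
`x₁⁻¹ δ((x₂ + x₀) / x₁) Y(Y_V(((x₂ + x₀) / x₁) ^ 𝓛 v₁, x₀) v₂, x₂) w`.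
Here `((x₂ + x₀) / x₁) ^ 𝓛 v₁` is the sum, over the terms `t x ^ α (log x) ^ r` of `x ^ 𝓛 v₁`, of
`((x₂ + x₀) / x₁) ^ α (log (x₂ + x₀) - log x₁) ^ r t`, the delta function is the sum of
`((x₂ + x₀) / x₁) ^ m` over `m : ℤ`, and powers of `x₂ + x₀` are expanded in nonnegative powers
of `x₀`. -/
def jacobiIterate (𝒱 : VertexOperatorAlgebra V) (𝓛 : Module.End ℂ V)
    (Y : V →ₗ[ℂ] W →ₗ[ℂ] LogSeries W) (v₁ v₂ : V) (w : W)
    (n : ℤ) (b c : ℂ) (k l : ℕ) : W :=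
  open scoped Classical in
  (xPow 𝓛 v₁).sum fun p t =>
    ∑ᶠ m : ℤ, if b = -1 - (m + p.1) then
      ∑ᶠ j : ℕ, ∑ q ∈ Finset.HasAntidiagonal.antidiagonal l,
        jacobiKernel (m + p.1) p.2 j k q.1 •
          logCoeff Y (HVertexOperator.coeff (𝒱.Y t) (-n - 1 - j) v₂)
            (c - (m + p.1) + j) q.2 w
    else 0

/-- The Jacobi identity for twisted vertex operators, where `𝓛` is a logarithm (divided by `2πi`)
of the twisting operator, coefficient by coefficient. -/
def TwistedJacobiIdentity (𝒱 : VertexOperatorAlgebra V) (𝓛 : Module.End ℂ V)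
    (Y : V →ₗ[ℂ] W →ₗ[ℂ] LogSeries W) : Prop :=
  ∀ (v₁ v₂ : V) (w : W) (n : ℤ) (b c : ℂ) (k l : ℕ),
    jacobiProduct Y v₁ v₂ w n b c k l - jacobiOppositeProduct Y v₁ v₂ w n b c k l =
      jacobiIterate 𝒱 𝓛 Y v₁ v₂ w n b c k l

open scoped Classical in
/-- The projection of `W = ∐_{n, α} W_[n]^[α]` onto `W_[n] = ∐_α W_[n]^[α]`. -/
def weightProj {A : Type} (gr : ℂ → A → Submodule ℂ W)
    (h : DirectSum.IsInternal (fun p : ℂ × A => gr p.1 p.2)) (n : ℂ) : W →ₗ[ℂ] W :=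
  internalLift (fun p : ℂ × A => gr p.1 p.2) h
    (fun p => if p.1 = n then LinearMap.id else 0)

end TwistedOperators

/-! ### Generalized twisted modules -/

open scoped Classical in
/-- A generalized `g`-twisted module whose second grading is indexed by `A`, where
`cls : ℂ → A` is the map from complex numbers to indices. It is used with `A = ℂ / ℤ` and the
quotient map, and with `A = ℂ` and the identity. -/
structure GeneralizedTwistedModule {V : Type*} [AddCommGroup V] [Module ℂ V]
    (𝒱 : VertexOperatorAlgebra V) (g : 𝒱.Automorphism) (A : Type) (cls : ℂ → A)
    (W : Type*) [AddCommGroup W] [Module ℂ W] where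
  /-- the homogeneous subspaces `W_[n]^[α]` -/
  grade : ℂ → A → Submodule ℂ W
  grade_internal : DirectSum.IsInternal (fun p : ℂ × A => grade p.1 p.2)
  /-- the action of `g` on `W` -/
  action : W ≃ₗ[ℂ] W
  /-- the twisted vertex operator map -/
  Y : V →ₗ[ℂ] W →ₗ[ℂ] LogSeries W
  equivariance : EquivarianceProperty (weightProj grade grade_internal) g.op Y
  identity : IdentityProperty 𝒱 Y
  lower_truncation : LowerTruncationProperty Y
  jacobi : TwistedJacobiIdentity 𝒱 (twistLog g.op) Y
  /-- each vector of `W_[n]` is annihilated by a power of `L(0) - n`, where `L(0)` is the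
  coefficient of `x⁻²` in `Y(ω, x)` -/
  L_zero_grading : ∀ (n : ℂ), ∀ w ∈ ⨆ α, grade n α,
    ∃ K : ℕ, ((logCoeff Y 𝒱.omega (-2) 0 - n • (1 : Module.End ℂ W)) ^ K) w = 0
  /-- each vector of `W^[α]` is annihilated by a power of `g - e ^ (2πi α)` -/
  g_grading : ∀ (α : ℂ), ∀ w ∈ ⨆ n, grade n (cls α),
    ∃ K : ℕ, ((action.toLinearMap -
      Complex.exp (2 * Real.pi * Complex.I * α) • (1 : Module.End ℂ W)) ^ K) w = 0
  L_derivative : LDerivativeProperty 𝒱 Y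

/-- A `ℂ/ℤ`-graded generalized `g`-twisted module. -/
abbrev CModZGradedTwistedModule {V : Type*} [AddCommGroup V] [Module ℂ V]
    (𝒱 : VertexOperatorAlgebra V) (g : 𝒱.Automorphism)
    (W : Type*) [AddCommGroup W] [Module ℂ W] :=
  GeneralizedTwistedModule 𝒱 g (ℂ ⧸ AddSubgroup.zmultiples (1 : ℂ))
    (fun α => (QuotientAddGroup.mk α : ℂ ⧸ AddSubgroup.zmultiples (1 : ℂ))) W

open scoped Classical in
/-- A `ℂ`-grading `V = ∐ V^[α]`, with `V = ∐ V_(n)^[α]`, compatible with `g`: the vectors of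
`V^[α]` are generalized eigenvectors of `g` with eigenvalue `e ^ (2πi α)`. -/
structure CompatibleCGrading {V : Type*} [AddCommGroup V] [Module ℂ V]
    (𝒱 : VertexOperatorAlgebra V) (g : 𝒱.Automorphism) where
  grade : ℂ → Submodule ℂ V
  grade_internal : DirectSum.IsInternal grade
  bigrade_internal : DirectSum.IsInternal (fun p : ℤ × ℂ => 𝒱.grade p.1 ⊓ grade p.2)
  grade_le : ∀ α : ℂ,
    grade α ≤ g.op.maxGenEigenspace (Complex.exp (2 * Real.pi * Complex.I * α))

/-- A `ℂ`-graded generalized `g`-twisted module. -/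
structure CGradedTwistedModule {V : Type*} [AddCommGroup V] [Module ℂ V]
    (𝒱 : VertexOperatorAlgebra V) (g : 𝒱.Automorphism) (𝒢 : CompatibleCGrading 𝒱 g)
    (W : Type*) [AddCommGroup W] [Module ℂ W]
    extends GeneralizedTwistedModule 𝒱 g ℂ (fun α => α) W where
  /-- the grading compatibility condition -/
  grading_compatible : ∀ (α β : ℂ), ∀ v ∈ 𝒢.grade α, ∀ w ∈ ⨆ n, grade n β,
    ∀ (a : ℂ) (k : ℕ), logCoeff Y v a k w ∈ ⨆ n, grade n (α + β)

/-- The identity, lower truncation, `L(-1)`-derivative, equivariance and Jacobi properties of a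
twisted vertex operator map with respect to the operator `h` on `V`, for the weight projections
`π n : W → W_[n]`. -/
structure HasTwistedProperties {V W : Type*} [AddCommGroup V] [Module ℂ V] [AddCommGroup W]
    [Module ℂ W] (𝒱 : VertexOperatorAlgebra V) (h : Module.End ℂ V)
    (π : ℂ → W →ₗ[ℂ] W) (Y : V →ₗ[ℂ] W →ₗ[ℂ] LogSeries W) : Prop where
  identity : IdentityProperty 𝒱 Y
  lower_truncation : LowerTruncationProperty Y
  L_derivative : LDerivativeProperty 𝒱 Y
  equivariance : EquivarianceProperty π h Y
  jacobi : TwistedJacobiIdentity 𝒱 (twistLog h) Y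

end

/-! Write `u₀ = Y_0(u)` and `Δ(x) = x^(-u₀) D(x)`, where `D(x)` is the exponential factor. Two facts
carry the theorem.

The first is the conjugation formula `Δ(x) Y(v, x₀) = Y(Δ(x + x₀) v, x₀) Δ(x)`. Because `V_(0) = ℂ𝟏`
and `V_(n) = 0` for `n < 0`, the vector `u_1 u` is a multiple of the vacuum, `u_i u = 0` for `i ≥
2`, and comparing two commutators on the vacuum gives `u_0 u = 0`; hence all nonnegative modes of
`u` commute (`commute_mode_nonneg`). So `D` solves a first order equation `x d/dx`-style
(`euler_deltaExp`), and after the factors `x^(-u₀)` are removed both sides of the conjugation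
formula solve that same equation with the same initial term (`deltaExp_conjugation`).

The second is that `𝓛_{g g_u} = 𝓛_g + u₀` up to an integer on each joint generalized eigenspace of
`g` and `u₀`. The nilpotent parts add exactly (`nilpotentLog_mul_expTwoPiI`), and the eigenvalues
add modulo `ℤ` (`exists_unitStripLog_eq`).

Identity and lower truncation hold because `Δ(x)` fixes the vacuum and `Δ(x) v` is a finite sum.
Evaluating the conjugation formula on the vacuum, where `v_{-2} 𝟏 = L(-1) v`, gives the commutator
of `Δ(x)` with `L(-1)` and so the derivative property. For equivariance, passing to the next branch
of the logarithm multiplies `x^(-u₀)` by `e^(-2πi u₀)`, which cancels `g_u`.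

For the Jacobi identity, apply the given identity to `Δ(x₁) v₁` and `Δ(x₂) v₂`. Its right side
contains `Y(((x₂+x₀)/x₁)^𝓛_g Δ(x₁) v₁, x₀) Δ(x₂) v₂`. In the right side to be proved, the
conjugation formula moves `Δ(x₂)` inside and produces `Δ(x₂+x₀) ((x₂+x₀)/x₁)^𝓛_{g g_u} v₁`. Here the
powers `(x₂+x₀)^(∓u₀)` cancel and leave `x₁^(-u₀)`, while the delta function turns the integral
powers in `D(x₂+x₀)` into those of `D(x₁)` and absorbs the integers of the second fact.

In coefficients, the semisimple parts only shift exponents, and binomial series multiply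
accordingly. The nilpotent parts become exponentials on `KernelRing ⊗ V`, whose logarithms cancel in
`nilExp_kernelMap_cancel`. `kernelPairing_iterateFamily_deltaTwist` combines the two, and
`jacobiIterate_deltaTwist` is the resulting comparison of the right sides. -/

open scoped TensorProduct

/-! ### Generalized eigenspace decompositions and series in locally nilpotent operators. -/

section LinearAlgebra

variable {V M : Type*} [AddCommGroup V] [Module ℂ V] [AddCommGroup M] [Module ℂ M]

theorem internalLift_apply {ι : Type*} [DecidableEq ι] (A : ι → Submodule ℂ V)
    (h : DirectSum.IsInternal A) (f : ι → V →ₗ[ℂ] M) {i : ι} {v : V} (hv : v ∈ A i) :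
    internalLift A h f v = f i v := by
  have : (LinearEquiv.ofBijective (DirectSum.coeLinearMap A)
      (bijective_coeLinearMap A h)).symm v = DirectSum.lof ℂ ι (fun i => A i) i ⟨v, hv⟩ := by
    rw [LinearEquiv.symm_apply_eq]
    simp [LinearEquiv.ofBijective_apply]
  simp [internalLift, this]

/-- The generalized eigenspaces of `T` span the whole space. -/
def IsTriangularizable (T : Module.End ℂ V) : Prop := ⨆ μ, T.maxGenEigenspace μ = ⊤

/-- Each vector is annihilated by some power of `N`. -/
def IsLocallyNilpotent (N : Module.End ℂ V) : Prop := ∀ v, ∃ k : ℕ, (N ^ k) v = 0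

namespace IsTriangularizable

variable {T S : Module.End ℂ V}

theorem isInternal [DecidableEq ℂ] (h : IsTriangularizable T) :
    DirectSum.IsInternal (fun μ : ℂ => T.maxGenEigenspace μ) :=
  (DirectSum.isInternal_submodule_iff_iSupIndep_and_iSup_eq_top _).2
    ⟨T.independent_maxGenEigenspace, h⟩

theorem induction (h : IsTriangularizable T) {p : V → Prop}
    (mem : ∀ μ, ∀ v ∈ T.maxGenEigenspace μ, p v) (zero : p 0)
    (add : ∀ v w, p v → p w → p (v + w)) (v : V) : p v :=
  Submodule.iSup_induction (fun μ => T.maxGenEigenspace μ) (motive := p)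
    (by rw [h]; trivial) mem zero add

theorem ext (h : IsTriangularizable T) {f f' : V →ₗ[ℂ] M}
    (hf : ∀ μ, ∀ v ∈ T.maxGenEigenspace μ, f v = f' v) : f = f' := by
  ext v
  exact h.induction (p := fun v => f v = f' v) hf (by simp)
    (fun v w hv hw => by simp [hv, hw]) v

theorem jordanLift_apply (h : IsTriangularizable T) (f : ℂ → V →ₗ[ℂ] M) {μ : ℂ} {v : V}
    (hv : v ∈ T.maxGenEigenspace μ) : jordanLift T f v = f μ v := by
  rw [jordanLift, dif_pos h.isInternal]
  exact internalLift_apply _ _ _ hv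

theorem commute_jordanLift (h : IsTriangularizable T) {A : Module.End ℂ V} (hA : Commute A T)
    (f : ℂ → Module.End ℂ V) (hf : ∀ μ, Commute A (f μ)) : Commute A (jordanLift T f) := by
  refine h.ext fun μ v hv => ?_
  have hAv : A v ∈ T.maxGenEigenspace μ := Module.End.mapsTo_maxGenEigenspace_of_comm hA.symm μ hv
  rw [Module.End.mul_apply, Module.End.mul_apply, h.jordanLift_apply f hv,
    h.jordanLift_apply f hAv]
  exact LinearMap.congr_fun (hf μ).eq v

/-- Commuting triangularizable operators have a common decomposition: the spectral projections of
`T` commute with `S`, so they preserve the generalized eigenspaces of `S`. -/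
theorem joint_induction (hT : IsTriangularizable T) (hS : IsTriangularizable S)
    (hTS : Commute T S) {p : V → Prop}
    (mem : ∀ μ ν, ∀ v ∈ T.maxGenEigenspace μ, v ∈ S.maxGenEigenspace ν → p v) (zero : p 0)
    (add : ∀ v w, p v → p w → p (v + w)) (v : V) : p v := by
  classical
  refine hS.induction (fun ν v hv => ?_) zero add v
  obtain ⟨m, hm, rfl⟩ := (Submodule.mem_iSup_iff_exists_finsupp _ _).mp
    (show v ∈ ⨆ μ, T.maxGenEigenspace μ by rw [hT]; trivial)
  have key (μ : ℂ) : m μ ∈ S.maxGenEigenspace ν := by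
    -- This lift is the projection onto the generalized eigenspace of `T` for `μ`.
    have hc : Commute S (jordanLift T fun κ => if κ = μ then (1 : Module.End ℂ V) else 0) :=
      hT.commute_jordanLift hTS.symm _ fun κ => by split_ifs <;> simp
    have := Module.End.mapsTo_maxGenEigenspace_of_comm hc ν hv
    convert this using 1
    rw [Finsupp.sum, map_sum]
    simp only [hT.jordanLift_apply _ (hm _)]
    rw [Finset.sum_eq_single μ (fun κ _ hκ => by simp [hκ]) (fun h => by simp_all)]
    simp
  exact Finset.sum_induction _ p add zero fun μ _ => mem μ ν _ (hm μ) (key μ)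

theorem joint_ext (hT : IsTriangularizable T) (hS : IsTriangularizable S)
    (hTS : Commute T S) {f f' : V →ₗ[ℂ] M}
    (hf : ∀ μ ν, ∀ v ∈ T.maxGenEigenspace μ, v ∈ S.maxGenEigenspace ν → f v = f' v) :
    f = f' := by
  ext v
  exact hT.joint_induction hS hTS (p := fun v => f v = f' v) hf (by simp)
    (fun v w hv hw => by simp [hv, hw]) v

theorem of_le (h : IsTriangularizable T) (f : ℂ → ℂ)
    (hf : ∀ μ, T.maxGenEigenspace μ ≤ S.maxGenEigenspace (f μ)) : IsTriangularizable S := by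
  rw [IsTriangularizable, eq_top_iff, ← h]
  exact iSup_le fun μ => (hf μ).trans (le_iSup (fun μ => S.maxGenEigenspace μ) (f μ))

/-- An operator preserving finite-dimensional subspaces that span is triangularizable. -/
theorem of_finite {ι : Type*} (A : ι → Submodule ℂ V) (hA : ⨆ i, A i = ⊤)
    (hfin : ∀ i, Module.Finite ℂ (A i)) (hT : ∀ i, ∀ v ∈ A i, T v ∈ A i) :
    IsTriangularizable T := by
  rw [IsTriangularizable, eq_top_iff, ← hA]
  refine iSup_le fun i v hv => ?_
  have := hfin i
  have h1 := Module.End.iSup_maxGenEigenspace_eq_top (T.restrict (hT i))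
  have h2 : (⟨v, hv⟩ : A i) ∈ ⨆ μ, Module.End.maxGenEigenspace (T.restrict (hT i)) μ := by
    rw [h1]; trivial
  have h3 := Submodule.mem_map_of_mem (f := (A i).subtype) h2
  rw [Submodule.map_iSup] at h3
  refine (iSup_mono fun μ => ?_ : _ ≤ ⨆ μ, T.maxGenEigenspace μ) h3
  rw [Module.End.maxGenEigenspace, Module.End.genEigenspace_restrict]
  exact Submodule.map_comap_le _ _

end IsTriangularizable

/-! ### Locally nilpotent operators -/

theorem Module.End.pow_apply_eq_zero_of_le {N : Module.End ℂ V} {v : V} {k l : ℕ} (hkl : k ≤ l)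
    (h : (N ^ k) v = 0) : (N ^ l) v = 0 := by
  rw [← Nat.sub_add_cancel hkl, pow_add, Module.End.mul_apply, h, map_zero]

theorem finsuppOfLocallyFinite_apply {F : ℕ → Module.End ℂ V}
    (h : ∀ v, ∃ K : ℕ, ∀ n, K ≤ n → F n v = 0) (v : V) (n : ℕ) :
    finsuppOfLocallyFinite F v n = F n v := by
  have h' : ∀ v, (Function.support fun n => F n v).Finite := fun v => by
    obtain ⟨K, hK⟩ := h v
    refine (Set.finite_lt_nat K).subset fun n hn => ?_
    by_contra hn'
    exact hn (hK n (not_lt.1 hn'))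
  rw [finsuppOfLocallyFinite, dif_pos h']
  rfl

theorem lsum_finsuppOfLocallyFinite {F : ℕ → Module.End ℂ V}
    (h : ∀ v, ∃ K : ℕ, ∀ n, K ≤ n → F n v = 0) (G : ℕ → V →ₗ[ℂ] M) {v : V} {K : ℕ}
    (hK : ∀ n, K ≤ n → F n v = 0) :
    Finsupp.lsum ℂ G (finsuppOfLocallyFinite F v) = ∑ n ∈ Finset.range K, G n (F n v) := by
  rw [Finsupp.lsum_apply, Finsupp.sum_of_support_subset (s := Finset.range K)]
  · simp [finsuppOfLocallyFinite_apply h]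
  · intro n hn
    rw [Finsupp.mem_support_iff, finsuppOfLocallyFinite_apply h] at hn
    by_contra hn'
    exact hn (hK n (by simpa using hn'))
  · simp

namespace IsLocallyNilpotent

variable {N A B : Module.End ℂ V}

theorem exists_forall (hN : IsLocallyNilpotent N) (v : V) :
    ∃ K : ℕ, ∀ n, K ≤ n → (N ^ n) v = 0 :=
  (hN v).imp fun _ hk _ h => Module.End.pow_apply_eq_zero_of_le h hk

theorem nilSeries_apply (hN : IsLocallyNilpotent N) (c : ℕ → ℂ) {v : V} {K : ℕ}
    (hK : (N ^ K) v = 0) : nilSeries c N v = ∑ k ∈ Finset.range K, c k • (N ^ k) v := by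
  rw [nilSeries, LinearMap.comp_apply, lsum_finsuppOfLocallyFinite hN.exists_forall _
    fun n hn => Module.End.pow_apply_eq_zero_of_le hn hK]
  rfl

theorem exists_common (hN : IsLocallyNilpotent N) (s : ℕ → V) (n : ℕ) :
    ∃ K : ℕ, ∀ i < n, (N ^ K) (s i) = 0 := by
  choose f hf using fun i => hN (s i)
  exact ⟨(Finset.range n).sup f, fun i hi => Module.End.pow_apply_eq_zero_of_le
    (Finset.le_sup (f := f) (Finset.mem_range.2 hi)) (hf i)⟩

theorem mul_left (hB : IsLocallyNilpotent B) (h : Commute A B) : IsLocallyNilpotent (A * B) :=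
  fun v => (hB v).imp fun k hk => by rw [h.mul_pow, Module.End.mul_apply, hk, map_zero]

theorem smul (hB : IsLocallyNilpotent B) (c : ℂ) : IsLocallyNilpotent (c • B) :=
  fun v => (hB v).imp fun k hk => by rw [smul_pow, LinearMap.smul_apply, hk, smul_zero]

theorem neg (hB : IsLocallyNilpotent B) : IsLocallyNilpotent (-B) := by
  simpa using hB.smul (-1)

theorem add (hA : IsLocallyNilpotent A) (hB : IsLocallyNilpotent B) (h : Commute A B) :
    IsLocallyNilpotent (A + B) := by
  intro v
  obtain ⟨K, hK⟩ := hA v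
  obtain ⟨L, hL⟩ := hB v
  refine ⟨K + L, ?_⟩
  rw [h.add_pow', LinearMap.sum_apply]
  refine Finset.sum_eq_zero fun p hp => ?_
  rw [Finset.HasAntidiagonal.mem_antidiagonal] at hp
  rw [LinearMap.smul_apply]
  rcases le_or_gt K p.1 with h1 | h1
  · rw [(h.pow_pow p.1 p.2).eq, Module.End.mul_apply,
      Module.End.pow_apply_eq_zero_of_le h1 hK]; simp
  · rw [Module.End.mul_apply, Module.End.pow_apply_eq_zero_of_le (show L ≤ p.2 by lia) hL]; simp

theorem commute_nilSeries (hN : IsLocallyNilpotent N) (h : Commute A N) (c : ℕ → ℂ) :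
    Commute A (nilSeries c N) := by
  ext v
  obtain ⟨K, hK⟩ := hN v
  have hK' : (N ^ K) (A v) = 0 := by
    rw [← Module.End.mul_apply, ← (h.pow_right K).eq, Module.End.mul_apply, hK, map_zero]
  rw [Module.End.mul_apply, Module.End.mul_apply, hN.nilSeries_apply c hK,
    hN.nilSeries_apply c hK', map_sum]
  refine Finset.sum_congr rfl fun k _ => ?_
  rw [map_smul, ← Module.End.mul_apply, (h.pow_right k).eq, Module.End.mul_apply]

end IsLocallyNilpotent

/-- The nonzero terms lie in the box `i < K`, `j < L`, where `i + j ≤ K + L - 2 < Q`; so the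
triangle and the box contain the same nonzero terms. This is the standard way below to rearrange
truncated Cauchy products. -/
theorem sum_range_antidiagonal_eq {G : Type*} [AddCommGroup G] {F : ℕ → ℕ → G} {K L Q : ℕ}
    (hK : ∀ i j, K ≤ i → F i j = 0) (hL : ∀ i j, L ≤ j → F i j = 0) (hQ : K + L ≤ Q + 1) :
    ∑ n ∈ Finset.range Q, ∑ p ∈ Finset.HasAntidiagonal.antidiagonal n, F p.1 p.2 =
      ∑ i ∈ Finset.range K, ∑ j ∈ Finset.range L, F i j := by
  rw [← Finset.sum_product', Finset.sum_sigma']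
  refine Finset.sum_bij_ne_zero (fun x _ _ => x.2) ?_ ?_ ?_ ?_
  · rintro ⟨n, i, j⟩ - h
    simp only [Finset.mem_product, Finset.mem_range]
    exact ⟨not_le.1 fun h' => h (hK i j h'), not_le.1 fun h' => h (hL i j h')⟩
  · rintro ⟨n, i, j⟩ h - ⟨n', i', j'⟩ h' - heq
    simp only [Finset.mem_sigma, Finset.HasAntidiagonal.mem_antidiagonal, Finset.mem_range] at h h' heq
    obtain ⟨rfl, rfl⟩ := Prod.mk.inj heq
    obtain ⟨-, rfl⟩ := h
    obtain ⟨-, rfl⟩ := h'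
    rfl
  · rintro ⟨i, j⟩ h hne
    simp only [Finset.mem_product, Finset.mem_range] at h
    exact ⟨⟨i + j, i, j⟩, by simp; lia, hne, rfl⟩
  · simp

/-- The action of a power series on a locally nilpotent operator is multiplicative. -/
theorem IsLocallyNilpotent.nilSeries_mul {N : Module.End ℂ V} (hN : IsLocallyNilpotent N)
    (f g : PowerSeries ℂ) :
    nilSeries (fun k => PowerSeries.coeff k (f * g)) N =
      nilSeries (fun k => PowerSeries.coeff k f) N *
        nilSeries (fun k => PowerSeries.coeff k g) N := by
  ext v
  obtain ⟨K, hK⟩ := hN v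
  have h0 {n : ℕ} (h : K ≤ n) : (N ^ n) v = 0 := Module.End.pow_apply_eq_zero_of_le h hK
  rw [Module.End.mul_apply, hN.nilSeries_apply (fun k => PowerSeries.coeff k g) hK, map_sum,
    hN.nilSeries_apply _ (h0 (show K ≤ 2 * K by lia))]
  simp only [PowerSeries.coeff_mul, Finset.sum_smul]
  have h1 : ∀ n, ∑ p ∈ Finset.HasAntidiagonal.antidiagonal n,
      (PowerSeries.coeff p.1 f * PowerSeries.coeff p.2 g) • (N ^ n) v =
      ∑ p ∈ Finset.HasAntidiagonal.antidiagonal n, (PowerSeries.coeff p.1 f * PowerSeries.coeff p.2 g) •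
        (N ^ (p.1 + p.2)) v := fun n => Finset.sum_congr rfl fun p hp => by
    rw [Finset.HasAntidiagonal.mem_antidiagonal.1 hp]
  simp only [h1]
  rw [sum_range_antidiagonal_eq (F := fun i j => (PowerSeries.coeff i f *
      PowerSeries.coeff j g) • (N ^ (i + j)) v) (K := K) (L := K)
      (fun i j h => by simp [h0 (show K ≤ i + j by lia)])
      (fun i j h => by simp [h0 (show K ≤ i + j by lia)]) (by lia), Finset.sum_comm]
  refine Finset.sum_congr rfl fun j _ => ?_
  have h2 : (N ^ K) (PowerSeries.coeff j g • (N ^ j) v) = 0 := by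
    rw [map_smul, ← Module.End.mul_apply, ← pow_add, h0 (by lia), smul_zero]
  rw [hN.nilSeries_apply _ h2]
  refine Finset.sum_congr rfl fun i _ => ?_
  rw [map_smul, smul_smul, ← Module.End.mul_apply, ← pow_add]

theorem IsLocallyNilpotent.nilSeries_pow {N : Module.End ℂ V} (hN : IsLocallyNilpotent N)
    (f : PowerSeries ℂ) (n : ℕ) :
    nilSeries (fun k => PowerSeries.coeff k (f ^ n)) N =
      nilSeries (fun k => PowerSeries.coeff k f) N ^ n := by
  induction n with
  | zero =>
    ext v
    obtain ⟨K, hK⟩ := hN v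
    rw [hN.nilSeries_apply _ (Module.End.pow_apply_eq_zero_of_le (Nat.le_succ K) hK),
      Finset.sum_eq_single 0 (fun k _ hk => by simp [PowerSeries.coeff_one, hk]) (by simp)]
    simp
  | succ n ih => rw [pow_succ, hN.nilSeries_mul, ih, pow_succ]

/-- The exponential of a locally nilpotent operator. -/
noncomputable def nilExp (N : Module.End ℂ V) : Module.End ℂ V := nilSeries (fun k => (k.factorial : ℂ)⁻¹) N

theorem IsLocallyNilpotent.nilExp_apply {N : Module.End ℂ V} (hN : IsLocallyNilpotent N) {v : V}
    {K : ℕ} (hK : (N ^ K) v = 0) :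
    nilExp N v = ∑ k ∈ Finset.range K, (k.factorial : ℂ)⁻¹ • (N ^ k) v :=
  hN.nilSeries_apply _ hK

theorem nilExp_add {A B : Module.End ℂ V} (hA : IsLocallyNilpotent A) (hB : IsLocallyNilpotent B)
    (h : Commute A B) : nilExp (A + B) = nilExp A * nilExp B := by
  ext v
  obtain ⟨L, hL⟩ := hB v
  -- The nilpotency order of `A` depends on the vector; one `K` serves all `B ^ j v` with `j < L`.
  obtain ⟨K, hK⟩ := hA.exists_common (fun j => (B ^ j) v) L
  have hAB : ∀ i j, K ≤ i ∨ L ≤ j → (A ^ i) ((B ^ j) v) = 0 := by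
    intro i j hij
    rcases le_or_gt L j with h1 | h1
    · rw [Module.End.pow_apply_eq_zero_of_le h1 hL, map_zero]
    · exact Module.End.pow_apply_eq_zero_of_le (by lia) (hK j h1)
  have h1 (n : ℕ) : (n.factorial : ℂ)⁻¹ • ((A + B) ^ n) v = ∑ p ∈ Finset.HasAntidiagonal.antidiagonal n,
      ((p.1.factorial : ℂ)⁻¹ * (p.2.factorial : ℂ)⁻¹) • (A ^ p.1) ((B ^ p.2) v) := by
    rw [h.add_pow', LinearMap.sum_apply, Finset.smul_sum]
    refine Finset.sum_congr rfl fun p hp => ?_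
    rw [Finset.HasAntidiagonal.mem_antidiagonal] at hp
    rw [LinearMap.smul_apply, ← Nat.cast_smul_eq_nsmul ℂ, smul_smul, Module.End.mul_apply]
    congr 1
    subst hp
    have h2 := Nat.add_choose_mul_factorial_mul_factorial p.1 p.2
    have h3 : ((p.1 + p.2).choose p.1 : ℂ) * p.1.factorial * p.2.factorial =
      (p.1 + p.2).factorial := by
      rw [← Nat.choose_symm_add] at h2
      exact_mod_cast h2
    have h4 : (p.1.factorial : ℂ) ≠ 0 := Nat.cast_ne_zero.2 (Nat.factorial_ne_zero _)
    have h5 : (p.2.factorial : ℂ) ≠ 0 := Nat.cast_ne_zero.2 (Nat.factorial_ne_zero _)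
    have h6 : ((p.1 + p.2).factorial : ℂ) ≠ 0 := Nat.cast_ne_zero.2 (Nat.factorial_ne_zero _)
    field_simp
    linear_combination h3
  have hKL : ((A + B) ^ (K + L)) v = 0 := by
    have h2 := h1 (K + L)
    rw [Finset.sum_eq_zero] at h2
    · exact (smul_eq_zero.1 h2).resolve_left (by simp [Nat.factorial_ne_zero])
    · intro p hp
      rw [Finset.HasAntidiagonal.mem_antidiagonal] at hp
      rw [hAB _ _ (by lia), smul_zero]
  rw [Module.End.mul_apply, hB.nilExp_apply hL, map_sum, (hA.add hB h).nilExp_apply hKL]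
  simp only [h1]
  rw [sum_range_antidiagonal_eq (F := fun i j => ((i.factorial : ℂ)⁻¹ *
    (j.factorial : ℂ)⁻¹) • (A ^ i) ((B ^ j) v)) (K := K) (L := L)
    (fun i j h => by simp [hAB i j (.inl h)]) (fun i j h => by simp [hAB i j (.inr h)]) (by lia),
    Finset.sum_comm]
  refine Finset.sum_congr rfl fun j hj => ?_
  rw [map_smul, hA.nilExp_apply (hK j (Finset.mem_range.1 hj)), Finset.smul_sum]
  refine Finset.sum_congr rfl fun i _ => ?_
  rw [smul_smul, mul_comm]

theorem nilExp_zero : nilExp (0 : Module.End ℂ V) = 1 := by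
  have h0 : IsLocallyNilpotent (0 : Module.End ℂ V) := fun v => ⟨1, by simp⟩
  ext v
  rw [h0.nilExp_apply (K := 1) (by simp)]
  simp

theorem IsLocallyNilpotent.nilExp_neg_mul {A : Module.End ℂ V} (hA : IsLocallyNilpotent A) :
    nilExp (-A) * nilExp A = 1 := by
  rw [← nilExp_add hA.neg hA (Commute.neg_left rfl), neg_add_cancel, nilExp_zero]

theorem nilSeries_smul (c : ℕ → ℂ) (a : ℂ) {N : Module.End ℂ V} (hN : IsLocallyNilpotent N) :
    nilSeries c (a • N) = nilSeries (fun k => c k * a ^ k) N := by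
  ext v
  obtain ⟨K, hK⟩ := hN v
  rw [(hN.smul a).nilSeries_apply c (K := K) (by rw [smul_pow, LinearMap.smul_apply, hK, smul_zero]),
    hN.nilSeries_apply _ hK]
  simp [smul_pow, smul_smul]

end LinearAlgebra

/-! ### Additive and multiplicative Jordan decompositions and the logarithm of an operator. -/

section JordanDecomposition

variable {V M : Type*} [AddCommGroup V] [Module ℂ V] [AddCommGroup M] [Module ℂ M]

theorem Module.End.mem_maxGenEigenspace_of_commute {T A : Module.End ℂ V} (h : Commute A T)
    {μ : ℂ} {v : V} (hv : v ∈ T.maxGenEigenspace μ) : A v ∈ T.maxGenEigenspace μ :=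
  Module.End.mapsTo_maxGenEigenspace_of_comm h.symm μ hv

theorem Module.End.pow_apply_mem {T : Module.End ℂ V} {p : Submodule ℂ V}
    (h : ∀ v ∈ p, T v ∈ p) (k : ℕ) : ∀ v ∈ p, (T ^ k) v ∈ p := by
  induction k with
  | zero => simp
  | succ k ih => exact fun v hv => by rw [pow_succ']; exact h _ (ih v hv)

theorem Module.End.pow_apply_eq_pow_apply {T S : Module.End ℂ V} {p : Submodule ℂ V}
    (hT : ∀ v ∈ p, T v ∈ p) (h : ∀ v ∈ p, S v = T v) (k : ℕ) {v : V} (hv : v ∈ p) :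
    (S ^ k) v = (T ^ k) v := by
  induction k with
  | zero => simp
  | succ k ih =>
    rw [pow_succ', pow_succ', Module.End.mul_apply, Module.End.mul_apply, ih,
      h _ (Module.End.pow_apply_mem hT k v hv)]

/-- An operator that acts on each generalized eigenspace of `T` as some operator which is
nilpotent on its vectors is locally nilpotent. -/
theorem IsTriangularizable.isLocallyNilpotent {T N : Module.End ℂ V} (h : IsTriangularizable T)
    (hN : ∀ μ, ∀ v ∈ T.maxGenEigenspace μ, ∃ k : ℕ, (N ^ k) v = 0) : IsLocallyNilpotent N :=
  h.induction hN ⟨0, by simp⟩ fun v w ⟨k, hk⟩ ⟨l, hl⟩ => ⟨max k l, by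
    rw [map_add, Module.End.pow_apply_eq_zero_of_le (le_max_left k l) hk,
      Module.End.pow_apply_eq_zero_of_le (le_max_right k l) hl, add_zero]⟩

/-- The operator equal to `f μ` on the generalized eigenspace for `μ`, plus a commuting locally
nilpotent operator. -/
theorem IsTriangularizable.maxGenEigenspace_le_of_eq_jordanLift_add {T S N : Module.End ℂ V}
    (h : IsTriangularizable T) (f : ℂ → ℂ) (hN : IsLocallyNilpotent N) (hNT : Commute N T)
    (hS : S = jordanLift T (fun μ => f μ • LinearMap.id) + N) (μ : ℂ) :
    T.maxGenEigenspace μ ≤ S.maxGenEigenspace (f μ) := by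
  intro v hv
  rw [Module.End.mem_maxGenEigenspace]
  obtain ⟨k, hk⟩ := hN v
  refine ⟨k, ?_⟩
  rw [Module.End.pow_apply_eq_pow_apply (T := N) (p := T.maxGenEigenspace μ)
    (fun v hv => Module.End.mem_maxGenEigenspace_of_commute hNT hv) (fun v hv => ?_) k hv, hk]
  rw [hS, LinearMap.sub_apply, LinearMap.add_apply, h.jordanLift_apply _ hv]
  simp

theorem IsTriangularizable.semisimplePart_apply {T : Module.End ℂ V} (h : IsTriangularizable T)
    {μ : ℂ} {v : V} (hv : v ∈ T.maxGenEigenspace μ) : semisimplePart T v = μ • v := by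
  rw [semisimplePart, h.jordanLift_apply _ hv]
  rfl

theorem IsTriangularizable.nilpotentPart_apply {T : Module.End ℂ V} (h : IsTriangularizable T)
    {μ : ℂ} {v : V} (hv : v ∈ T.maxGenEigenspace μ) :
    nilpotentPart T v = (T - μ • (1 : Module.End ℂ V)) v := by
  rw [nilpotentPart, LinearMap.sub_apply, h.semisimplePart_apply hv]
  simp

theorem IsTriangularizable.commute_nilpotentPart {T A : Module.End ℂ V}
    (h : IsTriangularizable T) (hA : Commute A T) : Commute A (nilpotentPart T) :=
  hA.sub_right (h.commute_jordanLift hA _ fun μ => (Commute.one_right A).smul_right μ)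

theorem IsTriangularizable.isLocallyNilpotent_nilpotentPart {T : Module.End ℂ V}
    (h : IsTriangularizable T) : IsLocallyNilpotent (nilpotentPart T) := by
  refine h.isLocallyNilpotent fun μ v hv => ?_
  obtain ⟨k, hk⟩ := (Module.End.mem_maxGenEigenspace T μ v).1 hv
  refine ⟨k, ?_⟩
  rw [Module.End.pow_apply_eq_pow_apply (p := T.maxGenEigenspace μ)
    (fun v hv => Module.End.mem_maxGenEigenspace_of_commute ?_ hv)
    (fun v hv => h.nilpotentPart_apply hv) k hv, hk]
  exact (Commute.refl T).sub_left ((Commute.one_left T).smul_left μ)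

/-- Uniqueness of the additive Jordan decomposition: an eigenspace of `T` for `μ` lies in the one of
`S` for `f μ`, where both nilpotent parts are `S - f μ`. It is used to read off the nilpotent part
of `twistLog`. -/
theorem IsTriangularizable.nilpotentPart_eq_of_eq_jordanLift_add {T S N : Module.End ℂ V}
    (h : IsTriangularizable T) (f : ℂ → ℂ) (hN : IsLocallyNilpotent N) (hNT : Commute N T)
    (hS : S = jordanLift T (fun μ => f μ • LinearMap.id) + N) : nilpotentPart S = N := by
  have hle := h.maxGenEigenspace_le_of_eq_jordanLift_add f hN hNT hS
  have hS' := h.of_le f hle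
  refine h.ext fun μ v hv => ?_
  rw [hS'.nilpotentPart_apply (hle μ hv), LinearMap.sub_apply, hS, LinearMap.add_apply,
    h.jordanLift_apply _ hv]
  simp

/-- `x ^ T` on a generalized eigenspace of `T`. -/
theorem IsTriangularizable.xPow_apply {T : Module.End ℂ V} (h : IsTriangularizable T)
    {μ : ℂ} {v : V} (hv : v ∈ T.maxGenEigenspace μ) {K : ℕ} (hK : (nilpotentPart T ^ K) v = 0) :
    xPow T v = ∑ k ∈ Finset.range K,
      Finsupp.single (μ, k) ((k.factorial : ℂ)⁻¹ • (nilpotentPart T ^ k) v) := by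
  rw [xPow, h.jordanLift_apply _ hv, LinearMap.comp_apply,
    lsum_finsuppOfLocallyFinite h.isLocallyNilpotent_nilpotentPart.exists_forall _
    fun n hn => Module.End.pow_apply_eq_zero_of_le hn hK]
  simp

theorem IsTriangularizable.expTwoPiI_apply {T : Module.End ℂ V} (h : IsTriangularizable T)
    {μ : ℂ} {v : V} (hv : v ∈ T.maxGenEigenspace μ) :
    expTwoPiI T v = Complex.exp (2 * Real.pi * Complex.I * μ) •
      nilExp ((2 * Real.pi * Complex.I : ℂ) • nilpotentPart T) v := by
  rw [expTwoPiI, h.jordanLift_apply _ hv, nilExp, nilSeries_smul _ _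
    h.isLocallyNilpotent_nilpotentPart, LinearMap.smul_apply]
  simp only [div_eq_inv_mul]

theorem Module.End.maxGenEigenspace_neg_le (T : Module.End ℂ V) (μ : ℂ) :
    T.maxGenEigenspace μ ≤ (-T).maxGenEigenspace (-μ) := by
  intro v hv
  rw [Module.End.mem_maxGenEigenspace] at hv ⊢
  obtain ⟨k, hk⟩ := hv
  refine ⟨k, ?_⟩
  rw [show -T - (-μ) • (1 : Module.End ℂ V) = -(T - μ • 1) by rw [neg_smul]; abel, neg_pow,
    Module.End.mul_apply, hk, map_zero]

theorem IsTriangularizable.neg {T : Module.End ℂ V} (h : IsTriangularizable T) :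
    IsTriangularizable (-T) :=
  h.of_le (fun μ => -μ) T.maxGenEigenspace_neg_le

theorem IsTriangularizable.nilpotentPart_neg {T : Module.End ℂ V} (h : IsTriangularizable T) :
    nilpotentPart (-T) = -nilpotentPart T := by
  refine h.ext fun μ v hv => ?_
  rw [h.neg.nilpotentPart_apply (T.maxGenEigenspace_neg_le μ hv), LinearMap.neg_apply,
    h.nilpotentPart_apply hv]
  simp only [LinearMap.sub_apply, LinearMap.neg_apply, LinearMap.smul_apply, neg_smul]
  abel

/-! ### The logarithm of a locally unipotent operator -/

/-- With `F = exp (log (1 + X))`, the chain rule gives `(1 + X) F' = F`. In coefficients, `(n + 1)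
c_{n+1} = (1 - n) c_n` with `c_0 = 1`, so `c_1 = 1` and `c_2 = 0`, and then all later coefficients
vanish. -/
theorem PowerSeries.exp_subst_log : (PowerSeries.exp ℂ).subst (PowerSeries.log ℂ) = 1 + X := by
  set F := (PowerSeries.exp ℂ).subst (PowerSeries.log ℂ) with hF
  have hs : HasSubst (PowerSeries.log ℂ) := HasSubst.log
  have h1 : (1 + X : PowerSeries ℂ) * PowerSeries.derivative ℂ (PowerSeries.log ℂ) = 1 := by
    ext n
    rw [PowerSeries.deriv_log, add_mul, one_mul, map_add]
    cases n with
    | zero => simp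
    | succ n => simp [PowerSeries.coeff_succ_X_mul, PowerSeries.coeff_one, pow_succ]
  have h2 : PowerSeries.derivative ℂ F = F * PowerSeries.derivative ℂ (PowerSeries.log ℂ) := by
    rw [hF, PowerSeries.derivative_subst hs, PowerSeries.derivative_exp]
  have h3 : PowerSeries.derivative ℂ F * (1 + X) = F := by
    rw [h2, mul_assoc, mul_comm _ (1 + X), h1, mul_one]
  have hF0 : PowerSeries.coeff 0 F = 1 := by
    rw [hF, PowerSeries.coeff_subst' hs, finsum_eq_single _ 0]
    · simp
    · intro d hd
      rw [PowerSeries.coeff_zero_eq_constantCoeff_apply, map_pow,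
        PowerSeries.constantCoeff_log, zero_pow hd, smul_zero]
  have h4 (n : ℕ) : PowerSeries.coeff (n + 1) F * (n + 1) = (1 - n) * PowerSeries.coeff n F := by
    have := congrArg (PowerSeries.coeff n) h3
    rw [mul_add, mul_one, map_add, PowerSeries.coeff_derivative] at this
    cases n with
    | zero => simpa using this
    | succ n =>
      rw [PowerSeries.coeff_succ_mul_X, PowerSeries.coeff_derivative] at this
      push_cast at this ⊢
      linear_combination this
  have hF1 : PowerSeries.coeff 1 F = 1 := by simpa [hF0] using h4 0
  have hF2 (n : ℕ) : PowerSeries.coeff (n + 2) F = 0 := by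
    induction n with
    | zero => simpa [hF1] using h4 1
    | succ n ih =>
      have := h4 (n + 2)
      rw [ih, mul_zero, mul_eq_zero] at this
      exact this.resolve_right (by norm_cast)
  ext n
  match n with
  | 0 => simp [hF0]
  | 1 => simp [hF1, PowerSeries.coeff_one]
  | n + 2 => simp [hF2, PowerSeries.coeff_one, PowerSeries.coeff_X]

namespace IsLocallyNilpotent

variable {N A B : Module.End ℂ V}

theorem nilSeries_of_constantCoeff (hN : IsLocallyNilpotent N) {g : PowerSeries ℂ}
    (hg : PowerSeries.constantCoeff g = 0) :
    IsLocallyNilpotent (nilSeries (fun k => PowerSeries.coeff k g) N) := by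
  intro v
  obtain ⟨K, hK⟩ := hN v
  refine ⟨K, ?_⟩
  rw [← hN.nilSeries_pow, hN.nilSeries_apply _ hK]
  refine Finset.sum_eq_zero fun k hk => ?_
  rw [PowerSeries.coeff_of_lt_order k, zero_smul]
  exact lt_of_lt_of_le (by exact_mod_cast Finset.mem_range.1 hk)
    (PowerSeries.le_order_pow_of_constantCoeff_eq_zero K hg)

/-- Composition of power series in a locally nilpotent operator. -/
theorem nilSeries_subst (hN : IsLocallyNilpotent N) (f : PowerSeries ℂ) {g : PowerSeries ℂ}
    (hg : PowerSeries.constantCoeff g = 0) :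
    nilSeries (fun k => PowerSeries.coeff k f) (nilSeries (fun k => PowerSeries.coeff k g) N) =
      nilSeries (fun k => PowerSeries.coeff k (f.subst g)) N := by
  ext v
  obtain ⟨K, hK⟩ := hN v
  have hlt {k d : ℕ} (h : k < d) : PowerSeries.coeff k (g ^ d) = 0 := by
    refine PowerSeries.coeff_of_lt_order k (lt_of_lt_of_le (by exact_mod_cast h)
      (PowerSeries.le_order_pow_of_constantCoeff_eq_zero d hg))
  have hK' : (nilSeries (fun k => PowerSeries.coeff k g) N ^ K) v = 0 := by
    rw [← hN.nilSeries_pow, hN.nilSeries_apply _ hK]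
    exact Finset.sum_eq_zero fun k hk => by rw [hlt (Finset.mem_range.1 hk), zero_smul]
  rw [(hN.nilSeries_of_constantCoeff hg).nilSeries_apply _ hK', hN.nilSeries_apply _ hK]
  simp only [← hN.nilSeries_pow, hN.nilSeries_apply _ hK, Finset.smul_sum, smul_smul]
  rw [Finset.sum_comm]
  refine Finset.sum_congr rfl fun k hk => ?_
  rw [← Finset.sum_smul, PowerSeries.coeff_subst' (PowerSeries.HasSubst.of_constantCoeff_zero' hg)]
  congr 1
  rw [finsum_eq_sum_of_support_subset (s := Finset.range K)]
  · rfl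
  · intro d hd
    by_contra hd'
    rw [Finset.coe_range, Set.mem_Iio, not_lt] at hd'
    exact hd (by simp only [hlt (lt_of_lt_of_le (Finset.mem_range.1 hk) hd'), smul_zero])

theorem nilExp_log (hN : IsLocallyNilpotent N) :
    nilExp (nilSeries (fun k => PowerSeries.coeff k (PowerSeries.log ℂ)) N) = 1 + N := by
  have h1 : nilExp (nilSeries (fun k => PowerSeries.coeff k (PowerSeries.log ℂ)) N) =
      nilSeries (fun k => PowerSeries.coeff k (PowerSeries.exp ℂ))
        (nilSeries (fun k => PowerSeries.coeff k (PowerSeries.log ℂ)) N) := by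
    rw [nilExp]
    congr 1
    ext k
    simp [PowerSeries.coeff_exp]
  rw [h1, hN.nilSeries_subst _ PowerSeries.constantCoeff_log, PowerSeries.exp_subst_log]
  ext v
  obtain ⟨K, hK⟩ := hN v
  rw [hN.nilSeries_apply _ (Module.End.pow_apply_eq_zero_of_le (show K ≤ K + 2 by lia) hK),
    Finset.sum_range_succ', Finset.sum_range_succ']
  simp [PowerSeries.coeff_one, PowerSeries.coeff_X, add_comm]

/-- Descent on the nilpotency order: if `A ^ (k + 2) v = 0`, then the exponential sends `A ^ k v` to
`A ^ k v + A ^ (k + 1) v`, so `A ^ (k + 1) v = 0` already. -/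
theorem eq_zero_of_nilExp_eq_one (hA : IsLocallyNilpotent A) (h : nilExp A = 1) : A = 0 := by
  ext v
  have key : ∀ k : ℕ, (A ^ (k + 1)) v = 0 → A v = 0 := by
    intro k
    induction k with
    | zero => simp
    | succ k ih =>
      intro hk
      apply ih
      have h1 := hA.nilExp_apply (v := (A ^ k) v) (K := 2)
        (by rw [← Module.End.mul_apply, ← pow_add, add_comm, hk])
      rw [h] at h1
      simpa [Finset.sum_range_succ, ← Module.End.mul_apply, ← pow_succ'] using h1
  obtain ⟨k, hk⟩ := hA v
  exact key k (Module.End.pow_apply_eq_zero_of_le (Nat.le_succ k) hk)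

theorem eq_of_nilExp_eq (hA : IsLocallyNilpotent A) (hB : IsLocallyNilpotent B)
    (hAB : Commute A B) (h : nilExp A = nilExp B) : A = B := by
  have hc : Commute (-B) A := hAB.symm.neg_left
  have h1 : nilExp (-B + A) = 1 := by
    rw [nilExp_add hB.neg hA hc, h, hB.nilExp_neg_mul]
  have := (hB.neg.add hA hc).eq_zero_of_nilExp_eq_one h1
  rwa [neg_add_eq_zero, eq_comm] at this

end IsLocallyNilpotent

/-! ### The logarithm of an invertible operator -/

theorem Module.End.eq_zero_of_mem_maxGenEigenspace_zero {g : Module.End ℂ V}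
    (hg : Function.Injective g) {v : V} (hv : v ∈ g.maxGenEigenspace 0) : v = 0 := by
  obtain ⟨k, hk⟩ := (Module.End.mem_maxGenEigenspace g 0 v).1 hv
  rw [zero_smul, sub_zero, Module.End.coe_pow] at hk
  exact hg.iterate k (hk.trans (by rw [← Module.End.coe_pow, map_zero]))

theorem twoPiI_ne_zero : (2 * Real.pi * Complex.I : ℂ) ≠ 0 := Complex.two_pi_I_ne_zero

theorem exp_unitStripLog {μ : ℂ} (hμ : μ ≠ 0) :
    Complex.exp (2 * Real.pi * Complex.I * unitStripLog μ) = μ := by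
  rw [unitStripLog, mul_sub, mul_div_cancel₀ _ twoPiI_ne_zero, Complex.exp_sub,
    Complex.exp_log hμ, mul_comm (2 * (Real.pi : ℂ) * Complex.I), Complex.exp_int_mul_two_pi_mul_I,
    div_one]

/-- Both sides have the same exponential. The integer `n` corrects for leaving the strip `0 ≤ Re <
1`; in the Jacobi identity it disappears into the sum over all integral powers in the delta
function. -/
theorem exists_unitStripLog_eq {μ : ℂ} (hμ : μ ≠ 0) (ν : ℂ) :
    ∃ n : ℤ, unitStripLog (μ * Complex.exp (2 * Real.pi * Complex.I * ν)) =
      unitStripLog μ + ν + n := by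
  have h1 : Complex.exp (2 * Real.pi * Complex.I *
      unitStripLog (μ * Complex.exp (2 * Real.pi * Complex.I * ν))) =
      Complex.exp (2 * Real.pi * Complex.I * (unitStripLog μ + ν)) := by
    rw [exp_unitStripLog (mul_ne_zero hμ (Complex.exp_ne_zero _)), mul_add, Complex.exp_add,
      exp_unitStripLog hμ]
  obtain ⟨n, hn⟩ := Complex.exp_eq_exp_iff_exists_int.1 h1
  refine ⟨n, mul_left_cancel₀ twoPiI_ne_zero ?_⟩
  linear_combination hn

namespace IsTriangularizable

variable {g T : Module.End ℂ V}

theorem unipotentPart_apply (h : IsTriangularizable g) {μ : ℂ} {v : V}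
    (hv : v ∈ g.maxGenEigenspace μ) : unipotentPart g v = μ⁻¹ • g v := by
  rw [unipotentPart, h.jordanLift_apply _ hv, LinearMap.smul_apply]

theorem commute_unipotentPart (h : IsTriangularizable g) {A : Module.End ℂ V} (hA : Commute A g) :
    Commute A (unipotentPart g) :=
  h.commute_jordanLift hA _ fun _ => hA.smul_right _

/-- On the generalized eigenspace for `μ ≠ 0`, the operator is `μ⁻¹ (g - μ)`. Injectivity excludes
`μ = 0`, where `μ⁻¹` has only its default value. -/
theorem isLocallyNilpotent_unipotentPart_sub_one (h : IsTriangularizable g)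
    (hg : Function.Injective g) : IsLocallyNilpotent (unipotentPart g - 1) := by
  refine h.isLocallyNilpotent fun μ v hv => ?_
  rcases eq_or_ne μ 0 with rfl | hμ
  · exact ⟨0, by simpa using Module.End.eq_zero_of_mem_maxGenEigenspace_zero hg hv⟩
  obtain ⟨k, hk⟩ := (Module.End.mem_maxGenEigenspace g μ v).1 hv
  refine ⟨k, ?_⟩
  rw [Module.End.pow_apply_eq_pow_apply (T := μ⁻¹ • (g - μ • (1 : Module.End ℂ V)))
    (p := g.maxGenEigenspace μ) (fun v hv => Module.End.mem_maxGenEigenspace_of_commute ?_ hv)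
    (fun v hv => ?_) k hv, smul_pow, LinearMap.smul_apply, hk, smul_zero]
  · exact ((Commute.refl g).sub_left ((Commute.one_left g).smul_left μ)).smul_left _
  · rw [LinearMap.sub_apply, h.unipotentPart_apply hv]
    simp [smul_sub, smul_smul, hμ]

theorem nilpotentLog_eq (h : IsTriangularizable g) (hg : Function.Injective g) :
    (2 * Real.pi * Complex.I : ℂ) • nilpotentLog g =
      nilSeries (fun k => PowerSeries.coeff k (PowerSeries.log ℂ)) (unipotentPart g - 1) := by
  have hN := h.isLocallyNilpotent_unipotentPart_sub_one hg
  ext v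
  obtain ⟨K, hK⟩ := hN v
  rw [nilpotentLog, LinearMap.smul_apply, hN.nilSeries_apply _ hK, hN.nilSeries_apply _ hK,
    Finset.smul_sum]
  refine Finset.sum_congr rfl fun k _ => ?_
  rw [smul_smul]
  congr 1
  rw [PowerSeries.coeff_log]
  split_ifs with hk
  · simp
  · have := twoPiI_ne_zero
    have hk' : (k : ℂ) ≠ 0 := Nat.cast_ne_zero.2 hk
    simp only [eq_ratCast, Rat.cast_div, Rat.cast_pow, Rat.cast_neg, Rat.cast_one,
      Rat.cast_natCast]
    field_simp

theorem isLocallyNilpotent_nilpotentLog (h : IsTriangularizable g) (hg : Function.Injective g) :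
    IsLocallyNilpotent (nilpotentLog g) := by
  have h1 := ((h.isLocallyNilpotent_unipotentPart_sub_one hg).nilSeries_of_constantCoeff
    PowerSeries.constantCoeff_log).smul (2 * Real.pi * Complex.I : ℂ)⁻¹
  rwa [← h.nilpotentLog_eq hg, smul_smul, inv_mul_cancel₀ twoPiI_ne_zero, one_smul] at h1

theorem commute_nilpotentLog (h : IsTriangularizable g) (hg : Function.Injective g)
    {A : Module.End ℂ V} (hA : Commute A g) : Commute A (nilpotentLog g) :=
  (h.isLocallyNilpotent_unipotentPart_sub_one hg).commute_nilSeries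
    ((h.commute_unipotentPart hA).sub_right (Commute.one_right A)) _

theorem nilExp_nilpotentLog (h : IsTriangularizable g) (hg : Function.Injective g) :
    nilExp ((2 * Real.pi * Complex.I : ℂ) • nilpotentLog g) = unipotentPart g := by
  rw [h.nilpotentLog_eq hg, (h.isLocallyNilpotent_unipotentPart_sub_one hg).nilExp_log]
  abel

theorem maxGenEigenspace_le_twistLog (h : IsTriangularizable g) (hg : Function.Injective g)
    (μ : ℂ) : g.maxGenEigenspace μ ≤ (twistLog g).maxGenEigenspace (unitStripLog μ) :=
  h.maxGenEigenspace_le_of_eq_jordanLift_add unitStripLog (h.isLocallyNilpotent_nilpotentLog hg)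
    (h.commute_nilpotentLog hg (Commute.refl g)).symm rfl μ

theorem twistLog (h : IsTriangularizable g) (hg : Function.Injective g) :
    IsTriangularizable (twistLog g) :=
  h.of_le unitStripLog (h.maxGenEigenspace_le_twistLog hg)

theorem nilpotentPart_twistLog (h : IsTriangularizable g) (hg : Function.Injective g) :
    nilpotentPart (_root_.twistLog g) = nilpotentLog g :=
  h.nilpotentPart_eq_of_eq_jordanLift_add unitStripLog (h.isLocallyNilpotent_nilpotentLog hg)
    (h.commute_nilpotentLog hg (Commute.refl g)).symm rfl

/-! ### The product of an invertible operator and a commuting exponential -/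

theorem isLocallyNilpotent_nilExp_sub_one {N : Module.End ℂ V} (hN : IsLocallyNilpotent N) :
    IsLocallyNilpotent (nilExp N - 1) := by
  have h1 : nilExp N - 1 = nilSeries
      (fun k => PowerSeries.coeff k (PowerSeries.exp ℂ - 1)) N := by
    ext v
    obtain ⟨K, hK⟩ := hN v
    have hK' := Module.End.pow_apply_eq_zero_of_le (Nat.le_succ K) hK
    rw [LinearMap.sub_apply, hN.nilExp_apply hK', hN.nilSeries_apply _ hK',
      Finset.sum_range_succ', Finset.sum_range_succ']
    simp [PowerSeries.coeff_exp, PowerSeries.coeff_one]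
  rw [h1]
  exact hN.nilSeries_of_constantCoeff (by simp)

/-- An explicit left inverse of `expTwoPiI T` is `e^(-2πi T_N)` composed with multiplication by
`e^(-2πi μ)` on each generalized eigenspace. -/
theorem injective_mul_expTwoPiI (hT : IsTriangularizable T) (hinj : Function.Injective g) :
    Function.Injective (g * expTwoPiI T) := by
  have hN := hT.isLocallyNilpotent_nilpotentPart.smul (2 * Real.pi * Complex.I : ℂ)
  rw [Module.End.coe_mul]
  refine hinj.comp ?_
  have h1 : nilExp (-((2 * Real.pi * Complex.I : ℂ) • nilpotentPart T)) *
      jordanLift T (fun μ => Complex.exp (-(2 * Real.pi * Complex.I * μ)) •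
        (LinearMap.id : V →ₗ[ℂ] V)) * expTwoPiI T = 1 := by
    refine hT.ext fun μ v hv => ?_
    have hc : Commute (nilExp ((2 * Real.pi * Complex.I : ℂ) • nilpotentPart T)) T :=
      (hN.commute_nilSeries ((hT.commute_nilpotentPart (Commute.refl T)).smul_right _) _).symm
    rw [Module.End.mul_apply, Module.End.mul_apply, hT.expTwoPiI_apply hv, map_smul,
      hT.jordanLift_apply _ (Module.End.mem_maxGenEigenspace_of_commute hc hv),
      LinearMap.smul_apply, smul_smul, ← Complex.exp_add, add_neg_cancel, Complex.exp_zero,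
      one_smul, LinearMap.id_apply, ← Module.End.mul_apply, hN.nilExp_neg_mul]
  intro v w hvw
  have := congrArg (nilExp (-((2 * Real.pi * Complex.I : ℂ) • nilpotentPart T)) *
      jordanLift T (fun μ => Complex.exp (-(2 * Real.pi * Complex.I * μ)) •
        (LinearMap.id : V →ₗ[ℂ] V))) hvw
  rwa [← Module.End.mul_apply, ← Module.End.mul_apply, h1, Module.End.one_apply,
    Module.End.one_apply] at this

variable (hg : IsTriangularizable g) (hT : IsTriangularizable T) (hgT : Commute g T)
  (hinj : Function.Injective g)
include hg hT hgT hinj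

/-- With `U` the unipotent part and `E` the exponential, `U E - 1 = E (U - 1) + (E - 1)` is a sum of
commuting locally nilpotent operators. -/
theorem isLocallyNilpotent_unipotent_product :
    IsLocallyNilpotent (unipotentPart g *
      nilExp ((2 * Real.pi * Complex.I : ℂ) • nilpotentPart T) - 1) := by
  set N := (2 * Real.pi * Complex.I : ℂ) • nilpotentPart T with hN
  have hN1 : IsLocallyNilpotent N := hT.isLocallyNilpotent_nilpotentPart.smul _
  have hc : Commute (unipotentPart g) N :=
    (hT.commute_nilpotentPart (hg.commute_unipotentPart hgT.symm).symm).smul_right _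
  have hc' : Commute (unipotentPart g) (nilExp N) := hN1.commute_nilSeries hc _
  have h1 : unipotentPart g * nilExp N - 1 =
      nilExp N * (unipotentPart g - 1) + (nilExp N - 1) := by
    rw [hc'.eq]; noncomm_ring
  rw [h1]
  refine ((hg.isLocallyNilpotent_unipotentPart_sub_one hinj).mul_left ?_).add
    (isLocallyNilpotent_nilExp_sub_one hN1) ?_
  · exact hc'.symm.sub_right (Commute.one_right _)
  · have : Commute (unipotentPart g - 1) (nilExp N) := hc'.sub_left (Commute.one_left _)
    exact ((Commute.refl _).mul_left this).sub_right (Commute.one_right _)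

/-- This exhibits the multiplicative Jordan decomposition of the product: a scalar on each joint
generalized eigenspace times a unipotent operator. -/
theorem mul_expTwoPiI_apply {μ ν : ℂ} {v : V} (hμ : v ∈ g.maxGenEigenspace μ)
    (hν : v ∈ T.maxGenEigenspace ν) :
    (g * expTwoPiI T) v = (μ * Complex.exp (2 * Real.pi * Complex.I * ν)) •
      (unipotentPart g * nilExp ((2 * Real.pi * Complex.I : ℂ) • nilpotentPart T)) v := by
  rcases eq_or_ne μ 0 with rfl | h0
  · simp [Module.End.eq_zero_of_mem_maxGenEigenspace_zero hinj hμ]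
  have hc : Commute (nilExp ((2 * Real.pi * Complex.I : ℂ) • nilpotentPart T)) g :=
    ((hT.isLocallyNilpotent_nilpotentPart.smul _).commute_nilSeries
      ((hT.commute_nilpotentPart hgT).smul_right _) _).symm
  rw [Module.End.mul_apply, Module.End.mul_apply, hT.expTwoPiI_apply hν,
    hg.unipotentPart_apply (Module.End.mem_maxGenEigenspace_of_commute hc hμ), map_smul, smul_smul]
  congr 1
  field_simp

theorem mem_maxGenEigenspace_mul_expTwoPiI {μ ν : ℂ} {v : V} (hμ : v ∈ g.maxGenEigenspace μ)
    (hν : v ∈ T.maxGenEigenspace ν) : v ∈ (g * expTwoPiI T).maxGenEigenspace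
      (μ * Complex.exp (2 * Real.pi * Complex.I * ν)) := by
  set U := unipotentPart g * nilExp ((2 * Real.pi * Complex.I : ℂ) • nilpotentPart T) with hU
  set c := μ * Complex.exp (2 * Real.pi * Complex.I * ν)
  have hUg : Commute U g := by
    refine ((hg.commute_unipotentPart (Commute.refl g)).mul_right ?_).symm
    exact (hT.isLocallyNilpotent_nilpotentPart.smul _).commute_nilSeries
      ((hT.commute_nilpotentPart hgT).smul_right _) _
  have hUT : Commute U T := by
    refine ((hg.commute_unipotentPart hgT.symm).mul_right ?_)|>.symm
    exact (hT.isLocallyNilpotent_nilpotentPart.smul _).commute_nilSeries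
      ((hT.commute_nilpotentPart (Commute.refl T)).smul_right _) _
  obtain ⟨k, hk⟩ := isLocallyNilpotent_unipotent_product hg hT hgT hinj v
  rw [Module.End.mem_maxGenEigenspace]
  refine ⟨k, ?_⟩
  rw [Module.End.pow_apply_eq_pow_apply (T := c • (U - 1))
    (p := g.maxGenEigenspace μ ⊓ T.maxGenEigenspace ν) ?_ ?_ k ⟨hμ, hν⟩, smul_pow,
    LinearMap.smul_apply, hk, smul_zero]
  · exact fun w hw => ⟨Module.End.mem_maxGenEigenspace_of_commute
      ((hUg.sub_left (Commute.one_left _)).smul_left _) hw.1,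
      Module.End.mem_maxGenEigenspace_of_commute
      ((hUT.sub_left (Commute.one_left _)).smul_left _) hw.2⟩
  · intro w hw
    rw [LinearMap.sub_apply, mul_expTwoPiI_apply hg hT hgT hinj hw.1 hw.2]
    simp [smul_sub, U, c]

theorem mul_expTwoPiI : IsTriangularizable (g * expTwoPiI T) := by
  rw [IsTriangularizable, eq_top_iff]
  rintro v -
  refine hg.joint_induction hT hgT (p := fun v =>
    v ∈ ⨆ μ, (g * expTwoPiI T).maxGenEigenspace μ) ?_ (zero_mem _) (fun v w => add_mem) v
  intro μ ν v hμ hν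
  exact Submodule.mem_iSup_of_mem _ (mem_maxGenEigenspace_mul_expTwoPiI hg hT hgT hinj hμ hν)

theorem unipotentPart_mul_expTwoPiI : unipotentPart (g * expTwoPiI T) =
    unipotentPart g * nilExp ((2 * Real.pi * Complex.I : ℂ) • nilpotentPart T) := by
  refine hg.joint_ext hT hgT fun μ ν v hμ hν => ?_
  rcases eq_or_ne μ 0 with rfl | h0
  · simp [Module.End.eq_zero_of_mem_maxGenEigenspace_zero hinj hμ]
  rw [(mul_expTwoPiI hg hT hgT hinj).unipotentPart_apply
    (mem_maxGenEigenspace_mul_expTwoPiI hg hT hgT hinj hμ hν),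
    mul_expTwoPiI_apply hg hT hgT hinj hμ hν, smul_smul,
    inv_mul_cancel₀ (mul_ne_zero h0 (Complex.exp_ne_zero _)), one_smul]

/-- `𝓝_{g e^{2πiT}} = 𝓝_g + T_N` for commuting `g` and `T`. -/
theorem nilpotentLog_mul_expTwoPiI :
    nilpotentLog (g * expTwoPiI T) = nilpotentLog g + nilpotentPart T := by
  have h := mul_expTwoPiI hg hT hgT hinj
  have hi := injective_mul_expTwoPiI hT hinj
  have hN := hT.isLocallyNilpotent_nilpotentPart
  have hL := hg.isLocallyNilpotent_nilpotentLog hinj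
  have hc1 : Commute g (nilpotentLog g) := hg.commute_nilpotentLog hinj (Commute.refl g)
  have hc2 : Commute g (nilpotentPart T) := hT.commute_nilpotentPart hgT
  have hc3 : Commute (nilpotentLog g) (nilpotentPart T) :=
    hT.commute_nilpotentPart (hg.commute_nilpotentLog hinj hgT.symm).symm
  have hc4 : Commute (nilpotentLog g) (expTwoPiI T) := by
    refine hT.commute_jordanLift (hg.commute_nilpotentLog hinj hgT.symm).symm _ fun μ => ?_
    exact (hN.commute_nilSeries hc3 _).smul_right _
  have hc5 : Commute (nilpotentPart T) (expTwoPiI T) := by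
    refine hT.commute_jordanLift (hT.commute_nilpotentPart (Commute.refl T)).symm _ fun μ => ?_
    exact (hN.commute_nilSeries (Commute.refl _) _).smul_right _
  have hc : Commute (nilpotentLog g + nilpotentPart T) (nilpotentLog (g * expTwoPiI T)) :=
    h.commute_nilpotentLog hi ((hc1.symm.mul_right hc4).add_left (hc2.symm.mul_right hc5))
  -- Both sides are locally nilpotent, commute, and have as exponential the unipotent part of the
  -- product; the exponential is injective on commuting locally nilpotent operators.
  have key : (2 * Real.pi * Complex.I : ℂ) • nilpotentLog (g * expTwoPiI T) =
      (2 * Real.pi * Complex.I : ℂ) • (nilpotentLog g + nilpotentPart T) := by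
    refine ((h.isLocallyNilpotent_nilpotentLog hi).smul _).eq_of_nilExp_eq
      ((hL.add hN hc3).smul _) ((hc.symm.smul_left _).smul_right _) ?_
    rw [h.nilExp_nilpotentLog hi, unipotentPart_mul_expTwoPiI hg hT hgT hinj, smul_add,
      nilExp_add (hL.smul _) (hN.smul _) ((hc3.smul_left _).smul_right _),
      hg.nilExp_nilpotentLog hinj]
  exact smul_right_injective _ twoPiI_ne_zero key

end IsTriangularizable

end JordanDecomposition

/-! ### Modes, conformal weights and the weight filtration. -/

namespace VertexOperatorAlgebra

variable {V : Type*} [AddCommGroup V] [Module ℂ V] (𝒱 : VertexOperatorAlgebra V)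

/-- The `n`-th product as a bilinear map. -/
noncomputable def modeHom (n : ℤ) : V →ₗ[ℂ] Module.End ℂ V :=
  LinearMap.proj n ∘ₗ VertexOperator.ncoeff ∘ₗ 𝒱.Y

theorem modeHom_apply (n : ℤ) (a : V) : 𝒱.modeHom n a = 𝒱.mode a n := rfl

theorem mode_add (a b : V) (n : ℤ) : 𝒱.mode (a + b) n = 𝒱.mode a n + 𝒱.mode b n :=
  map_add (𝒱.modeHom n) a b

theorem mode_smul (c : ℂ) (a : V) (n : ℤ) : 𝒱.mode (c • a) n = c • 𝒱.mode a n :=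
  map_smul (𝒱.modeHom n) c a

theorem mode_zero (n : ℤ) : 𝒱.mode 0 n = 0 := map_zero (𝒱.modeHom n)

theorem mode_sum {ι : Type*} (s : Finset ι) (f : ι → V) (n : ℤ) :
    𝒱.mode (∑ i ∈ s, f i) n = ∑ i ∈ s, 𝒱.mode (f i) n :=
  map_sum (𝒱.modeHom n) f s

/-- The commutator formula. -/
theorem mode_commutator (a b c : V) (m n : ℤ) :
    𝒱.mode a m (𝒱.mode b n c) - 𝒱.mode b n (𝒱.mode a m c) =
      ∑ᶠ i : ℕ, ((Ring.choose m i : ℤ) : ℂ) • 𝒱.mode (𝒱.mode a i b) (m + n - i) c := by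
  have h := 𝒱.jacobi a b c 0 m n
  rw [finsum_eq_single (fun i : ℕ => ((-1 : ℂ) ^ i * ((Ring.choose (0 : ℤ) i : ℤ) : ℂ)) • _) 0
      (fun i hi => by simp [Ring.choose_zero_ite, hi]),
    finsum_eq_single (fun i : ℕ => ((-1 : ℂ) ^ ((0 : ℤ) - i) *
      ((Ring.choose (0 : ℤ) i : ℤ) : ℂ)) • _) 0
      (fun i hi => by simp [Ring.choose_zero_ite, hi])] at h
  simp only [zero_add] at h
  simp only [mode]
  rw [h]
  simp

theorem mode_commutator_nat (a b : V) (m : ℕ) (n : ℤ) :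
    𝒱.mode a m * 𝒱.mode b n - 𝒱.mode b n * 𝒱.mode a m =
      ∑ i ∈ Finset.range (m + 1), (m.choose i : ℂ) • 𝒱.mode (𝒱.mode a i b) (m + n - i) := by
  ext c
  rw [LinearMap.sub_apply, Module.End.mul_apply, Module.End.mul_apply, 𝒱.mode_commutator,
    finsum_eq_sum_of_support_subset (s := Finset.range (m + 1))]
  · simp [Ring.choose_natCast]
  · intro i hi
    by_contra hi'
    simp only [Finset.coe_range, Set.mem_Iio, not_lt] at hi'
    exact hi (by simp [Ring.choose_natCast, Nat.choose_eq_zero_of_lt (show m < i by lia)])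

theorem mode_zero_derivation (a b c : V) (n : ℤ) :
    𝒱.mode a 0 (𝒱.mode b n c) = 𝒱.mode (𝒱.mode a 0 b) n c + 𝒱.mode b n (𝒱.mode a 0 c) := by
  have h := LinearMap.congr_fun (𝒱.mode_commutator_nat a b 0 n) c
  simp only [LinearMap.sub_apply, Module.End.mul_apply] at h
  rw [← sub_eq_iff_eq_add]
  simpa using h

theorem mode_vac (n : ℤ) : 𝒱.mode 𝒱.vac n = if n = -1 then 1 else 0 := 𝒱.vac_mode n

theorem mode_L_neg_one (v : V) (n : ℤ) :
    𝒱.mode (𝒱.mode 𝒱.omega 0 v) n = (-(n : ℂ)) • 𝒱.mode v (n - 1) := 𝒱.L_neg_one v n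

theorem iSup_grade : ⨆ n, 𝒱.grade n = ⊤ := 𝒱.grade_internal.submodule_iSup_eq_top

theorem grade_ext {M : Type*} [AddCommGroup M] [Module ℂ M] {f f' : V →ₗ[ℂ] M}
    (h : ∀ n, ∀ v ∈ 𝒱.grade n, f v = f' v) : f = f' := by
  ext v
  refine Submodule.iSup_induction 𝒱.grade (motive := fun v => f v = f' v)
    (by rw [𝒱.iSup_grade]; trivial) h (by simp) (fun v w hv hw => by simp [hv, hw])

/-- Since `L(0)` acts by distinct scalars on distinct homogeneous subspaces, `L(0) - k` is
invertible off `V_(k)`. Thus membership in `V_(k)` can be tested by an eigenvalue equation. -/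
theorem mem_grade_of_eigen {k : ℤ} {x : V} (hx : 𝒱.mode 𝒱.omega 1 x = (k : ℂ) • x) :
    x ∈ 𝒱.grade k := by
  set P := internalLift 𝒱.grade 𝒱.grade_internal
    (fun i => if i = k then (LinearMap.id : V →ₗ[ℂ] V) else 0) with hP
  set Q := internalLift 𝒱.grade 𝒱.grade_internal
    (fun i => ((i : ℂ) - k)⁻¹ • (LinearMap.id : V →ₗ[ℂ] V)) with hQ
  -- `P` projects onto `V_(k)` and `Q` inverts `L(0) - k` on the other homogeneous subspaces; at `i
  -- = k` the scalar in `Q` is the default `0⁻¹ = 0`, which is harmless because `L(0) - k` vanishes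
  -- there.
  have h1 : Q ∘ₗ (𝒱.mode 𝒱.omega 1 - (k : ℂ) • (1 : Module.End ℂ V)) + P = LinearMap.id := by
    refine 𝒱.grade_ext fun n v hv => ?_
    have h2 : 𝒱.mode 𝒱.omega 1 v = (n : ℂ) • v := 𝒱.L_zero n v hv
    rw [LinearMap.add_apply, LinearMap.comp_apply, LinearMap.sub_apply, h2]
    rw [LinearMap.smul_apply, Module.End.one_apply, ← sub_smul, map_smul, hP, hQ,
      internalLift_apply _ _ _ hv, internalLift_apply _ _ _ hv]
    by_cases hn : n = k
    · simp [hn]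
    · have : (n : ℂ) - k ≠ 0 := sub_ne_zero.2 (by exact_mod_cast hn)
      simp [hn, smul_smul, this]
  have h3 : P x = x := by
    have := LinearMap.congr_fun h1 x
    simpa [hx] using this
  have h4 : ∀ y, P y ∈ 𝒱.grade k := by
    intro y
    refine Submodule.iSup_induction 𝒱.grade (motive := fun y => P y ∈ 𝒱.grade k)
      (x := y) (by rw [𝒱.iSup_grade]; trivial) ?_ (by simp)
      (fun v w hv hw => by rw [map_add]; exact add_mem hv hw)
    intro n v hv
    rw [hP, internalLift_apply _ _ _ hv]
    by_cases hn : n = k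
    · subst hn; simpa using hv
    · simp [hn]
  rw [← h3]
  exact h4 x

/-- The homogeneity of modes is not an axiom here. The commutator formula for `L(0) = ω_1`, with the
`L(-1)`-derivative property, gives `[L(0), a_n] = (p - n - 1) a_n`. -/
theorem mode_mem_grade {p q : ℤ} {a b : V} (ha : a ∈ 𝒱.grade p) (hb : b ∈ 𝒱.grade q) (n : ℤ) :
    𝒱.mode a n b ∈ 𝒱.grade (p + q - n - 1) := by
  apply 𝒱.mem_grade_of_eigen
  have h := LinearMap.congr_fun (𝒱.mode_commutator_nat 𝒱.omega a 1 n) b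
  have ha' : 𝒱.mode 𝒱.omega 1 a = (p : ℂ) • a := 𝒱.L_zero p a ha
  have hb' : 𝒱.mode 𝒱.omega 1 b = (q : ℂ) • b := 𝒱.L_zero q b hb
  simp only [Finset.sum_range_succ, Finset.sum_range_zero, LinearMap.sub_apply,
    Module.End.mul_apply, LinearMap.add_apply, LinearMap.smul_apply, Nat.cast_zero, Nat.cast_one,
    ha', hb', mode_L_neg_one, mode_smul, map_smul] at h
  rw [sub_eq_iff_eq_add] at h
  rw [h]
  simp only [sub_zero, add_sub_cancel_left, Nat.choose_zero_right, Nat.choose_self, Nat.cast_one,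
    one_smul, LinearMap.zero_apply, zero_add, ← add_smul]
  push_cast
  congr 1
  ring

/-- The sum of the homogeneous subspaces of weight at most `q`. -/
def filtration (q : ℤ) : Submodule ℂ V := ⨆ (i : ℤ) (_ : i ≤ q), 𝒱.grade i

theorem grade_le_filtration {p q : ℤ} (h : p ≤ q) : 𝒱.grade p ≤ 𝒱.filtration q :=
  le_iSup₂_of_le p h le_rfl

theorem filtration_mono {p q : ℤ} (h : p ≤ q) : 𝒱.filtration p ≤ 𝒱.filtration q :=
  iSup₂_le fun _ hi => 𝒱.grade_le_filtration (hi.trans h)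

theorem filtration_induction {q : ℤ} {p : V → Prop} (mem : ∀ i ≤ q, ∀ v ∈ 𝒱.grade i, p v)
    (zero : p 0) (add : ∀ v w, p v → p w → p (v + w)) {v : V} (hv : v ∈ 𝒱.filtration q) : p v := by
  rw [filtration, iSup_subtype'] at hv
  exact Submodule.iSup_induction (fun i : {i : ℤ // i ≤ q} => 𝒱.grade i) (motive := p) hv
    (fun i => mem i.1 i.2) zero add

theorem exists_mem_filtration (v : V) : ∃ q : ℕ, v ∈ 𝒱.filtration q := by
  refine Submodule.iSup_induction 𝒱.grade (motive := fun v => ∃ q : ℕ, v ∈ 𝒱.filtration q)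
    (x := v) (by rw [𝒱.iSup_grade]; trivial) (fun i v hv => ?_) ⟨0, zero_mem _⟩ ?_
  · exact ⟨i.toNat, 𝒱.grade_le_filtration (Int.self_le_toNat i) hv⟩
  · rintro v w ⟨p, hp⟩ ⟨q, hq⟩
    exact ⟨max p q, add_mem (𝒱.filtration_mono (by simp) hp) (𝒱.filtration_mono (by simp) hq)⟩

theorem mode_mem_filtration {p q : ℤ} {a b : V} (ha : a ∈ 𝒱.filtration p)
    (hb : b ∈ 𝒱.filtration q) (n : ℤ) : 𝒱.mode a n b ∈ 𝒱.filtration (p + q - n - 1) := by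
  refine 𝒱.filtration_induction (p := fun a => 𝒱.mode a n b ∈ 𝒱.filtration (p + q - n - 1))
    (fun i hi a ha => ?_) (by simp [mode_zero])
    (fun v w hv hw => by rw [mode_add]; exact add_mem hv hw) ha
  refine 𝒱.filtration_induction (p := fun b => 𝒱.mode a n b ∈ 𝒱.filtration (p + q - n - 1))
    (fun j hj b hb => ?_) (by simp)
    (fun v w hv hw => by rw [map_add]; exact add_mem hv hw) hb
  exact 𝒱.grade_le_filtration (by lia) (𝒱.mode_mem_grade ha hb n)

theorem filtration_eq_bot (hVneg : ∀ n : ℤ, n < 0 → 𝒱.grade n = ⊥) {q : ℤ} (hq : q < 0) :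
    𝒱.filtration q = ⊥ := by
  rw [filtration, eq_bot_iff]
  exact iSup₂_le fun i hi => (hVneg i (by lia)).le

/-- The product would lie in weights at most `p + q - n - 1 < 0`. This explicit bound supplies the
truncation index `J` wherever an iterate is written as a finite sum. -/
theorem mode_eq_zero (hVneg : ∀ n : ℤ, n < 0 → 𝒱.grade n = ⊥) {p q n : ℤ} {a b : V}
    (ha : a ∈ 𝒱.filtration p) (hb : b ∈ 𝒱.filtration q) (hn : p + q ≤ n) :
    𝒱.mode a n b = 0 := by
  have := 𝒱.mode_mem_filtration ha hb n
  rwa [𝒱.filtration_eq_bot hVneg (by lia), Submodule.mem_bot] at this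

theorem apply_mem_filtration {A : Module.End ℂ V} (hA : ∀ n, ∀ v ∈ 𝒱.grade n, A v ∈ 𝒱.grade n)
    {q : ℤ} {v : V} (hv : v ∈ 𝒱.filtration q) : A v ∈ 𝒱.filtration q :=
  𝒱.filtration_induction (p := fun v => A v ∈ 𝒱.filtration q)
    (fun i hi v hv => 𝒱.grade_le_filtration hi (hA i v hv)) (by simp)
    (fun v w hv hw => by rw [map_add]; exact add_mem hv hw) hv

theorem isTriangularizable {A : Module.End ℂ V}
    (hA : ∀ n, ∀ v ∈ 𝒱.grade n, A v ∈ 𝒱.grade n) : IsTriangularizable A :=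
  IsTriangularizable.of_finite 𝒱.grade 𝒱.iSup_grade 𝒱.grade_finite hA

/-- An operator commuting with `L(0)` preserves the homogeneous subspaces. -/
theorem mem_grade_of_commute {A : Module.End ℂ V} (hA : Commute A (𝒱.mode 𝒱.omega 1)) (n : ℤ)
    {v : V} (hv : v ∈ 𝒱.grade n) : A v ∈ 𝒱.grade n := by
  apply 𝒱.mem_grade_of_eigen
  rw [← Module.End.mul_apply, ← hA.eq, Module.End.mul_apply,
    show 𝒱.mode 𝒱.omega 1 v = (n : ℂ) • v from 𝒱.L_zero n v hv, map_smul]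

namespace Automorphism

variable {𝒱} (g : 𝒱.Automorphism)

theorem op_mode (a b : V) (n : ℤ) : g.op (𝒱.mode a n b) = 𝒱.mode (g.op a) n (g.op b) :=
  g.map_mode a b n

theorem commute_op_mode {a : V} (ha : g.op a = a) (n : ℤ) : Commute g.op (𝒱.mode a n) := by
  ext v
  rw [Module.End.mul_apply, Module.End.mul_apply, op_mode, ha]

theorem injective_op : Function.Injective g.op := g.toLinearEquiv.injective

theorem op_mem_grade (n : ℤ) {v : V} (hv : v ∈ 𝒱.grade n) : g.op v ∈ 𝒱.grade n :=
  𝒱.mem_grade_of_commute (g.commute_op_mode g.map_omega 1) n hv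

theorem isTriangularizable_op : IsTriangularizable g.op :=
  𝒱.isTriangularizable fun n _ hv => g.op_mem_grade n hv

end Automorphism

section WeightOne

variable {u : V} (hu : u ∈ 𝒱.grade 1)
include hu

theorem mode_one_mem_grade (n : ℤ) {q : ℤ} {v : V} (hv : v ∈ 𝒱.grade q) :
    𝒱.mode u n v ∈ 𝒱.grade (q - n) := by
  convert 𝒱.mode_mem_grade hu hv n using 2
  ring

theorem zeroMode_mem_grade {q : ℤ} {v : V} (hv : v ∈ 𝒱.grade q) : 𝒱.mode u 0 v ∈ 𝒱.grade q := by
  simpa using 𝒱.mode_one_mem_grade hu 0 hv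

theorem isTriangularizable_zeroMode : IsTriangularizable (𝒱.mode u 0) :=
  𝒱.isTriangularizable fun _ _ hv => 𝒱.zeroMode_mem_grade hu hv

theorem mode_one_mem_filtration (n : ℤ) {q : ℤ} {v : V} (hv : v ∈ 𝒱.filtration q) :
    𝒱.mode u n v ∈ 𝒱.filtration (q - n) := by
  convert 𝒱.mode_mem_filtration (𝒱.grade_le_filtration le_rfl hu) hv n using 2
  ring

variable (hV0 : 𝒱.grade 0 = Submodule.span ℂ {𝒱.vac})
  (hVneg : ∀ n : ℤ, n < 0 → 𝒱.grade n = ⊥)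
include hV0 hVneg

/-- The nonnegative modes of a vector of weight one commute. -/
theorem commute_mode_nonneg (m n : ℕ) : Commute (𝒱.mode u m) (𝒱.mode u n) := by
  have h2 (i : ℕ) (hi : 2 ≤ i) : 𝒱.mode u i u = 0 := by
    have := 𝒱.mode_mem_grade hu hu i
    rwa [hVneg _ (by lia), Submodule.mem_bot] at this
  obtain ⟨k, hk⟩ : ∃ k : ℂ, k • 𝒱.vac = 𝒱.mode u 1 u := by
    have := 𝒱.mode_mem_grade hu hu 1
    rw [show (1 : ℤ) + 1 - 1 - 1 = 0 by ring, hV0] at this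
    exact Submodule.mem_span_singleton.1 this
  have key (m n : ℤ) (hmn : m + n ≠ 0 ∨ m = 0) (c : V) :
      𝒱.mode u m (𝒱.mode u n c) - 𝒱.mode u n (𝒱.mode u m c) =
        𝒱.mode (𝒱.mode u 0 u) (m + n) c := by
    rw [𝒱.mode_commutator, finsum_eq_single _ 0]
    · simp
    · intro i hi
      rcases eq_or_ne i 1 with rfl | hi1
      · rw [Nat.cast_one, ← hk, mode_smul, mode_vac]
        rcases hmn with h | h
        · rw [if_neg (by lia)]; simp
        · simp [h]
      · rw [h2 i (by lia), mode_zero, LinearMap.zero_apply, smul_zero]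
  -- On the vacuum, `[u_0, u_{-1}]` and `[u_{-1}, u_0]` are both equal to `u_0 u` by creation, so
  -- `u_0 u` is its own negative.
  have huu : 𝒱.mode u 0 u = 0 := by
    have h3 := key 0 (-1) (by simp) 𝒱.vac
    have h4 := key (-1) 0 (by simp) 𝒱.vac
    have h5 : 𝒱.mode (𝒱.mode u 0 u) (-1) 𝒱.vac = 𝒱.mode u 0 u := 𝒱.creation _
    simp only [zero_add, add_zero, h5] at h3 h4
    have h6 : (2 : ℂ) • 𝒱.mode u 0 u = 0 := by
      rw [two_smul]
      nth_rewrite 1 [← h3]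
      rw [← h4]
      abel
    simpa using h6
  ext c
  rw [Module.End.mul_apply, Module.End.mul_apply, ← sub_eq_zero,
    key m n (by lia) c, huu, mode_zero, LinearMap.zero_apply]

end WeightOne

end VertexOperatorAlgebra

/-! ### First order equations for power series with noncommuting coefficients. -/

section PowerSeriesEuler

variable {R : Type*} [Ring R]

/-- The Euler derivation `X d/dX` on power series over a possibly noncommutative ring. -/
noncomputable def PowerSeries.euler (f : PowerSeries R) : PowerSeries R :=
  PowerSeries.mk fun n => n • PowerSeries.coeff n f

namespace PowerSeries

theorem coeff_euler (f : PowerSeries R) (n : ℕ) : coeff n (euler f) = n • coeff n f :=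
  coeff_mk _ _

theorem euler_mul (f g : PowerSeries R) : euler (f * g) = euler f * g + f * euler g := by
  ext n
  rw [map_add, coeff_euler, coeff_mul, coeff_mul, coeff_mul, Finset.smul_sum,
    ← Finset.sum_add_distrib]
  refine Finset.sum_congr rfl fun p hp => ?_
  rw [coeff_euler, coeff_euler, ← Finset.HasAntidiagonal.mem_antidiagonal.1 hp, add_smul,
    smul_mul_assoc, mul_smul_comm]

theorem euler_C (a : R) : euler (C a) = 0 := by
  ext n
  rw [coeff_euler, coeff_C]
  split_ifs with h <;> simp [h]

theorem commute_of_coeff {f g : PowerSeries R} (h : ∀ m n, Commute (coeff m f) (coeff n g)) :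
    Commute f g := by
  ext n
  rw [coeff_mul, coeff_mul, ← Finset.Nat.sum_antidiagonal_swap]
  exact Finset.sum_congr rfl fun p _ => h _ _

/-- Over a noncommutative ring the power rule needs `f` to commute with its own derivative, so that
the factor `euler f` can be collected on the left. -/
theorem euler_pow_succ {f : PowerSeries R} (h : Commute f (euler f)) (n : ℕ) :
    euler (f ^ (n + 1)) = (n + 1) • (euler f * f ^ n) := by
  induction n with
  | zero => simp
  | succ n ih =>
    rw [pow_succ, euler_mul, ih, (h.pow_left (n + 1)).eq, smul_mul_assoc, mul_assoc, ← pow_succ,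
      succ_nsmul _ (n + 1)]

theorem coeff_pow_eq_zero_of_lt {f : PowerSeries R} (h : coeff 0 f = 0) {k n : ℕ} (hkn : n < k) :
    coeff n (f ^ k) = 0 := by
  induction k generalizing n with
  | zero => lia
  | succ k ih =>
    rw [pow_succ, coeff_mul]
    refine Finset.sum_eq_zero fun p hp => ?_
    have := Finset.HasAntidiagonal.mem_antidiagonal.1 hp
    rcases Nat.eq_zero_or_pos p.2 with h0 | h0
    · rw [h0, h, mul_zero]
    · rw [ih (by lia), zero_mul]

/-- A first order differential equation without constant term has at most one solution with
given constant coefficient. -/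
theorem eq_of_euler_eq_mul [IsAddTorsionFree R] {e f g : PowerSeries R} (he : coeff 0 e = 0)
    (hf : euler f = e * f) (hg : euler g = e * g) (h0 : coeff 0 f = coeff 0 g) : f = g := by
  ext n
  induction n using Nat.strong_induction_on with
  | _ n ih =>
    rcases Nat.eq_zero_or_pos n with rfl | hn
    · exact h0
    · have hf' := congrArg (coeff n) hf
      have hg' := congrArg (coeff n) hg
      rw [coeff_euler, coeff_mul] at hf' hg'
      refine nsmul_right_injective (by lia : n ≠ 0) ?_
      change n • coeff n f = n • coeff n g
      rw [hf', hg']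
      -- After multiplication by `n`, the right side involves only lower coefficients, as the
      -- constant term of `e` is zero.
      refine Finset.sum_congr rfl fun p hp => ?_
      have := Finset.HasAntidiagonal.mem_antidiagonal.1 hp
      rcases Nat.eq_zero_or_pos p.1 with h1 | h1
      · rw [h1, he, zero_mul, zero_mul]
      · rw [ih p.2 (by lia)]

end PowerSeries

end PowerSeriesEuler

/-! ### Binomial coefficients polynomial in the exponent. -/

section Binomial

/-- The polynomial with value `Ring.choose (-μ - m) j` at `μ`. -/
noncomputable def negBinomial (m j : ℕ) : Polynomial ℂ :=
  (j.factorial : ℂ)⁻¹ • (descPochhammer ℂ j).comp (-Polynomial.X - Polynomial.C (m : ℂ))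

theorem eval_negBinomial (m j : ℕ) (μ : ℂ) :
    (negBinomial m j).eval μ = Ring.choose (-μ - m) j := by
  rw [Ring.choose_eq_smul, negBinomial, ← Polynomial.aeval_eq_smeval, Polynomial.aeval_def,
    Polynomial.eval₂_eq_eval_map, algebraMap_int_eq, descPochhammer_map]
  simp [Polynomial.eval_smul, Polynomial.eval_comp]

theorem negBinomial_zero (m : ℕ) : negBinomial m 0 = 1 := by
  refine Polynomial.funext fun μ => ?_
  simp [eval_negBinomial]

theorem negBinomial_one (m : ℕ) : negBinomial m 1 = -Polynomial.X - Polynomial.C (m : ℂ) := by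
  refine Polynomial.funext fun μ => ?_
  simp [eval_negBinomial]

theorem choose_neg_succ (p q : ℕ) :
    Ring.choose (-((p : ℂ) + 1)) q = (-1) ^ q * ((p + q).choose p : ℂ) := by
  have h := Ring.choose_neg ((p : ℂ) + 1) q
  rw [h, show (p : ℂ) + 1 + q - 1 = ((p + q : ℕ) : ℂ) by push_cast; ring, Ring.choose_natCast,
    ← Nat.choose_symm_add]
  rw [Units.smul_def, zsmul_eq_mul]
  simp [Int.negOnePow_def]

/-- Vandermonde's identity for `(1 + y)^(-p-1) (1 + y)^(-μ-m) = (1 + y)^(-μ-m-p-1)`. Proving it at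
every complex value gives it as an identity of polynomials, into which `Y_0(u)` can then be
substituted. -/
theorem sum_negBinomial (m p J : ℕ) :
    ∑ r ∈ Finset.HasAntidiagonal.antidiagonal J,
      ((-1 : ℂ) ^ r.1 * ((p + r.1).choose p : ℂ)) • negBinomial m r.2 =
        negBinomial (m + p + 1) J := by
  refine Polynomial.funext fun μ => ?_
  rw [eval_negBinomial, Polynomial.eval_finsetSum,
    show -μ - ((m + p + 1 : ℕ) : ℂ) = -((p : ℂ) + 1) + (-μ - m) by push_cast; ring,
    Ring.add_choose_eq J (Commute.all _ _)]
  refine Finset.sum_congr rfl fun r _ => ?_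
  rw [Polynomial.eval_smul, eval_negBinomial, choose_neg_succ, smul_eq_mul]

theorem ring_choose_succ_smul (z : ℂ) (j : ℕ) :
    ((j : ℂ) + 1) * Ring.choose z (j + 1) = (z - j) * Ring.choose z j := by
  have h1 := Ring.descPochhammer_eq_factorial_smul_choose z (j + 1)
  have h2 := Ring.descPochhammer_eq_factorial_smul_choose z j
  rw [descPochhammer_succ_right, Polynomial.smeval_mul, h2] at h1
  simp only [Polynomial.smeval_sub, Polynomial.smeval_X, pow_one, Polynomial.smeval_natCast,
    pow_zero, nsmul_eq_mul, mul_one, Nat.factorial_succ, Nat.cast_mul, Nat.cast_add,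
    Nat.cast_one] at h1
  have h3 : (j.factorial : ℂ) ≠ 0 := Nat.cast_ne_zero.2 (Nat.factorial_ne_zero _)
  apply mul_left_cancel₀ h3
  linear_combination -h1

theorem ring_choose_mul_sub (z : ℂ) (j : ℕ) :
    (z - j) * Ring.choose z j = z * Ring.choose (z - 1) j := by
  induction j with
  | zero => simp
  | succ j ih =>
    have h1 := ring_choose_succ_smul z j
    have h2 := ring_choose_succ_smul (z - 1) j
    have h3 : ((j : ℂ) + 1) ≠ 0 := Nat.cast_add_one_ne_zero j
    apply mul_left_cancel₀ h3
    push_cast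
    linear_combination (z - (j + 1)) * h1 + (z - (j + 1)) * ih - z * h2

/-- The absorption identity `(z - J) C(z, J) = z C(z - 1, J)` at `z = -μ - m`. -/
theorem X_add_mul_negBinomial (m J : ℕ) :
    (Polynomial.X + Polynomial.C (m : ℂ)) * negBinomial (m + 1) J =
      (Polynomial.X + Polynomial.C ((m : ℂ) + J)) * negBinomial m J := by
  refine Polynomial.funext fun μ => ?_
  have h := ring_choose_mul_sub (-μ - m) J
  simp only [Polynomial.eval_mul, Polynomial.eval_add, Polynomial.eval_X, Polynomial.eval_C,
    eval_negBinomial]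
  rw [show -μ - ((m + 1 : ℕ) : ℂ) = -μ - m - 1 by push_cast; ring]
  linear_combination h

end Binomial

/-- Both sides sum over two-by-two arrays with total `S`, grouped by rows or by columns;
transposition of the array is the bijection. -/
theorem sum_antidiagonal_antidiagonal_comm {M : Type*} [AddCommMonoid M] (S : ℕ)
    (F : ℕ → ℕ → ℕ → ℕ → M) :
    ∑ x ∈ Finset.HasAntidiagonal.antidiagonal S,
      ∑ a ∈ Finset.HasAntidiagonal.antidiagonal x.1,
        ∑ b ∈ Finset.HasAntidiagonal.antidiagonal x.2, F a.1 a.2 b.1 b.2 =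
    ∑ x ∈ Finset.HasAntidiagonal.antidiagonal S,
      ∑ a ∈ Finset.HasAntidiagonal.antidiagonal x.1,
        ∑ b ∈ Finset.HasAntidiagonal.antidiagonal x.2, F a.1 b.1 a.2 b.2 := by
  simp only [← Finset.sum_product', Finset.sum_sigma']
  refine Finset.sum_bij' (fun x _ => ⟨(x.2.1.1 + x.2.2.1, x.2.1.2 + x.2.2.2),
      ((x.2.1.1, x.2.2.1), (x.2.1.2, x.2.2.2))⟩)
    (fun x _ => ⟨(x.2.1.1 + x.2.2.1, x.2.1.2 + x.2.2.2),
      ((x.2.1.1, x.2.2.1), (x.2.1.2, x.2.2.2))⟩) ?_ ?_ ?_ ?_ ?_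
  · rintro ⟨⟨x, y⟩, ⟨a, b⟩, ⟨c, d⟩⟩ h
    simp only [Finset.mem_sigma, Finset.mem_product,
      Finset.HasAntidiagonal.mem_antidiagonal] at h ⊢
    lia
  · rintro ⟨⟨x, y⟩, ⟨a, b⟩, ⟨c, d⟩⟩ h
    simp only [Finset.mem_sigma, Finset.mem_product,
      Finset.HasAntidiagonal.mem_antidiagonal] at h ⊢
    lia
  · rintro ⟨⟨x, y⟩, ⟨a, b⟩, ⟨c, d⟩⟩ h
    simp only [Finset.mem_sigma, Finset.mem_product,
      Finset.HasAntidiagonal.mem_antidiagonal] at h ⊢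
    obtain ⟨-, rfl, rfl⟩ := h
    rfl
  · rintro ⟨⟨x, y⟩, ⟨a, b⟩, ⟨c, d⟩⟩ h
    simp only [Finset.mem_sigma, Finset.mem_product,
      Finset.HasAntidiagonal.mem_antidiagonal] at h ⊢
    obtain ⟨-, rfl, rfl⟩ := h
    rfl
  · rintro ⟨⟨x, y⟩, ⟨a, b⟩, ⟨c, d⟩⟩ h
    rfl

/-! ### The exponential factor of Δ and the conjugation formula. -/

namespace VertexOperatorAlgebra

variable {V : Type*} [AddCommGroup V] [Module ℂ V] (𝒱 : VertexOperatorAlgebra V)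

theorem coeff_euler_deltaExponent (u : V) (m : ℕ) :
    PowerSeries.coeff m (PowerSeries.euler (𝒱.deltaExponent u)) =
      if m = 0 then 0 else ((-1 : ℂ) ^ m) • 𝒱.mode u m := by
  rw [PowerSeries.coeff_euler, deltaExponent, PowerSeries.coeff_mk]
  split_ifs with h
  · simp
  · rw [← Nat.cast_smul_eq_nsmul ℂ, smul_smul, mul_div_cancel₀ _ (Nat.cast_ne_zero.2 h)]

theorem coeff_zero_deltaExponent (u : V) : PowerSeries.coeff 0 (𝒱.deltaExponent u) = 0 := by
  simp [deltaExponent]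

theorem deltaExpCoeff_zero (u : V) : 𝒱.deltaExpCoeff u 0 = 1 := by
  simp [deltaExpCoeff]

theorem deltaExpCoeff_eq (u : V) {n Q : ℕ} (h : n < Q) : 𝒱.deltaExpCoeff u n =
    ∑ k ∈ Finset.range Q, ((k.factorial : ℂ)⁻¹) • PowerSeries.coeff n (𝒱.deltaExponent u ^ k) := by
  rw [deltaExpCoeff]
  refine Finset.sum_subset (by simpa using h) fun k _ hk => ?_
  rw [PowerSeries.coeff_pow_eq_zero_of_lt (𝒱.coeff_zero_deltaExponent u) (by simpa using hk),
    smul_zero]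

/-- An operator commuting with the nonnegative modes of `u` commutes with the exponential factor
of `Δ`. -/
theorem commute_deltaExpCoeff {u : V} {A : Module.End ℂ V} (hA : ∀ n : ℕ, Commute A (𝒱.mode u n))
    (m : ℕ) : Commute A (𝒱.deltaExpCoeff u m) := by
  have h1 : Commute (PowerSeries.C A) (𝒱.deltaExponent u) := by
    refine PowerSeries.commute_of_coeff fun i j => ?_
    rw [PowerSeries.coeff_C, deltaExponent, PowerSeries.coeff_mk]
    split_ifs
    · simp
    · exact (hA _).smul_right _
    · simp
    · simp
  refine Commute.sum_right _ _ _ fun k _ => Commute.smul_right ?_ _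
  have h2 := congrArg (PowerSeries.coeff m) (h1.pow_right k).eq
  rw [PowerSeries.coeff_C_mul, PowerSeries.coeff_mul_C] at h2
  exact h2

section WeightOne

variable {u : V} (hu : u ∈ 𝒱.grade 1)
  (hV0 : 𝒱.grade 0 = Submodule.span ℂ {𝒱.vac})
  (hVneg : ∀ n : ℤ, n < 0 → 𝒱.grade n = ⊥)
include hu hV0 hVneg

/-- The differential equation satisfied by the exponential factor of `Δ`. -/
theorem euler_deltaExp : PowerSeries.euler (PowerSeries.mk (𝒱.deltaExpCoeff u)) =
    PowerSeries.euler (𝒱.deltaExponent u) * PowerSeries.mk (𝒱.deltaExpCoeff u) := by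
  have hc : Commute (𝒱.deltaExponent u) (PowerSeries.euler (𝒱.deltaExponent u)) := by
    refine PowerSeries.commute_of_coeff fun m n => ?_
    rw [coeff_euler_deltaExponent, deltaExponent, PowerSeries.coeff_mk]
    split_ifs
    · simp
    · simp
    · simp
    · exact ((𝒱.commute_mode_nonneg hu hV0 hVneg m n).smul_left _).smul_right _
  ext1 n
  rw [PowerSeries.coeff_euler, PowerSeries.coeff_mul]
  simp only [PowerSeries.coeff_mk]
  have h1 : ∀ p ∈ Finset.HasAntidiagonal.antidiagonal n,
      PowerSeries.coeff p.1 (PowerSeries.euler (𝒱.deltaExponent u)) * 𝒱.deltaExpCoeff u p.2 =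
      ∑ k ∈ Finset.range (n + 1), ((k.factorial : ℂ)⁻¹) •
        (PowerSeries.coeff p.1 (PowerSeries.euler (𝒱.deltaExponent u)) *
          PowerSeries.coeff p.2 (𝒱.deltaExponent u ^ k)) := by
    intro p hp
    have := Finset.HasAntidiagonal.mem_antidiagonal.1 hp
    rw [𝒱.deltaExpCoeff_eq u (show p.2 < n + 1 by lia), Finset.mul_sum]
    simp only [mul_smul_comm]
  -- One term more is taken on the left, so that after its constant term is split off, the power `k
  -- + 1` there meets the power `k` on the right, with `(k + 1) / (k + 1)! = 1 / k!`.
  rw [Finset.sum_congr rfl h1, Finset.sum_comm, 𝒱.deltaExpCoeff_eq u (show n < n + 2 by lia),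
    Finset.sum_range_succ']
  simp only [← Finset.smul_sum, ← PowerSeries.coeff_mul]
  have h0 : n • (((Nat.factorial 0 : ℕ) : ℂ)⁻¹ •
      PowerSeries.coeff n (𝒱.deltaExponent u ^ 0)) = 0 := by
    rcases Nat.eq_zero_or_pos n with rfl | hn
    · simp
    · simp [PowerSeries.coeff_one, hn.ne']
  rw [smul_add, h0, add_zero, Finset.smul_sum]
  refine Finset.sum_congr rfl fun k _ => ?_
  rw [← Nat.cast_smul_eq_nsmul ℂ, smul_comm, Nat.cast_smul_eq_nsmul, ← PowerSeries.coeff_euler,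
    PowerSeries.euler_pow_succ hc, map_nsmul, ← Nat.cast_smul_eq_nsmul ℂ, smul_smul]
  congr 1
  rw [Nat.factorial_succ]
  push_cast
  have h3 : (k.factorial : ℂ) ≠ 0 := Nat.cast_ne_zero.2 (Nat.factorial_ne_zero _)
  have h4 : ((k : ℂ) + 1) ≠ 0 := Nat.cast_add_one_ne_zero _
  field_simp

/-- The coefficient form of the equation for `D`, with the term of `Y_0(u)`, absent from the Euler
derivative of the exponent, added to both sides. -/
theorem sum_mode_mul_deltaExpCoeff (m : ℕ) :
    ∑ p ∈ Finset.HasAntidiagonal.antidiagonal m,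
      ((-1 : ℂ) ^ p.1) • (𝒱.mode u p.1 * 𝒱.deltaExpCoeff u p.2) =
        (m : ℂ) • 𝒱.deltaExpCoeff u m + 𝒱.mode u 0 * 𝒱.deltaExpCoeff u m := by
  have h := congrArg (PowerSeries.coeff m) (𝒱.euler_deltaExp hu hV0 hVneg)
  rw [PowerSeries.coeff_euler, PowerSeries.coeff_mul] at h
  simp only [PowerSeries.coeff_mk, coeff_euler_deltaExponent] at h
  rw [Nat.cast_smul_eq_nsmul, h]
  have h0 : (0, m) ∈ Finset.HasAntidiagonal.antidiagonal m := by simp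
  rw [← Finset.add_sum_erase _ _ h0, ← Finset.add_sum_erase _ _ h0, add_comm]
  simp only [Nat.cast_zero, pow_zero, one_smul, if_true, zero_mul, zero_add]
  congr 1
  refine Finset.sum_congr rfl fun p hp => ?_
  rw [if_neg, smul_mul_assoc]
  intro hp0
  rw [Finset.mem_erase, Finset.HasAntidiagonal.mem_antidiagonal] at hp
  exact hp.1 (Prod.ext hp0 (by simpa [hp0] using hp.2))

/-- The recursion `m D_m = ∑ (-1)^i u_i D_{m-i}` over `1 ≤ i ≤ m` lowers weights by `i + (m - i) =
m`. With no negative weights, it follows that `D(x) v` is a finite sum. -/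
theorem deltaExpCoeff_mem_filtration (m : ℕ) {q : ℤ} {v : V} (hv : v ∈ 𝒱.filtration q) :
    𝒱.deltaExpCoeff u m v ∈ 𝒱.filtration (q - m) := by
  induction m using Nat.strong_induction_on with
  | _ m ih =>
    rcases Nat.eq_zero_or_pos m with rfl | hm
    · simpa [deltaExpCoeff_zero] using hv
    have h := congrArg (PowerSeries.coeff m) (𝒱.euler_deltaExp hu hV0 hVneg)
    rw [PowerSeries.coeff_euler, PowerSeries.coeff_mul] at h
    simp only [PowerSeries.coeff_mk, coeff_euler_deltaExponent] at h
    have h' := LinearMap.congr_fun h v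
    rw [← Nat.cast_smul_eq_nsmul ℂ, LinearMap.smul_apply, LinearMap.sum_apply] at h'
    rw [← Submodule.smul_mem_iff _ (Nat.cast_ne_zero.2 hm.ne' : (m : ℂ) ≠ 0), h']
    refine Submodule.sum_mem _ fun p hp => ?_
    rw [Finset.HasAntidiagonal.mem_antidiagonal] at hp
    split_ifs with h0
    · simp
    · have := 𝒱.mode_one_mem_filtration hu p.1 (ih p.2 (by lia))
      rw [Module.End.mul_apply, LinearMap.smul_apply]
      refine Submodule.smul_mem _ _ ?_
      convert this using 2
      lia

theorem deltaExpCoeff_eq_zero {m : ℕ} {q : ℤ} {v : V} (hv : v ∈ 𝒱.filtration q) (hm : q < m) :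
    𝒱.deltaExpCoeff u m v = 0 := by
  have := 𝒱.deltaExpCoeff_mem_filtration hu hV0 hVneg m hv
  rwa [𝒱.filtration_eq_bot hVneg (by lia), Submodule.mem_bot] at this

theorem commute_mode_zero_deltaExpCoeff (m : ℕ) :
    Commute (𝒱.mode u 0) (𝒱.deltaExpCoeff u m) :=
  𝒱.commute_deltaExpCoeff (fun n => by
    simpa using 𝒱.commute_mode_nonneg hu hV0 hVneg 0 n) m

end WeightOne

/-- The coefficient of `(x₀/x) ^ j` in `x ^ m (1 + x₀/x) ^ (-Y_0(u) - m)` times the `m`-th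
coefficient of the exponential factor of `Δ`. -/
noncomputable def shiftedDeltaCoeff (u : V) (m j : ℕ) : Module.End ℂ V :=
  Polynomial.aeval (𝒱.mode u 0) (negBinomial m j) * 𝒱.deltaExpCoeff u m

theorem shiftedDeltaCoeff_zero (u : V) (m : ℕ) :
    𝒱.shiftedDeltaCoeff u m 0 = 𝒱.deltaExpCoeff u m := by
  simp [shiftedDeltaCoeff, negBinomial_zero]

section WeightOne

variable {u : V} (hu : u ∈ 𝒱.grade 1)
  (hV0 : 𝒱.grade 0 = Submodule.span ℂ {𝒱.vac})
  (hVneg : ∀ n : ℤ, n < 0 → 𝒱.grade n = ⊥)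
include hu hV0 hVneg

/-- The equation for `Δ` after the substitution `x ↦ x + x₀`, in coefficients. Vandermonde collects
the binomials over `b` into `negBinomial (m + 1) J`, the equation for `D` evaluates the sum over
`a`, and absorption returns to `negBinomial m J` with the factor `Y_0(u) + m + J`. -/
theorem sum_mode_mul_shiftedDeltaCoeff (m J : ℕ) :
    ∑ a ∈ Finset.HasAntidiagonal.antidiagonal m, ∑ b ∈ Finset.HasAntidiagonal.antidiagonal J,
      ((-1 : ℂ) ^ (a.1 + b.1) * ((a.1 + b.1).choose a.1 : ℂ)) •
        (𝒱.mode u a.1 * 𝒱.shiftedDeltaCoeff u a.2 b.2) =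
      ((m + J : ℕ) : ℂ) • 𝒱.shiftedDeltaCoeff u m J + 𝒱.mode u 0 * 𝒱.shiftedDeltaCoeff u m J := by
  have hT (p : Polynomial ℂ) (n : ℕ) : Commute (Polynomial.aeval (𝒱.mode u 0) p) (𝒱.mode u n) := by
    have h0 : Commute (𝒱.mode u n) (𝒱.mode u 0) := by
      simpa using 𝒱.commute_mode_nonneg hu hV0 hVneg n 0
    induction p using Polynomial.induction_on' with
    | add p q hp hq => rw [map_add]; exact hp.add_left hq
    | monomial k a =>
      rw [Polynomial.aeval_monomial]
      exact Commute.mul_left (Algebra.commutes a _) (h0.symm.pow_left k)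
  have h1 : ∀ a ∈ Finset.HasAntidiagonal.antidiagonal m,
      ∑ b ∈ Finset.HasAntidiagonal.antidiagonal J,
      ((-1 : ℂ) ^ (a.1 + b.1) * ((a.1 + b.1).choose a.1 : ℂ)) •
        (𝒱.mode u a.1 * 𝒱.shiftedDeltaCoeff u a.2 b.2) =
      Polynomial.aeval (𝒱.mode u 0) (negBinomial (m + 1) J) *
        ((-1 : ℂ) ^ a.1 • (𝒱.mode u a.1 * 𝒱.deltaExpCoeff u a.2)) := by
    intro a ha
    rw [Finset.HasAntidiagonal.mem_antidiagonal] at ha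
    rw [show m + 1 = a.2 + a.1 + 1 by lia, ← sum_negBinomial, map_sum, Finset.sum_mul]
    refine Finset.sum_congr rfl fun b _ => ?_
    rw [shiftedDeltaCoeff, ← mul_assoc, ← (hT _ a.1).eq, map_smul, smul_mul_assoc, mul_smul_comm,
      mul_assoc, smul_smul]
    congr 1
    ring
  rw [Finset.sum_congr rfl h1, ← Finset.mul_sum, 𝒱.sum_mode_mul_deltaExpCoeff hu hV0 hVneg]
  have h2 := congrArg (Polynomial.aeval (𝒱.mode u 0)) (X_add_mul_negBinomial m J)
  simp only [map_mul, map_add, Polynomial.aeval_X, Polynomial.aeval_C] at h2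
  have h3 := hT (negBinomial (m + 1) J) 0
  rw [Nat.cast_zero] at h3
  have h4 : (m : ℂ) • 𝒱.deltaExpCoeff u m + 𝒱.mode u 0 * 𝒱.deltaExpCoeff u m =
      (𝒱.mode u 0 + algebraMap ℂ (Module.End ℂ V) m) * 𝒱.deltaExpCoeff u m := by
    rw [add_mul, Algebra.smul_def, add_comm]
  rw [h4, ← mul_assoc, (h3.add_right (Algebra.commutes _ _ : Commute _ _).symm).eq, h2,
    shiftedDeltaCoeff]
  rw [add_mul, add_mul, mul_assoc, mul_assoc, ← map_add, Algebra.smul_def, add_comm]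
  push_cast
  rfl

/-- The conjugation formula `Δ(x) Y(v, x₀) = Y(Δ(x + x₀) v, x₀) Δ(x)`, up to the factors
`x ^ (-Y_0(u))`. -/
theorem deltaExp_conjugation (n : ℤ) (v : V) :
    PowerSeries.mk (𝒱.deltaExpCoeff u) * PowerSeries.C (𝒱.mode v n) =
      PowerSeries.mk (fun s => ∑ p ∈ Finset.HasAntidiagonal.antidiagonal s,
        𝒱.mode (𝒱.shiftedDeltaCoeff u p.1 p.2 v) (n + p.2)) *
        PowerSeries.mk (𝒱.deltaExpCoeff u) := by
  have hDE := 𝒱.euler_deltaExp hu hV0 hVneg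
  set e := PowerSeries.euler (𝒱.deltaExponent u) with he
  set Z : PowerSeries (Module.End ℂ V) := PowerSeries.mk (fun s =>
    ∑ p ∈ Finset.HasAntidiagonal.antidiagonal s,
        𝒱.mode (𝒱.shiftedDeltaCoeff u p.1 p.2 v) (n + p.2)) with hZ
  set D := PowerSeries.mk (𝒱.deltaExpCoeff u) with hD
  have he0 : PowerSeries.coeff 0 e = 0 := by simp [he, PowerSeries.coeff_euler]
  -- Given this commutator equation and the equation `e * D` for the derivative of `D`, the
  -- derivative of `Z * D` is `e * (Z * D)`, the equation also satisfied by the left side.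
  have key : PowerSeries.euler Z = e * Z - Z * e := by
    -- Adding the constant term `Y_0(u)` to `e` lets all modes be treated uniformly. Its commutator
    -- with `Z` is the extra `Y_0(u)` term of `sum_mode_mul_shiftedDeltaCoeff`, and is subtracted
    -- again at the end.
    set e' : PowerSeries (Module.End ℂ V) :=
      PowerSeries.mk fun i : ℕ => (-1 : ℂ) ^ i • 𝒱.mode u i with he'
    have hee : e' = e + PowerSeries.C (𝒱.mode u 0) := by
      ext1 i
      rw [map_add, he, coeff_euler_deltaExponent, he', PowerSeries.coeff_mk, PowerSeries.coeff_C]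
      split_ifs with h <;> simp [h]
    have h1 : e' * Z - Z * e' = PowerSeries.euler Z +
        (PowerSeries.C (𝒱.mode u 0) * Z - Z * PowerSeries.C (𝒱.mode u 0)) := by
      -- The commutator formula splits the index of the mode of `u` as `a.1 + a.2`: the part `a.1`
      -- acts on the vector and `a.2` raises the index of its mode.
      have hcomm : ∀ x : ℕ × ℕ, ((-1 : ℂ) ^ x.1 • 𝒱.mode u x.1) *
          (∑ p ∈ Finset.HasAntidiagonal.antidiagonal x.2,
            𝒱.mode (𝒱.shiftedDeltaCoeff u p.1 p.2 v) (n + p.2)) -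
          (∑ p ∈ Finset.HasAntidiagonal.antidiagonal x.2,
            𝒱.mode (𝒱.shiftedDeltaCoeff u p.1 p.2 v) (n + p.2)) *
              ((-1 : ℂ) ^ x.1 • 𝒱.mode u x.1) =
          ∑ a ∈ Finset.HasAntidiagonal.antidiagonal x.1,
            ∑ b ∈ Finset.HasAntidiagonal.antidiagonal x.2,
            ((-1 : ℂ) ^ (a.1 + a.2) * ((a.1 + a.2).choose a.1 : ℂ)) •
              𝒱.mode (𝒱.mode u a.1 (𝒱.shiftedDeltaCoeff u b.1 b.2 v)) (n + b.2 + a.2) := by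
        intro x
        rw [Finset.mul_sum, Finset.sum_mul, ← Finset.sum_sub_distrib, Finset.sum_comm]
        refine Finset.sum_congr rfl fun b _ => ?_
        rw [smul_mul_assoc, mul_smul_comm, ← smul_sub, 𝒱.mode_commutator_nat,
          Finset.Nat.sum_antidiagonal_eq_sum_range_succ_mk, Finset.smul_sum]
        refine Finset.sum_congr rfl fun i hi => ?_
        have hi' : i ≤ x.1 := by simpa [Nat.lt_succ_iff] using hi
        rw [smul_smul, Nat.add_sub_cancel' hi']
        congr 2
        push_cast [hi']
        ring
      ext1 S
      rw [map_sub, map_add, map_sub, PowerSeries.coeff_mul, PowerSeries.coeff_mul,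
        ← Finset.Nat.sum_antidiagonal_swap (n := S) (f := fun p =>
          PowerSeries.coeff p.1 Z * PowerSeries.coeff p.2 e'), ← Finset.sum_sub_distrib]
      simp only [Prod.fst_swap, Prod.snd_swap, hZ, he', PowerSeries.coeff_mk,
        PowerSeries.coeff_euler, PowerSeries.coeff_C_mul, PowerSeries.coeff_mul_C]
      rw [Finset.sum_congr rfl fun x _ => hcomm x]
      rw [sum_antidiagonal_antidiagonal_comm S (fun p q m j =>
        ((-1 : ℂ) ^ (p + q) * ((p + q).choose p : ℂ)) •
              𝒱.mode (𝒱.mode u p (𝒱.shiftedDeltaCoeff u m j v)) (n + j + q))]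
      rw [Finset.mul_sum, Finset.sum_mul, ← Finset.sum_sub_distrib, Finset.smul_sum,
        ← Finset.sum_add_distrib]
      refine Finset.sum_congr rfl fun x hx => ?_
      rw [Finset.HasAntidiagonal.mem_antidiagonal] at hx
      have h2 := LinearMap.congr_fun (𝒱.sum_mode_mul_shiftedDeltaCoeff hu hV0 hVneg x.1 x.2) v
      have h3 := congrArg (fun w => 𝒱.mode w (n + x.2)) h2
      simp only [LinearMap.sum_apply, LinearMap.add_apply, LinearMap.smul_apply,
        Module.End.mul_apply, mode_sum, mode_add, mode_smul] at h3
      have h4 : 𝒱.mode u 0 * 𝒱.mode (𝒱.shiftedDeltaCoeff u x.1 x.2 v) (n + x.2) -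
          𝒱.mode (𝒱.shiftedDeltaCoeff u x.1 x.2 v) (n + x.2) * 𝒱.mode u 0 =
          𝒱.mode (𝒱.mode u 0 (𝒱.shiftedDeltaCoeff u x.1 x.2 v)) (n + x.2) := by
        ext c
        rw [LinearMap.sub_apply, Module.End.mul_apply, Module.End.mul_apply,
          𝒱.mode_zero_derivation]
        abel
      rw [h4, ← hx, ← Nat.cast_smul_eq_nsmul ℂ, ← h3]
      refine Finset.sum_congr rfl fun a _ => Finset.sum_congr rfl fun b hb => ?_
      rw [Finset.HasAntidiagonal.mem_antidiagonal] at hb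
      rw [← hb]
      congr 2
      push_cast
      ring
    rw [hee, add_mul, mul_add] at h1
    have h5 : PowerSeries.euler Z = e * Z + PowerSeries.C (𝒱.mode u 0) * Z -
        (Z * e + Z * PowerSeries.C (𝒱.mode u 0)) -
        (PowerSeries.C (𝒱.mode u 0) * Z - Z * PowerSeries.C (𝒱.mode u 0)) := by
      rw [h1]; abel
    rw [h5]; abel
  have htf : IsAddTorsionFree (Module.End ℂ V) := IsAddTorsionFree.of_isTorsionFree ℂ _
  refine PowerSeries.eq_of_euler_eq_mul he0 ?_ ?_ ?_
  · rw [PowerSeries.euler_mul, hDE, PowerSeries.euler_C, mul_zero, add_zero, mul_assoc]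
  · rw [PowerSeries.euler_mul, hDE, key, sub_mul, mul_assoc, mul_assoc]
    abel
  · rw [PowerSeries.coeff_mul_C, PowerSeries.coeff_mul]
    simp [hD, hZ, deltaExpCoeff_zero, shiftedDeltaCoeff_zero]

theorem deltaExpCoeff_mode (M : ℕ) (n : ℤ) (v w : V) :
    𝒱.deltaExpCoeff u M (𝒱.mode v n w) = ∑ x ∈ Finset.HasAntidiagonal.antidiagonal M,
      ∑ p ∈ Finset.HasAntidiagonal.antidiagonal x.1,
        𝒱.mode (𝒱.shiftedDeltaCoeff u p.1 p.2 v) (n + p.2) (𝒱.deltaExpCoeff u x.2 w) := by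
  have h := LinearMap.congr_fun
    (congrArg (PowerSeries.coeff M) (𝒱.deltaExp_conjugation hu hV0 hVneg n v)) w
  rw [PowerSeries.coeff_mul_C, PowerSeries.coeff_mul] at h
  simpa [LinearMap.sum_apply] using h

end WeightOne

end VertexOperatorAlgebra

/-! ### Finite logarithmic sums acting through a vertex operator map. -/

section Series

variable {V W : Type*} [AddCommGroup V] [Module ℂ V] [AddCommGroup W] [Module ℂ W]

theorem logCoeff_apply (Y : V →ₗ[ℂ] W →ₗ[ℂ] LogSeries W) (v : V) (a : ℂ) (k : ℕ) (w : W) :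
    logCoeff Y v a k w = Y v w k a := rfl

theorem mulMonomial_apply (b : ℂ) (j : ℕ) (f : LogSeries W) (k : ℕ) (a : ℂ) :
    mulMonomial (W := W) b j f k a = if j ≤ k then f (k - j) (a - b) else 0 := by
  rw [mulMonomial, LinearMap.comp_apply, Finsupp.lmapDomain_apply]
  split_ifs with h
  · obtain ⟨i, rfl⟩ := Nat.exists_eq_add_of_le' h
    rw [Finsupp.mapDomain_apply (add_left_injective j)]
    simp [LinearMap.funLeft_apply]
  · rw [Finsupp.mapDomain_of_notMem_range]
    · rfl
    · rintro ⟨i, hi⟩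
      exact h (by simp at hi; lia)

/-- The map `(x, w) ↦ Y(x, x) w` for a finite sum `x` of terms `v x ^ a (log x) ^ k`. -/
noncomputable def seriesAction (Y : V →ₗ[ℂ] W →ₗ[ℂ] LogSeries W) :
    (ℂ × ℕ →₀ V) →ₗ[ℂ] W →ₗ[ℂ] LogSeries W :=
  Finsupp.lsum ℂ (fun p : ℂ × ℕ => Y.compr₂ (mulMonomial p.1 p.2))

theorem seriesAction_single (Y : V →ₗ[ℂ] W →ₗ[ℂ] LogSeries W) (p : ℂ × ℕ) (t : V) (w : W)
    (k : ℕ) (a : ℂ) : seriesAction Y (Finsupp.single p t) w k a =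
      if p.2 ≤ k then logCoeff Y t (a - p.1) (k - p.2) w else 0 := by
  rw [seriesAction, Finsupp.lsum_single, LinearMap.compr₂_apply, mulMonomial_apply]
  rfl

theorem seriesAction_lowerTruncation {Y : V →ₗ[ℂ] W →ₗ[ℂ] LogSeries W}
    (hY : LowerTruncationProperty Y) (x : ℂ × ℕ →₀ V) (w : W) :
    ∃ N : ℝ, ∀ a : ℂ, a.re < N → ∀ k : ℕ, seriesAction Y x w k a = 0 := by
  induction x using Finsupp.induction_linear with
  | zero => exact ⟨0, by simp⟩
  | add x y hx hy =>
    obtain ⟨N, hN⟩ := hx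
    obtain ⟨N', hN'⟩ := hy
    refine ⟨min N N', fun a ha k => ?_⟩
    rw [map_add, LinearMap.add_apply, Finsupp.add_apply, Pi.add_apply,
      hN a (ha.trans_le (min_le_left _ _)), hN' a (ha.trans_le (min_le_right _ _)), add_zero]
  | single p t =>
    obtain ⟨N, hN⟩ := hY t w
    refine ⟨N + p.1.re, fun a ha k => ?_⟩
    rw [seriesAction_single]
    split_ifs
    · exact hN _ (by rw [Complex.sub_re]; linarith) _
    · rfl

/-- The substitution `x ^ a = e ^ (a L)`, `log x = L` in a finite sum of terms
`v x ^ a (log x) ^ k`. -/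
noncomputable def branchEval (L : ℂ) : (ℂ × ℕ →₀ V) →ₗ[ℂ] V :=
  Finsupp.lsum ℂ (fun p : ℂ × ℕ => (Complex.exp (p.1 * L) * L ^ p.2) • LinearMap.id)

theorem branchEval_single (L : ℂ) (p : ℂ × ℕ) (t : V) :
    branchEval L (Finsupp.single p t) = (Complex.exp (p.1 * L) * L ^ p.2) • t := by
  rw [branchEval, Finsupp.lsum_single]
  rfl

theorem seriesAction_finite {Y : V →ₗ[ℂ] W →ₗ[ℂ] LogSeries W} (π : W →ₗ[ℂ] W)
    (hY : ∀ v w, {q : ℂ × ℕ | π (logCoeff Y v q.1 q.2 w) ≠ 0}.Finite) (x : ℂ × ℕ →₀ V) (w : W) :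
    {q : ℂ × ℕ | π (seriesAction Y x w q.2 q.1) ≠ 0}.Finite := by
  induction x using Finsupp.induction_linear with
  | zero => simp
  | add x y hx hy =>
    refine (hx.union hy).subset fun q hq => ?_
    by_contra h
    simp only [Set.mem_union, Set.mem_ofPred_eq, not_or, not_not] at h
    exact hq (by rw [map_add, LinearMap.add_apply, Finsupp.add_apply, Pi.add_apply, map_add, h.1,
      h.2, add_zero])
  | single p t =>
    refine ((hY t w).image fun q => (q.1 + p.1, q.2 + p.2)).subset fun q hq => ?_
    rw [Set.mem_ofPred_eq, seriesAction_single] at hq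
    split_ifs at hq with h
    · exact ⟨(q.1 - p.1, q.2 - p.2), hq, by simp [Nat.sub_add_cancel h]⟩
    · simp at hq

/-- Substituting a value for `log x` is multiplicative on monomials, so it may be done first in the
argument and then in `Y`. For a single monomial the two sums differ by a translation of the indices.
-/
theorem finsum_seriesAction {Y : V →ₗ[ℂ] W →ₗ[ℂ] LogSeries W} (π : W →ₗ[ℂ] W)
    (hY : ∀ v w, {q : ℂ × ℕ | π (logCoeff Y v q.1 q.2 w) ≠ 0}.Finite) (L : ℂ)
    (x : ℂ × ℕ →₀ V) (w : W) :
    ∑ᶠ q : ℂ × ℕ, (Complex.exp (q.1 * L) * L ^ q.2) • π (seriesAction Y x w q.2 q.1) =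
      ∑ᶠ q : ℂ × ℕ, (Complex.exp (q.1 * L) * L ^ q.2) •
        π (logCoeff Y (branchEval L x) q.1 q.2 w) := by
  have hsupp {f : ℂ × ℕ → W} (hf : {q | f q ≠ 0}.Finite) (c : ℂ × ℕ → ℂ) :
      (Function.support fun q => c q • f q).Finite :=
    hf.subset fun q hq h => hq (by simp [h])
  induction x using Finsupp.induction_linear with
  | zero => simp [logCoeff_apply]
  | add x y hx hy =>
    rw [map_add (branchEval L)]
    simp only [map_add, LinearMap.add_apply, Finsupp.add_apply, Pi.add_apply, smul_add,
      logCoeff_apply] at hx hy ⊢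
    rw [finsum_add_distrib (hsupp (seriesAction_finite π hY x w) _)
      (hsupp (seriesAction_finite π hY y w) _), hx, hy]
    exact (finsum_add_distrib
      (hsupp (hY (branchEval L x) w) fun q => Complex.exp (q.1 * L) * L ^ q.2)
      (hsupp (hY (branchEval L y) w) fun q => Complex.exp (q.1 * L) * L ^ q.2)).symm
  | single p t =>
    have hinj : Function.Injective fun q : ℂ × ℕ => (q.1 + p.1, q.2 + p.2) := by
      rintro ⟨a, b⟩ ⟨c, d⟩ h
      simpa using h
    rw [branchEval_single, ← finsum_mem_univ,
      ← finsum_mem_inter_support_eq' _ (Set.range fun q : ℂ × ℕ => (q.1 + p.1, q.2 + p.2)) Set.univ,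
      finsum_mem_range hinj]
    · refine finsum_congr fun q => ?_
      rw [seriesAction_single, if_pos (by simp)]
      simp only [logCoeff_apply, map_smul, LinearMap.smul_apply, Finsupp.smul_apply,
        Pi.smul_apply, smul_smul, add_sub_cancel_right, Nat.add_sub_cancel]
      congr 1
      rw [add_mul, Complex.exp_add, pow_add]
      ring
    · intro q hq
      simp only [Set.mem_univ, iff_true]
      rw [Function.mem_support, seriesAction_single] at hq
      split_ifs at hq with h
      · exact ⟨(q.1 - p.1, q.2 - p.2), by simp [Nat.sub_add_cancel h]⟩
      · simp at hq

/-- The formal derivative of a finite sum of terms `v x ^ a (log x) ^ k`. -/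
noncomputable def seriesDerivative : (ℂ × ℕ →₀ V) →ₗ[ℂ] (ℂ × ℕ →₀ V) :=
  Finsupp.lsum ℂ fun p : ℂ × ℕ => p.1 • Finsupp.lsingle (p.1 - 1, p.2) +
    (p.2 : ℂ) • Finsupp.lsingle (p.1 - 1, p.2 - 1)

theorem seriesDerivative_single (p : ℂ × ℕ) (t : V) :
    seriesDerivative (Finsupp.single p t) = p.1 • Finsupp.single (p.1 - 1, p.2) t +
      (p.2 : ℂ) • Finsupp.single (p.1 - 1, p.2 - 1) t := by
  rw [seriesDerivative, Finsupp.lsum_single]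
  rfl

/-- The Leibniz rule: the derivative falls on `Y`, where it becomes `A` in the argument, or on the
coefficients of the argument. -/
theorem seriesAction_derivative {Y : V →ₗ[ℂ] W →ₗ[ℂ] LogSeries W} (A : Module.End ℂ V)
    (hY : ∀ (v : V) (w : W) (a : ℂ) (k : ℕ), (a + 1) • logCoeff Y v (a + 1) k w +
      ((k : ℂ) + 1) • logCoeff Y v (a + 1) (k + 1) w = logCoeff Y (A v) a k w)
    (x : ℂ × ℕ →₀ V) (w : W) (a : ℂ) (k : ℕ) :
    (a + 1) • seriesAction Y x w k (a + 1) +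
      ((k : ℂ) + 1) • seriesAction Y x w (k + 1) (a + 1) =
      seriesAction Y (Finsupp.mapRange.linearMap A x + seriesDerivative x) w k a := by
  induction x using Finsupp.induction_linear with
  | zero => simp
  | add x y hx hy =>
    simp only [map_add, LinearMap.add_apply, Finsupp.add_apply, Pi.add_apply, smul_add] at hx hy ⊢
    rw [add_add_add_comm, hx, hy]
    abel
  | single p t =>
    rw [seriesDerivative_single]
    simp only [Finsupp.mapRange.linearMap_apply, Finsupp.mapRange_single, map_add, map_smul,
      LinearMap.add_apply, LinearMap.smul_apply, Finsupp.add_apply, Finsupp.smul_apply,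
      Pi.add_apply, Pi.smul_apply, seriesAction_single]
    -- At `p.2 = k + 1` only the derivative of the logarithm reaches `(log x) ^ k`; above it every
    -- term is zero.
    rcases lt_trichotomy p.2 (k + 1) with h | h | h
    · rw [if_pos (by lia), if_pos (by lia), if_pos (by lia), if_pos (by lia), if_pos (by lia), ← hY]
      obtain ⟨i, rfl⟩ := Nat.exists_eq_add_of_le' (show p.2 ≤ k by lia)
      rw [show i + p.2 - p.2 = i by lia, show i + p.2 + 1 - p.2 = i + 1 by lia,
        show a - (p.1 - 1) = a - p.1 + 1 by ring, show a + 1 - p.1 = a - p.1 + 1 by ring]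
      -- For `p.2 = 0` the truncated exponent `p.2 - 1` is meaningless, but its coefficient `p.2` is
      -- zero.
      rcases Nat.eq_zero_or_pos p.2 with h0 | h0
      · rw [h0]; simp only [Nat.cast_zero, Nat.cast_add, zero_smul]; module
      · rw [show i + p.2 - (p.2 - 1) = i + 1 by lia]
        push_cast
        module
    · rw [if_neg (by lia), if_pos (by lia), if_neg (by lia), if_neg (by lia), if_pos (by lia), h,
        show a - (p.1 - 1) = a + 1 - p.1 by ring]
      simp
    · rw [if_neg (by lia), if_neg (by lia), if_neg (by lia), if_neg (by lia), if_neg (by lia)]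
      simp

/-- Multiplication by `x ^ (-m)`. -/
noncomputable def seriesShift (m : ℕ) : (ℂ × ℕ →₀ V) →ₗ[ℂ] (ℂ × ℕ →₀ V) :=
  Finsupp.lmapDomain V ℂ (fun p : ℂ × ℕ => (p.1 - m, p.2))

theorem seriesShift_single (m : ℕ) (p : ℂ × ℕ) (t : V) :
    seriesShift m (Finsupp.single p t) = Finsupp.single (p.1 - m, p.2) t := by
  rw [seriesShift, Finsupp.lmapDomain_apply, Finsupp.mapDomain_single]

theorem branchEval_seriesShift (L : ℂ) (m : ℕ) (x : ℂ × ℕ →₀ V) :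
    branchEval L (seriesShift m x) = Complex.exp (-(m * L)) • branchEval L x := by
  induction x using Finsupp.induction_linear with
  | zero => simp
  | add x y hx hy => rw [map_add, map_add, map_add, hx, hy, smul_add]
  | single p t =>
    rw [seriesShift_single, branchEval_single, branchEval_single, smul_smul, ← mul_assoc,
      ← Complex.exp_add]
    congr 3
    ring

theorem mapRange_seriesShift (A : Module.End ℂ V) (m : ℕ) (x : ℂ × ℕ →₀ V) :
    Finsupp.mapRange.linearMap A (seriesShift m x) =
      seriesShift m (Finsupp.mapRange.linearMap A x) := by
  induction x using Finsupp.induction_linear with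
  | zero => simp
  | add x y hx hy => simp only [map_add, hx, hy]
  | single p t => simp [seriesShift_single]

theorem seriesDerivative_seriesShift (m : ℕ) (x : ℂ × ℕ →₀ V) :
    seriesDerivative (seriesShift m x) =
      seriesShift m (seriesDerivative x) - (m : ℂ) • seriesShift (m + 1) x := by
  induction x using Finsupp.induction_linear with
  | zero => simp
  | add x y hx hy => simp only [map_add, hx, hy, smul_add]; abel
  | single p t =>
    simp only [seriesShift_single, seriesDerivative_single, map_add, map_smul]
    rw [show p.1 - ((m + 1 : ℕ) : ℂ) = p.1 - m - 1 by push_cast; ring,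
      show p.1 - 1 - (m : ℂ) = p.1 - m - 1 by ring]
    module

namespace IsTriangularizable

variable {T : Module.End ℂ V} (h : IsTriangularizable T)
include h

theorem xPow_commute {A : Module.End ℂ V} (hA : Commute A T) (v : V) :
    xPow T (A v) = Finsupp.mapRange.linearMap A (xPow T v) := by
  have key : xPow T ∘ₗ A = Finsupp.mapRange.linearMap A ∘ₗ xPow T := by
    refine h.ext fun μ v hv => ?_
    obtain ⟨K, hK⟩ := h.isLocallyNilpotent_nilpotentPart v
    have hc := (h.commute_nilpotentPart hA)
    have hA' (k : ℕ) : (nilpotentPart T ^ k) (A v) = A ((nilpotentPart T ^ k) v) :=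
      LinearMap.congr_fun (hc.pow_right k).eq.symm v
    rw [LinearMap.comp_apply, LinearMap.comp_apply, h.xPow_apply hv hK,
      h.xPow_apply (Module.End.mem_maxGenEigenspace_of_commute hA hv)
      (by rw [hA', hK, map_zero]), map_sum]
    simp [hA']
  exact LinearMap.congr_fun key v

theorem seriesDerivative_xPow (v : V) :
    seriesDerivative (xPow T v) = seriesShift 1 (xPow T (T v)) := by
  have key : seriesDerivative ∘ₗ xPow T = seriesShift 1 ∘ₗ xPow T ∘ₗ T := by
    refine h.ext fun μ v hv => ?_
    have hTv := Module.End.mem_maxGenEigenspace_of_commute (Commute.refl T) hv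
    obtain ⟨K, hK⟩ := h.isLocallyNilpotent_nilpotentPart v
    have hK' : (nilpotentPart T ^ (K + 1)) v = 0 :=
      Module.End.pow_apply_eq_zero_of_le (Nat.le_succ K) hK
    have hTv' : T v = μ • v + nilpotentPart T v := by
      rw [h.nilpotentPart_apply hv]; simp
    rw [LinearMap.comp_apply, LinearMap.comp_apply, LinearMap.comp_apply, hTv', map_add,
      map_smul, h.xPow_apply hv hK',
      h.xPow_apply (K := K) (Module.End.mem_maxGenEigenspace_of_commute
        (h.commute_nilpotentPart (Commute.refl T)).symm hv)
        (by rw [← Module.End.mul_apply, ← pow_succ, hK']), map_sum, map_add, map_smul, map_sum,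
      map_sum]
    simp only [seriesDerivative_single, seriesShift_single, Finset.sum_add_distrib,
      Finset.smul_sum, Nat.cast_one]
    congr 1
    rw [Finset.sum_range_succ']
    simp only [Nat.cast_zero, zero_smul, add_zero, Nat.add_sub_cancel]
    refine Finset.sum_congr rfl fun k _ => ?_
    rw [Finsupp.smul_single, smul_smul, ← Module.End.mul_apply, ← pow_succ]
    congr 2
    rw [Nat.factorial_succ]
    push_cast
    have h3 : (k.factorial : ℂ) ≠ 0 := Nat.cast_ne_zero.2 (Nat.factorial_ne_zero _)
    have h4 : ((k : ℂ) + 1) ≠ 0 := Nat.cast_add_one_ne_zero _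
    field_simp
  exact LinearMap.congr_fun key v

theorem branchEval_xPow {μ : ℂ} {v : V} (hv : v ∈ T.maxGenEigenspace μ) (L : ℂ) :
    branchEval L (xPow T v) = Complex.exp (μ * L) • nilExp (L • nilpotentPart T) v := by
  obtain ⟨K, hK⟩ := h.isLocallyNilpotent_nilpotentPart v
  rw [h.xPow_apply hv hK, (h.isLocallyNilpotent_nilpotentPart.smul L).nilExp_apply (K := K)
    (by rw [smul_pow, LinearMap.smul_apply, hK, smul_zero]), map_sum, Finset.smul_sum]
  refine Finset.sum_congr rfl fun k _ => ?_
  rw [branchEval_single, smul_pow, LinearMap.smul_apply, smul_smul, smul_smul, smul_smul]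
  congr 1
  ring

/-- The monodromy of `x ^ (-T)`. -/
theorem branchEval_xPow_neg_monodromy (L : ℂ) (v : V) :
    branchEval (L + 2 * Real.pi * Complex.I) (xPow (-T) (expTwoPiI T v)) =
      branchEval L (xPow (-T) v) := by
  have key : branchEval (L + 2 * Real.pi * Complex.I) ∘ₗ xPow (-T) ∘ₗ expTwoPiI T =
      branchEval L ∘ₗ xPow (-T) := by
    refine h.ext fun μ v hv => ?_
    have hN := h.isLocallyNilpotent_nilpotentPart
    have hc : Commute (nilExp ((2 * Real.pi * Complex.I : ℂ) • nilpotentPart T)) T :=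
      ((hN.smul _).commute_nilSeries
        ((h.commute_nilpotentPart (Commute.refl T)).smul_right _) _).symm
    have hv' := T.maxGenEigenspace_neg_le μ hv
    have hv'' := T.maxGenEigenspace_neg_le μ (Module.End.mem_maxGenEigenspace_of_commute hc hv)
    rw [LinearMap.comp_apply, LinearMap.comp_apply, LinearMap.comp_apply, h.expTwoPiI_apply hv,
      map_smul, map_smul, h.neg.branchEval_xPow hv', h.neg.branchEval_xPow hv'', smul_smul,
      ← Complex.exp_add, h.nilpotentPart_neg, smul_neg, smul_neg, ← neg_smul, ← neg_smul,
      ← Module.End.mul_apply, ← nilExp_add (hN.smul _) (hN.smul _)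
      ((Commute.refl _).smul_left _ |>.smul_right _), ← add_smul]
    congr 3 <;> ring_nf
  exact LinearMap.congr_fun key v

end IsTriangularizable

end Series

theorem Module.End.neg_pow_apply {V : Type*} [AddCommGroup V] [Module ℂ V] (N : Module.End ℂ V)
    (k : ℕ) (v : V) : ((-N) ^ k) v = (-1 : ℂ) ^ k • (N ^ k) v := by
  rw [← neg_one_smul ℂ N, smul_pow, LinearMap.smul_apply]

/-! ### Identity, lower truncation, derivative and equivariance for the deformed operators. -/

namespace VertexOperatorAlgebra

variable {V W : Type*} [AddCommGroup V] [Module ℂ V] [AddCommGroup W] [Module ℂ W]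
  (𝒱 : VertexOperatorAlgebra V)

/-- The derivative property at index `-1`, read on the vacuum. It turns the conjugation formula on
the vacuum into a statement about `L(-1)`. -/
theorem mode_neg_two_vac (v : V) : 𝒱.mode v (-2) 𝒱.vac = 𝒱.L (-1) v := by
  have h := LinearMap.congr_fun (𝒱.mode_L_neg_one v (-1)) 𝒱.vac
  have h1 : 𝒱.mode (𝒱.mode 𝒱.omega 0 v) (-1) 𝒱.vac = 𝒱.mode 𝒱.omega 0 v := 𝒱.creation _
  rw [h1] at h
  simpa [L] using h.symm

theorem mode_nonneg_vac (v : V) {n : ℤ} (hn : 0 ≤ n) : 𝒱.mode v n 𝒱.vac = 0 :=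
  𝒱.creation_nonneg v n hn

theorem vac_mem_filtration : 𝒱.vac ∈ 𝒱.filtration 0 :=
  𝒱.grade_le_filtration le_rfl 𝒱.vac_mem

theorem deltaTwist_apply (u : V) (Y : V →ₗ[ℂ] W →ₗ[ℂ] LogSeries W) (v : V) :
    deltaTwist 𝒱 u Y v = seriesAction Y (𝒱.Delta u v) := rfl

theorem commute_L_neg_one (u : V) : Commute (𝒱.L (-1)) (𝒱.mode u 0) := by
  have h := 𝒱.mode_commutator_nat 𝒱.omega u 0 0
  have h1 := 𝒱.mode_L_neg_one u 0
  simp only [Nat.cast_zero, zero_add, Finset.sum_range_one, Nat.choose_self, Nat.cast_one, one_smul,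
    sub_zero, h1, Int.cast_zero, neg_zero, zero_smul] at h
  exact sub_eq_zero.1 h

section WeightOne

variable {u : V} (hu : u ∈ 𝒱.grade 1)
  (hV0 : 𝒱.grade 0 = Submodule.span ℂ {𝒱.vac})
  (hVneg : ∀ n : ℤ, n < 0 → 𝒱.grade n = ⊥)
include hu hV0 hVneg

theorem Delta_eq {q : ℤ} {v : V} (hv : v ∈ 𝒱.filtration q) {Q : ℕ} (hQ : q < Q) :
    𝒱.Delta u v = ∑ m ∈ Finset.range Q,
      seriesShift m (xPow (-(𝒱.mode u 0)) (𝒱.deltaExpCoeff u m v)) := by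
  rw [Delta, LinearMap.comp_apply, lsum_finsuppOfLocallyFinite (K := Q)]
  · rfl
  · intro w
    obtain ⟨p, hp⟩ := 𝒱.exists_mem_filtration w
    exact ⟨p + 1, fun n hn => 𝒱.deltaExpCoeff_eq_zero hu hV0 hVneg hp (by lia)⟩
  · exact fun n hn => 𝒱.deltaExpCoeff_eq_zero hu hV0 hVneg hv (by lia)

theorem deltaExpCoeff_vac (m : ℕ) : 𝒱.deltaExpCoeff u m 𝒱.vac = if m = 0 then 𝒱.vac else 0 := by
  split_ifs with h
  · rw [h, deltaExpCoeff_zero, Module.End.one_apply]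
  · exact 𝒱.deltaExpCoeff_eq_zero hu hV0 hVneg 𝒱.vac_mem_filtration (by lia)

theorem deltaExpCoeff_mem_maxGenEigenspace (m : ℕ) {μ : ℂ} {v : V}
    (hv : v ∈ (𝒱.mode u 0).maxGenEigenspace μ) :
    𝒱.deltaExpCoeff u m v ∈ (𝒱.mode u 0).maxGenEigenspace μ :=
  Module.End.mem_maxGenEigenspace_of_commute
    (𝒱.commute_mode_zero_deltaExpCoeff hu hV0 hVneg m).symm hv

/-- The coefficients of `Y(Δ(x) v, x) w` for a generalized eigenvector `v` of `Y_0(u)`. -/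
theorem logCoeff_deltaTwist (Y : V →ₗ[ℂ] W →ₗ[ℂ] LogSeries W) {μ : ℂ} {v : V}
    (hμ : v ∈ (𝒱.mode u 0).maxGenEigenspace μ) {q : ℤ} (hv : v ∈ 𝒱.filtration q) {Q : ℕ}
    (hQ : q < Q) (a : ℂ) (l : ℕ) (w : W) :
    logCoeff (deltaTwist 𝒱 u Y) v a l w = ∑ m ∈ Finset.range Q,
      ∑ p ∈ Finset.HasAntidiagonal.antidiagonal l, ((-1 : ℂ) ^ p.1 * (p.1.factorial : ℂ)⁻¹) •
        logCoeff Y ((nilpotentPart (𝒱.mode u 0) ^ p.1) (𝒱.deltaExpCoeff u m v)) (a + μ + m)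
          p.2 w := by
  have hT := 𝒱.isTriangularizable_zeroMode hu
  have hN := hT.isLocallyNilpotent_nilpotentPart
  rw [logCoeff_apply, deltaTwist_apply, 𝒱.Delta_eq hu hV0 hVneg hv hQ, map_sum, LinearMap.sum_apply,
    Finsupp.finsetSum_apply, Finset.sum_apply]
  refine Finset.sum_congr rfl fun m _ => ?_
  obtain ⟨K, hK⟩ := hN (𝒱.deltaExpCoeff u m v)
  -- The cutoff is enlarged by `l + 1` so that it covers every `k ≤ l`; the terms with `k > l` do
  -- not reach `(log x) ^ l`.
  have hK' : (nilpotentPart (-(𝒱.mode u 0)) ^ (K + (l + 1))) (𝒱.deltaExpCoeff u m v) = 0 := by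
    rw [hT.nilpotentPart_neg, neg_pow, Module.End.mul_apply,
      Module.End.pow_apply_eq_zero_of_le (Nat.le_add_right _ _) hK, map_zero]
  rw [hT.neg.xPow_apply (Module.End.maxGenEigenspace_neg_le _ _
    (𝒱.deltaExpCoeff_mem_maxGenEigenspace hu hV0 hVneg m hμ)) hK', map_sum, map_sum,
    LinearMap.sum_apply, Finsupp.finsetSum_apply, Finset.sum_apply,
    Finset.Nat.sum_antidiagonal_eq_sum_range_succ_mk]
  symm
  refine Finset.sum_subset_zero_on_sdiff (by simp) ?_ ?_
  · intro k hk
    rw [Finset.mem_sdiff, Finset.mem_range, Finset.mem_range] at hk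
    rw [seriesShift_single, seriesAction_single, if_neg (by simpa using hk.2)]
  · intro k hk
    rw [Finset.mem_range] at hk
    rw [seriesShift_single, seriesAction_single, if_pos (by simpa using Nat.lt_succ_iff.1 hk),
      hT.nilpotentPart_neg, Module.End.neg_pow_apply]
    simp only [logCoeff_apply, map_smul, LinearMap.smul_apply, Finsupp.smul_apply, Pi.smul_apply,
      mul_smul]
    rw [show a - (-μ - (m : ℂ)) = a + μ + m by ring, smul_comm]

theorem identityProperty_deltaTwist {Y : V →ₗ[ℂ] W →ₗ[ℂ] LogSeries W}
    (hY : IdentityProperty 𝒱 Y) : IdentityProperty 𝒱 (deltaTwist 𝒱 u Y) := by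
  intro a k w
  have hT := 𝒱.isTriangularizable_zeroMode hu
  have h0 : 𝒱.mode u 0 𝒱.vac = 0 := 𝒱.mode_nonneg_vac u le_rfl
  have hvac : 𝒱.vac ∈ (𝒱.mode u 0).maxGenEigenspace 0 := by
    rw [Module.End.mem_maxGenEigenspace]
    exact ⟨1, by simp [h0]⟩
  have hN : nilpotentPart (𝒱.mode u 0) 𝒱.vac = 0 := by
    rw [hT.nilpotentPart_apply hvac]
    simp [h0]
  rw [𝒱.logCoeff_deltaTwist hu hV0 hVneg Y hvac 𝒱.vac_mem_filtration (Q := 1) (by simp),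
    Finset.sum_range_one, deltaExpCoeff_zero, Finset.sum_eq_single (0, k)]
  · simp [hY a k w]
  · intro p hp hne
    rw [Finset.HasAntidiagonal.mem_antidiagonal] at hp
    have h1 : p.1 ≠ 0 := fun h1 => hne (Prod.ext h1 (by simpa [h1] using hp))
    obtain ⟨i, hi⟩ := Nat.exists_eq_succ_of_ne_zero h1
    rw [hi, pow_succ (nilpotentPart _), Module.End.mul_apply, Module.End.one_apply, hN, map_zero, logCoeff_apply,
      map_zero]
    simp
  · simp

/-- Apply the conjugation formula to `v_{-2} 𝟏`. The vacuum is fixed by `D`, and `D`-shifts by two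
or more give nonnegative modes, which kill it. The modes `-2` and `-1` remain and give `L(-1)
D_{m+1} v` and `(-Y_0(u) - m) D_m v`. -/
theorem deltaExpCoeff_succ_L_neg_one (m : ℕ) (v : V) :
    𝒱.deltaExpCoeff u (m + 1) (𝒱.L (-1) v) = 𝒱.L (-1) (𝒱.deltaExpCoeff u (m + 1) v) -
      (𝒱.mode u 0 (𝒱.deltaExpCoeff u m v) + (m : ℂ) • 𝒱.deltaExpCoeff u m v) := by
  rw [← mode_neg_two_vac, 𝒱.deltaExpCoeff_mode hu hV0 hVneg, Finset.sum_eq_single (m + 1, 0)]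
  · rw [Finset.Nat.sum_antidiagonal_succ', Finset.sum_eq_single (m, 0)]
    · rw [deltaExpCoeff_zero, Module.End.one_apply, shiftedDeltaCoeff_zero]
      have h1 : 𝒱.shiftedDeltaCoeff u m 1 v =
          -(𝒱.mode u 0 (𝒱.deltaExpCoeff u m v) + (m : ℂ) • 𝒱.deltaExpCoeff u m v) := by
        rw [shiftedDeltaCoeff, negBinomial_one, Module.End.mul_apply]
        simp [sub_eq_add_neg, add_comm, Nat.cast_smul_eq_nsmul]
      have h2 : 𝒱.mode (𝒱.shiftedDeltaCoeff u m 1 v) (-2 + ((0 + 1 : ℕ) : ℤ)) 𝒱.vac =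
          𝒱.shiftedDeltaCoeff u m 1 v := 𝒱.creation _
      dsimp only
      rw [zero_add] at h2 ⊢
      rw [h2, h1, Nat.cast_zero, add_zero, mode_neg_two_vac, sub_eq_add_neg]
    · intro p hp hne
      rw [Finset.HasAntidiagonal.mem_antidiagonal] at hp
      have h1 : p.2 ≠ 0 := fun h1 => hne (Prod.ext (by simpa [h1] using hp) h1)
      rw [deltaExpCoeff_zero, Module.End.one_apply]
      exact 𝒱.mode_nonneg_vac _ (by push_cast; lia)
    · simp
  · intro x hx hne
    rw [Finset.HasAntidiagonal.mem_antidiagonal] at hx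
    have h1 : x.2 ≠ 0 := fun h1 => hne (Prod.ext (by simpa [h1] using hx) h1)
    simp [𝒱.deltaExpCoeff_vac hu hV0 hVneg, h1]
  · simp

/-- `Δ(x) L(-1) v = L(-1) Δ(x) v + Δ'(x) v`. -/
theorem Delta_L_neg_one (v : V) : 𝒱.Delta u (𝒱.L (-1) v) =
    Finsupp.mapRange.linearMap (𝒱.L (-1)) (𝒱.Delta u v) + seriesDerivative (𝒱.Delta u v) := by
  have hT := 𝒱.isTriangularizable_zeroMode hu
  obtain ⟨q, hq⟩ := 𝒱.exists_mem_filtration v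
  obtain ⟨q', hq'⟩ := 𝒱.exists_mem_filtration (𝒱.L (-1) v)
  set Q := q + q' + 1
  have hc : Commute (𝒱.L (-1)) (-(𝒱.mode u 0)) := (𝒱.commute_L_neg_one u).neg_right
  have hd (m : ℕ) : seriesDerivative (seriesShift m
      (xPow (-(𝒱.mode u 0)) (𝒱.deltaExpCoeff u m v))) = -seriesShift (m + 1)
        (xPow (-(𝒱.mode u 0)) (𝒱.mode u 0 (𝒱.deltaExpCoeff u m v) +
          (m : ℂ) • 𝒱.deltaExpCoeff u m v)) := by
    rw [seriesDerivative_seriesShift, hT.neg.seriesDerivative_xPow, LinearMap.neg_apply, map_neg,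
      map_neg, map_neg, map_add, map_add, map_smul, map_smul]
    have h1 (x : ℂ × ℕ →₀ V) : seriesShift m (seriesShift 1 x) = seriesShift (m + 1) x := by
      induction x using Finsupp.induction_linear with
      | zero => simp
      | add x y hx hy => simp only [map_add, hx, hy]
      | single p t =>
        simp only [seriesShift_single]
        congr 2
        push_cast
        ring
    rw [h1]
    abel
  -- The derivative of the `m`-th term of `Δ(x) v` matches part of the `(m + 1)`-st term on the
  -- left. The vanishing of the `Q`-th coefficient removes the derivative term left without a
  -- partner.
  have hz : 𝒱.deltaExpCoeff u Q v = 0 := 𝒱.deltaExpCoeff_eq_zero hu hV0 hVneg hq (by lia)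
  rw [𝒱.Delta_eq hu hV0 hVneg hq' (Q := Q + 1) (by lia),
    𝒱.Delta_eq hu hV0 hVneg hq (Q := Q + 1) (by lia), map_sum, map_sum, Finset.sum_congr rfl
    fun m _ => hd m, Finset.sum_range_succ', Finset.sum_range_succ' (fun m =>
      Finsupp.mapRange.linearMap (𝒱.L (-1)) _), Finset.sum_range_succ _ Q, hz]
  simp only [𝒱.deltaExpCoeff_succ_L_neg_one hu hV0 hVneg, deltaExpCoeff_zero,
    Module.End.one_apply, mapRange_seriesShift, hT.neg.xPow_commute hc, map_sub,
    Finset.sum_sub_distrib, Finset.sum_neg_distrib, map_zero, smul_zero, add_zero, neg_zero]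
  abel

theorem lDerivativeProperty_deltaTwist {Y : V →ₗ[ℂ] W →ₗ[ℂ] LogSeries W}
    (hY : LDerivativeProperty 𝒱 Y) : LDerivativeProperty 𝒱 (deltaTwist 𝒱 u Y) := by
  intro v w a k
  simp only [logCoeff_apply, deltaTwist_apply]
  rw [seriesAction_derivative (𝒱.L (-1)) hY, 𝒱.Delta_L_neg_one hu hV0 hVneg]

/-- On the next branch, `x^(-Y_0(u))` acquires the monodromy `e^(-2πi Y_0(u))`, which cancels `g_u`.
The automorphism `g` passes through `Δ` because it fixes `u`. -/
theorem branchEval_Delta (g : 𝒱.Automorphism) (hgu : g.op u = u) (L : ℂ) (v : V) :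
    branchEval (L + 2 * Real.pi * Complex.I) (𝒱.Delta u (g.twist u v)) =
      g.op (branchEval L (𝒱.Delta u v)) := by
  have hT := 𝒱.isTriangularizable_zeroMode hu
  obtain ⟨q, hq⟩ := 𝒱.exists_mem_filtration v
  obtain ⟨q', hq'⟩ := 𝒱.exists_mem_filtration (g.twist u v)
  have hc (n : ℕ) : Commute (expTwoPiI (𝒱.mode u 0)) (𝒱.mode u n) := by
    have h0 : Commute (𝒱.mode u n) (𝒱.mode u 0) := by
      simpa using 𝒱.commute_mode_nonneg hu hV0 hVneg n 0
    refine (hT.commute_jordanLift h0 _ fun μ => ?_).symm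
    exact (hT.isLocallyNilpotent_nilpotentPart.commute_nilSeries
      (hT.commute_nilpotentPart h0) _).smul_right _
  have hh (n : ℕ) : Commute (g.twist u) (𝒱.mode u n) :=
    (g.commute_op_mode hgu n).mul_left (hc n)
  rw [𝒱.Delta_eq hu hV0 hVneg hq' (Q := q + q' + 1) (by lia),
    𝒱.Delta_eq hu hV0 hVneg hq (Q := q + q' + 1) (by lia), map_sum, map_sum, map_sum]
  refine Finset.sum_congr rfl fun m _ => ?_
  have h1 : 𝒱.deltaExpCoeff u m (g.twist u v) = g.twist u (𝒱.deltaExpCoeff u m v) :=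
    LinearMap.congr_fun (𝒱.commute_deltaExpCoeff hh m).eq.symm v
  have h2 (x : ℂ × ℕ →₀ V) (L : ℂ) :
      branchEval L (Finsupp.mapRange.linearMap g.op x) = g.op (branchEval L x) := by
    induction x using Finsupp.induction_linear with
    | zero => simp
    | add x y hx hy => simp only [map_add, hx, hy]
    | single p t => simp [branchEval_single]
  rw [branchEval_seriesShift, branchEval_seriesShift, h1, Automorphism.twist,
    Module.End.mul_apply, hT.neg.xPow_commute (by
      simpa using (g.commute_op_mode hgu 0).neg_right), h2,
    hT.branchEval_xPow_neg_monodromy, map_smul]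
  congr 1
  rw [Complex.exp_eq_exp_iff_exists_int]
  -- The integral power `x ^ (-m)` has no monodromy.
  exact ⟨-m, by push_cast; ring⟩

theorem equivarianceProperty_deltaTwist {Y : V →ₗ[ℂ] W →ₗ[ℂ] LogSeries W}
    (g : 𝒱.Automorphism) (hgu : g.op u = u) {π : ℂ → W →ₗ[ℂ] W}
    (hY : EquivarianceProperty π g.op Y) :
    EquivarianceProperty π (g.twist u) (deltaTwist 𝒱 u Y) := by
  refine ⟨fun v w n => seriesAction_finite (π n) (fun v w => hY.1 v w n) _ w,
    fun p z hz v w n => ?_⟩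
  have hfin : ∀ v w, {q : ℂ × ℕ | π n (logCoeff Y v q.1 q.2 w) ≠ 0}.Finite :=
    fun v w => hY.1 v w n
  have h1 : logBranch (p + 1) z = logBranch p z + 2 * Real.pi * Complex.I := by
    rw [logBranch, logBranch]
    push_cast
    ring
  have h2 := hY.2 p z hz (branchEval (logBranch p z) (𝒱.Delta u v)) w n
  rw [branchComponent, branchComponent] at h2 ⊢
  simp only [logCoeff_apply (deltaTwist 𝒱 u Y), deltaTwist_apply]
  rw [finsum_seriesAction (π n) hfin, finsum_seriesAction (π n) hfin, ← h2, h1,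
    𝒱.branchEval_Delta hu hV0 hVneg g hgu]

end WeightOne

theorem lowerTruncationProperty_deltaTwist {Y : V →ₗ[ℂ] W →ₗ[ℂ] LogSeries W} (u : V)
    (hY : LowerTruncationProperty Y) : LowerTruncationProperty (deltaTwist 𝒱 u Y) :=
  fun v w => seriesAction_lowerTruncation hY (𝒱.Delta u v) w

end VertexOperatorAlgebra

/-! ### Polynomials in `log x₂` and `log x₁` over power series in `x₀ / x₂` -/

/-- The ring of polynomials in `log x₂` (outer variable) and `log x₁` (inner variable) over power
series in `x₀ / x₂`. -/
def KernelRing : Type := Polynomial (Polynomial (PowerSeries ℂ))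

namespace KernelRing

noncomputable instance : CommRing KernelRing :=
  inferInstanceAs (CommRing (Polynomial (Polynomial (PowerSeries ℂ))))

noncomputable instance : Algebra ℂ KernelRing :=
  inferInstanceAs (Algebra ℂ (Polynomial (Polynomial (PowerSeries ℂ))))

/-- The coefficient of `(x₀ / x₂) ^ j (log x₁) ^ k (log x₂) ^ l`. -/
noncomputable def kcoeff (j k l : ℕ) : KernelRing →ₗ[ℂ] ℂ :=
  PowerSeries.coeff j ∘ₗ (Polynomial.lcoeff (PowerSeries ℂ) k).restrictScalars ℂ ∘ₗ
    (Polynomial.lcoeff (Polynomial (PowerSeries ℂ)) l).restrictScalars ℂ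

/-- A power series in `x₀ / x₂` as an element of the kernel ring. -/
noncomputable def ofSeries : PowerSeries ℂ →ₐ[ℂ] KernelRing :=
  (Polynomial.CAlgHom (R := ℂ) (A := Polynomial (PowerSeries ℂ))).comp
    (Polynomial.CAlgHom (R := ℂ) (A := PowerSeries ℂ))

/-- `log x₁`. -/
noncomputable def logX₁ : KernelRing :=
  (Polynomial.C Polynomial.X : Polynomial (Polynomial (PowerSeries ℂ)))

/-- `log x₂`. -/
noncomputable def logX₂ : KernelRing :=
  (Polynomial.X : Polynomial (Polynomial (PowerSeries ℂ)))

/-- `log (x₂ + x₀)`. -/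
noncomputable def logSum : KernelRing := logX₂ + ofSeries (PowerSeries.log ℂ)

theorem kcoeff_ofSeries_mul (f : PowerSeries ℂ) (κ : KernelRing) (j k l : ℕ) :
    kcoeff j k l (ofSeries f * κ) = ∑ p ∈ Finset.HasAntidiagonal.antidiagonal j,
      PowerSeries.coeff p.1 f * kcoeff p.2 k l κ := by
  have h (p : Polynomial (Polynomial (PowerSeries ℂ))) :
      PowerSeries.coeff j (Polynomial.coeff (Polynomial.coeff
        (Polynomial.C (Polynomial.C f) * p) l) k) =
      ∑ x ∈ Finset.HasAntidiagonal.antidiagonal j,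
        PowerSeries.coeff x.1 f * PowerSeries.coeff x.2 ((p.coeff l).coeff k) := by
    rw [Polynomial.coeff_C_mul, Polynomial.coeff_C_mul, PowerSeries.coeff_mul]
  exact h κ

theorem kcoeff_logX₁_pow_mul (i : ℕ) (κ : KernelRing) (j k l : ℕ) :
    kcoeff j k l (logX₁ ^ i * κ) = if i ≤ k then kcoeff j (k - i) l κ else 0 := by
  change PowerSeries.coeff j (Polynomial.coeff (Polynomial.coeff
    (Polynomial.C Polynomial.X ^ i *
      (show Polynomial (Polynomial (PowerSeries ℂ)) from κ)) l) k) = _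
  rw [← Polynomial.C_pow, Polynomial.coeff_C_mul, Polynomial.coeff_X_pow_mul']
  split_ifs
  · rfl
  · exact map_zero _

theorem kcoeff_logX₂_pow_mul (i : ℕ) (κ : KernelRing) (j k l : ℕ) :
    kcoeff j k l (logX₂ ^ i * κ) = if i ≤ l then kcoeff j k (l - i) κ else 0 := by
  change PowerSeries.coeff j (Polynomial.coeff (Polynomial.coeff
    (Polynomial.X ^ i * (show Polynomial (Polynomial (PowerSeries ℂ)) from κ)) l) k) = _
  rw [Polynomial.coeff_X_pow_mul']
  split_ifs
  · rfl
  · simp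

theorem jacobiKernel_eq (β : ℂ) (r j k l : ℕ) : jacobiKernel β r j k l =
    kcoeff j k l (ofSeries (PowerSeries.binomialSeries ℂ β) * (logSum - logX₁) ^ r) := rfl

end KernelRing

open KernelRing

theorem sum_antidiagonal_shift {M : Type*} [AddCommMonoid M] (i l : ℕ) (f : ℕ → ℕ → M) :
    ∑ x ∈ Finset.HasAntidiagonal.antidiagonal l, (if i ≤ x.1 then f (x.1 - i) x.2 else 0) =
      if i ≤ l then ∑ x ∈ Finset.HasAntidiagonal.antidiagonal (l - i), f x.1 x.2 else 0 := by
  split_ifs with h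
  · rw [← Finset.sum_filter]
    refine Finset.sum_nbij' (fun x => (x.1 - i, x.2)) (fun x => (x.1 + i, x.2)) ?_ ?_ ?_ ?_ ?_
    · intro x hx
      simp only [Finset.mem_filter, Finset.HasAntidiagonal.mem_antidiagonal] at hx ⊢
      lia
    · intro x hx
      simp only [Finset.mem_filter, Finset.HasAntidiagonal.mem_antidiagonal] at hx ⊢
      lia
    · intro x hx
      simp only [Finset.mem_filter] at hx
      simp [Nat.sub_add_cancel hx.2]
    · intro x _
      simp
    · intro x _
      rfl
  · refine Finset.sum_eq_zero fun x hx => if_neg ?_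
    have := Finset.HasAntidiagonal.mem_antidiagonal.1 hx
    lia

section Pairing

variable {V W : Type*} [AddCommGroup V] [Module ℂ V] [AddCommGroup W] [Module ℂ W]

/-- The pairing of `κ ⊗ v` with a family of linear maps indexed by powers of `x₀ / x₂` and
of `log x₂`: the coefficient of `(log x₁) ^ k (log x₂) ^ l` of the product. -/
noncomputable def kernelPairing (J : ℕ) (P : ℕ → ℕ → V →ₗ[ℂ] W) (k l : ℕ) :
    KernelRing ⊗[ℂ] V →ₗ[ℂ] W :=
  TensorProduct.lift (∑ j ∈ Finset.range J, ∑ q ∈ Finset.HasAntidiagonal.antidiagonal l,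
    (kcoeff j k q.1).smulRight (P j q.2))

theorem kernelPairing_tmul (J : ℕ) (P : ℕ → ℕ → V →ₗ[ℂ] W) (k l : ℕ) (κ : KernelRing) (v : V) :
    kernelPairing J P k l (κ ⊗ₜ v) = ∑ j ∈ Finset.range J,
      ∑ q ∈ Finset.HasAntidiagonal.antidiagonal l, kcoeff j k q.1 κ • P j q.2 v := by
  simp [kernelPairing, LinearMap.sum_apply]

/-- The operator `c ⊗ N` on `KernelRing ⊗ V`. -/
noncomputable def kernelMap (c : KernelRing) : Module.End ℂ V →ₗ[ℂ] Module.End ℂ (KernelRing ⊗[ℂ] V) :=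
  TensorProduct.mapBilinear (RingHom.id ℂ) KernelRing V KernelRing V (LinearMap.mulLeft ℂ c)

theorem kernelMap_tmul (c : KernelRing) (N : Module.End ℂ V) (κ : KernelRing) (v : V) :
    kernelMap c N (κ ⊗ₜ v) = (c * κ) ⊗ₜ N v := rfl

theorem kernelMap_mul (c d : KernelRing) (A B : Module.End ℂ V) :
    kernelMap c A * kernelMap d B = kernelMap (c * d) (A * B) := by
  refine TensorProduct.ext' fun κ v => ?_
  rw [Module.End.mul_apply, kernelMap_tmul, kernelMap_tmul, kernelMap_tmul, mul_assoc,
    Module.End.mul_apply]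

theorem kernelMap_add_left (c d : KernelRing) (A : Module.End ℂ V) :
    kernelMap (c + d) A = kernelMap c A + kernelMap d A := by
  refine TensorProduct.ext' fun κ v => ?_
  rw [LinearMap.add_apply, kernelMap_tmul, kernelMap_tmul, kernelMap_tmul, add_mul,
    TensorProduct.add_tmul]

theorem commute_kernelMap (c d : KernelRing) {A B : Module.End ℂ V} (h : Commute A B) :
    Commute (kernelMap c A) (kernelMap d B) := by
  rw [commute_iff_eq, kernelMap_mul, kernelMap_mul, h.eq, mul_comm c d]

theorem kernelMap_pow_tmul (c : KernelRing) (N : Module.End ℂ V) (i : ℕ) (κ : KernelRing) (v : V) :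
    (kernelMap c N ^ i) (κ ⊗ₜ v) = (c ^ i * κ) ⊗ₜ (N ^ i) v := by
  induction i with
  | zero => simp
  | succ i ih =>
    rw [pow_succ', Module.End.mul_apply, ih, kernelMap_tmul, pow_succ', pow_succ' N,
      Module.End.mul_apply, mul_assoc]

theorem IsLocallyNilpotent.kernelMap {N : Module.End ℂ V} (hN : IsLocallyNilpotent N)
    (c : KernelRing) : IsLocallyNilpotent (kernelMap c N) := by
  intro z
  induction z with
  | zero => exact ⟨0, by simp⟩
  | tmul κ v =>
    obtain ⟨k, hk⟩ := hN v
    exact ⟨k, by rw [kernelMap_pow_tmul, hk, TensorProduct.tmul_zero]⟩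
  | add x y hx hy =>
    obtain ⟨k, hk⟩ := hx
    obtain ⟨l, hl⟩ := hy
    exact ⟨max k l, by
      rw [map_add, Module.End.pow_apply_eq_zero_of_le (le_max_left k l) hk,
        Module.End.pow_apply_eq_zero_of_le (le_max_right k l) hl, add_zero]⟩

theorem IsLocallyNilpotent.nilExp_kernelMap_tmul {N : Module.End ℂ V} (hN : IsLocallyNilpotent N)
    (c κ : KernelRing) {v : V} {K : ℕ} (hK : (N ^ K) v = 0) :
    nilExp (_root_.kernelMap c N) (κ ⊗ₜ v) =
      ∑ i ∈ Finset.range K, (i.factorial : ℂ)⁻¹ • (c ^ i * κ) ⊗ₜ[ℂ] (N ^ i) v := by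
  rw [(hN.kernelMap c).nilExp_apply (K := K)
    (by rw [kernelMap_pow_tmul, hK, TensorProduct.tmul_zero])]
  simp only [kernelMap_pow_tmul]

theorem kernelPairing_logX₁ (J : ℕ) (P : ℕ → ℕ → V →ₗ[ℂ] W) (k l i : ℕ) (κ : KernelRing) (v : V) :
    kernelPairing J P k l ((logX₁ ^ i * κ) ⊗ₜ v) =
      if i ≤ k then kernelPairing J P (k - i) l (κ ⊗ₜ v) else 0 := by
  simp only [kernelPairing_tmul, kcoeff_logX₁_pow_mul]
  split_ifs <;> simp

theorem kernelPairing_logX₂ (J : ℕ) (P : ℕ → ℕ → V →ₗ[ℂ] W) (k l i : ℕ) (κ : KernelRing) (v : V) :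
    kernelPairing J P k l ((logX₂ ^ i * κ) ⊗ₜ v) =
      if i ≤ l then kernelPairing J P k (l - i) (κ ⊗ₜ v) else 0 := by
  simp only [kernelPairing_tmul, kcoeff_logX₂_pow_mul, ite_smul, zero_smul]
  rw [Finset.sum_congr rfl fun j _ =>
    sum_antidiagonal_shift i l (fun a b => kcoeff j k a κ • P j b v)]
  split_ifs <;> simp

/-- If multiplication by `c` merely shifts an index of the pairing, then `e^(-cN)` can be expanded
outside it. Stated for a general `c`, so that it serves both `log x₁` and `log x₂`. -/
theorem kernelPairing_nilExp_aux {N : Module.End ℂ V} (hN : IsLocallyNilpotent N)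
    (c : KernelRing) (Λ : ℕ → KernelRing ⊗[ℂ] V →ₗ[ℂ] W)
    (hΛ : ∀ k i κ v, Λ k ((c ^ i * κ) ⊗ₜ v) = if i ≤ k then Λ (k - i) (κ ⊗ₜ v) else 0)
    (k : ℕ) (z : KernelRing ⊗[ℂ] V) :
    Λ k (nilExp (kernelMap (-c) N) z) = ∑ q ∈ Finset.HasAntidiagonal.antidiagonal k,
      ((-1 : ℂ) ^ q.1 * (q.1.factorial : ℂ)⁻¹) • Λ q.2 (kernelMap 1 (N ^ q.1) z) := by
  induction z with
  | zero => simp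
  | add x y hx hy => simp only [map_add, hx, hy, smul_add, Finset.sum_add_distrib]
  | tmul κ v =>
    obtain ⟨K, hK⟩ := hN v
    rw [hN.nilExp_kernelMap_tmul (-c) κ (K := K + (k + 1))
      (Module.End.pow_apply_eq_zero_of_le (Nat.le_add_right _ _) hK), map_sum,
      Finset.Nat.sum_antidiagonal_eq_sum_range_succ_mk]
    have hc (i : ℕ) : ((-c) ^ i * κ) = (-1 : ℂ) ^ i • (c ^ i * κ) := by
      rw [← neg_one_smul ℂ c, smul_pow, smul_mul_assoc]
    symm
    refine Finset.sum_subset_zero_on_sdiff (by simp) ?_ ?_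
    · intro i hi
      rw [Finset.mem_sdiff, Finset.mem_range, Finset.mem_range] at hi
      rw [map_smul, hc, ← TensorProduct.smul_tmul', map_smul, hΛ, if_neg (by lia), smul_zero,
        smul_zero]
    · intro i hi
      rw [Finset.mem_range] at hi
      rw [map_smul, hc, ← TensorProduct.smul_tmul', map_smul, hΛ, if_pos (by lia), smul_smul,
        kernelMap_tmul, one_mul, mul_comm]

theorem kernelPairing_nilExp_logX₁ {N : Module.End ℂ V} (hN : IsLocallyNilpotent N)
    (J : ℕ) (P : ℕ → ℕ → V →ₗ[ℂ] W) (k l : ℕ) (z : KernelRing ⊗[ℂ] V) :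
    kernelPairing J P k l (nilExp (kernelMap (-logX₁) N) z) =
      ∑ q ∈ Finset.HasAntidiagonal.antidiagonal k, ((-1 : ℂ) ^ q.1 * (q.1.factorial : ℂ)⁻¹) •
        kernelPairing J P q.2 l (kernelMap 1 (N ^ q.1) z) :=
  kernelPairing_nilExp_aux hN logX₁ (fun k => kernelPairing J P k l)
    (fun k i κ v => kernelPairing_logX₁ J P k l i κ v) k z

theorem kernelPairing_nilExp_logX₂ {N : Module.End ℂ V} (hN : IsLocallyNilpotent N)
    (J : ℕ) (P : ℕ → ℕ → V →ₗ[ℂ] W) (k l : ℕ) (z : KernelRing ⊗[ℂ] V) :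
    kernelPairing J P k l (nilExp (kernelMap (-logX₂) N) z) =
      ∑ q ∈ Finset.HasAntidiagonal.antidiagonal l, ((-1 : ℂ) ^ q.1 * (q.1.factorial : ℂ)⁻¹) •
        kernelPairing J P k q.2 (kernelMap 1 (N ^ q.1) z) :=
  kernelPairing_nilExp_aux hN logX₂ (fun l => kernelPairing J P k l)
    (fun l i κ v => kernelPairing_logX₂ J P k l i κ v) l z

end Pairing

/-! ### The binomial series with an operator exponent -/

theorem succ_mul_negBinomial_succ (m j : ℕ) :
    ((j : ℂ) + 1) • negBinomial m (j + 1) =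
      (-Polynomial.X - Polynomial.C ((m : ℂ) + j)) * negBinomial m j := by
  refine Polynomial.funext fun μ => ?_
  simp only [Polynomial.eval_smul, Polynomial.eval_mul, Polynomial.eval_sub, Polynomial.eval_neg,
    Polynomial.eval_X, Polynomial.eval_C, eval_negBinomial, smul_eq_mul, ring_choose_succ_smul]
  ring

theorem one_add_X_mul_derivative_binomialSeries (z : ℂ) :
    (1 + PowerSeries.X) * PowerSeries.derivative ℂ (PowerSeries.binomialSeries ℂ z) =
      z • PowerSeries.binomialSeries ℂ z := by
  ext j
  rw [add_mul, one_mul, map_add, PowerSeries.coeff_derivative]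
  have h := ring_choose_succ_smul z j
  cases j with
  | zero =>
    simp only [PowerSeries.binomialSeries_coeff, PowerSeries.coeff_zero_X_mul,
      PowerSeries.coeff_smul, smul_eq_mul, mul_one] at h ⊢
    simp only [Nat.cast_zero, sub_zero] at h ⊢
    linear_combination h
  | succ j =>
    simp only [PowerSeries.coeff_succ_X_mul, PowerSeries.coeff_derivative,
      PowerSeries.binomialSeries_coeff, PowerSeries.coeff_smul, smul_eq_mul, mul_one] at h ⊢
    push_cast at h ⊢
    linear_combination h

theorem one_add_X_mul_derivative_log :
    (1 + PowerSeries.X) * PowerSeries.derivative ℂ (PowerSeries.log ℂ) = 1 := by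
  ext n
  rw [PowerSeries.deriv_log, add_mul, one_mul, map_add]
  cases n with
  | zero => simp
  | succ n => simp [PowerSeries.coeff_succ_X_mul, PowerSeries.coeff_one, pow_succ]

/-- `(1 + y) ^ z (-log (1 + y)) ^ r / r!`. -/
noncomputable def binomialLogSeries (z : ℂ) (r : ℕ) : PowerSeries ℂ :=
  (r.factorial : ℂ)⁻¹ • (PowerSeries.binomialSeries ℂ z * (-PowerSeries.log ℂ) ^ r)

theorem coeff_zero_binomialLogSeries (z : ℂ) (r : ℕ) :
    PowerSeries.coeff 0 (binomialLogSeries z r) = if r = 0 then 1 else 0 := by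
  rw [binomialLogSeries, PowerSeries.coeff_smul, PowerSeries.coeff_zero_eq_constantCoeff_apply,
    map_mul, map_pow, map_neg, PowerSeries.constantCoeff_log]
  split_ifs with h <;> simp [h]

theorem one_add_X_mul_derivative_binomialSeries_mul_pow (z : ℂ) (r : ℕ) :
    (1 + PowerSeries.X) * PowerSeries.derivative ℂ
        (PowerSeries.binomialSeries ℂ z * (-PowerSeries.log ℂ) ^ (r + 1)) =
      z • (PowerSeries.binomialSeries ℂ z * (-PowerSeries.log ℂ) ^ (r + 1)) -
        ((r : ℂ) + 1) • (PowerSeries.binomialSeries ℂ z * (-PowerSeries.log ℂ) ^ r) := by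
  have hb := one_add_X_mul_derivative_binomialSeries z
  have hl := one_add_X_mul_derivative_log
  rw [Derivation.leibniz, Derivation.leibniz_pow, map_neg, Nat.add_sub_cancel]
  simp only [smul_eq_mul, nsmul_eq_mul, PowerSeries.smul_eq_C_mul, map_add, map_natCast,
    map_one] at hb ⊢
  push_cast
  linear_combination (-PowerSeries.log ℂ) ^ (r + 1) * hb -
    ((r : PowerSeries ℂ) + 1) * PowerSeries.binomialSeries ℂ z * (-PowerSeries.log ℂ) ^ r * hl

/-- Writing `f_r` for the series, `(1 + y) f_r' = z f_r - f_{r-1}`. This is the recursion of the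
binomial polynomials evaluated at an operator `μ + N` with `z = -μ - m`, collected by powers of `N`.
-/
theorem coeff_succ_binomialLogSeries (z : ℂ) (r j : ℕ) :
    ((j : ℂ) + 1) * PowerSeries.coeff (j + 1) (binomialLogSeries z r) =
      (z - j) * PowerSeries.coeff j (binomialLogSeries z r) -
        if r = 0 then 0 else PowerSeries.coeff j (binomialLogSeries z (r - 1)) := by
  have h1 : (1 + PowerSeries.X) * PowerSeries.derivative ℂ (binomialLogSeries z r) =
      z • binomialLogSeries z r - if r = 0 then 0 else binomialLogSeries z (r - 1) := by
    cases r with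
    | zero =>
      simp only [binomialLogSeries, Nat.factorial_zero, Nat.cast_one, inv_one, one_smul, pow_zero,
        mul_one, if_true, sub_zero, one_add_X_mul_derivative_binomialSeries]
    | succ r =>
      have h4 : ((r : ℂ) + 1) ≠ 0 := Nat.cast_add_one_ne_zero _
      have h5 : ((r.factorial : ℂ))⁻¹ = ((r + 1).factorial : ℂ)⁻¹ * (r + 1) := by
        rw [Nat.factorial_succ]
        push_cast
        field_simp
      rw [if_neg (Nat.succ_ne_zero r), Nat.add_sub_cancel, binomialLogSeries, binomialLogSeries,
        Derivation.map_smul, mul_smul_comm, one_add_X_mul_derivative_binomialSeries_mul_pow, h5]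
      module
  have h2 := congrArg (PowerSeries.coeff j) h1
  rw [add_mul, one_mul, map_add, PowerSeries.coeff_derivative, map_sub, PowerSeries.coeff_smul,
    apply_ite (PowerSeries.coeff j), map_zero, smul_eq_mul] at h2
  cases j with
  | zero =>
    rw [PowerSeries.coeff_zero_X_mul] at h2
    push_cast at h2 ⊢
    linear_combination h2
  | succ j =>
    rw [PowerSeries.coeff_succ_X_mul, PowerSeries.coeff_derivative] at h2
    push_cast at h2 ⊢
    linear_combination h2

/-- The coefficients of `(1 + y) ^ (-T - m)` on a generalized eigenspace of `T`. -/
theorem IsTriangularizable.aeval_negBinomial {V : Type*} [AddCommGroup V] [Module ℂ V]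
    {T : Module.End ℂ V} (h : IsTriangularizable T) {μ : ℂ} {v : V}
    (hv : v ∈ T.maxGenEigenspace μ) (m j : ℕ) {K : ℕ} (hK : (nilpotentPart T ^ K) v = 0) :
    Polynomial.aeval T (negBinomial m j) v = ∑ r ∈ Finset.range K,
      PowerSeries.coeff j (binomialLogSeries (-μ - m) r) • (nilpotentPart T ^ r) v := by
  induction j with
  | zero =>
    simp only [negBinomial_zero, map_one, Module.End.one_apply, coeff_zero_binomialLogSeries]
    cases K with
    | zero => simpa using hK
    | succ K => rw [Finset.sum_range_succ']; simp
  | succ j ih =>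
    have h1 := LinearMap.congr_fun
      (congrArg (Polynomial.aeval T) (succ_mul_negBinomial_succ m j)) v
    have hj : ((j : ℂ) + 1) ≠ 0 := Nat.cast_add_one_ne_zero _
    rw [map_smul, LinearMap.smul_apply, map_mul, Module.End.mul_apply, ih] at h1
    refine smul_right_injective V hj ?_
    change ((j : ℂ) + 1) • _ = ((j : ℂ) + 1) • _
    rw [h1, Finset.smul_sum, map_sum]
    have hT (r : ℕ) : T ((nilpotentPart T ^ r) v) =
        μ • (nilpotentPart T ^ r) v + (nilpotentPart T ^ (r + 1)) v := by
      have hr : (nilpotentPart T ^ r) v ∈ T.maxGenEigenspace μ :=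
        Module.End.mem_maxGenEigenspace_of_commute
          ((h.commute_nilpotentPart (Commute.refl T)).pow_right r).symm hv
      rw [pow_succ', Module.End.mul_apply, h.nilpotentPart_apply hr]
      simp
    have h2 (r : ℕ) : Polynomial.aeval T (-Polynomial.X - Polynomial.C ((m : ℂ) + j))
        (PowerSeries.coeff j (binomialLogSeries (-μ - m) r) • (nilpotentPart T ^ r) v) =
        ((-μ - m - j) * PowerSeries.coeff j (binomialLogSeries (-μ - m) r)) •
          (nilpotentPart T ^ r) v -
        PowerSeries.coeff j (binomialLogSeries (-μ - m) r) • (nilpotentPart T ^ (r + 1)) v := by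
      simp only [map_sub, map_neg, Polynomial.aeval_X, Polynomial.aeval_C, map_smul,
        LinearMap.sub_apply, LinearMap.neg_apply, Module.algebraMap_end_apply, hT]
      module
    simp only [h2, smul_smul, coeff_succ_binomialLogSeries, Finset.sum_sub_distrib, sub_smul]
    congr 1
    -- Shifting the index `r` creates one boundary term, which contains `N ^ K v = 0`.
    cases K with
    | zero => simp
    | succ K => rw [Finset.sum_range_succ, Finset.sum_range_succ', hK]; simp

theorem LinearMap.pow_apply_leibniz {V : Type*} [AddCommGroup V] [Module ℂ V]
    (f : V →ₗ[ℂ] V →ₗ[ℂ] V) {A B C : Module.End ℂ V}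
    (h : ∀ a b, A (f a b) = f (B a) b + f a (C b)) (p : ℕ) (a b : V) :
    (A ^ p) (f a b) = ∑ x ∈ Finset.HasAntidiagonal.antidiagonal p,
      p.choose x.1 • f ((B ^ x.1) a) ((C ^ x.2) b) := by
  induction p with
  | zero => simp
  | succ p ih =>
    rw [Finset.sum_antidiagonal_choose_succ_nsmul (fun i j => f ((B ^ i) a) ((C ^ j) b)), pow_succ',
      Module.End.mul_apply, ih, map_sum, ← Finset.sum_add_distrib]
    refine Finset.sum_congr rfl fun x hx => ?_
    have hs : p.choose x.1 = p.choose x.2 := by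
      rw [← Finset.HasAntidiagonal.mem_antidiagonal.1 hx]
      exact Nat.choose_symm_add
    rw [map_nsmul, h, pow_succ' C, pow_succ' B, Module.End.mul_apply, Module.End.mul_apply, nsmul_add,
      add_comm, hs]

/-- Both sides run over the decompositions of `l` into four parts, nested differently. -/
theorem sum_antidiagonal_comm₄ {M : Type*} [AddCommMonoid M] (l : ℕ) (F : ℕ → ℕ → ℕ → ℕ → M) :
    ∑ x ∈ Finset.HasAntidiagonal.antidiagonal l, ∑ y ∈ Finset.HasAntidiagonal.antidiagonal x.2,
      ∑ a ∈ Finset.HasAntidiagonal.antidiagonal y.1, F x.1 y.2 a.1 a.2 =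
    ∑ q ∈ Finset.HasAntidiagonal.antidiagonal l, ∑ r ∈ Finset.HasAntidiagonal.antidiagonal q.2,
      ∑ x ∈ Finset.HasAntidiagonal.antidiagonal r.2, F x.1 x.2 r.1 q.1 := by
  simp only [Finset.sum_sigma']
  refine Finset.sum_nbij'
    (fun z => ⟨(z.2.2.2, l - z.2.2.2), (z.2.2.1, z.1.1 + z.2.1.2), (z.1.1, z.2.1.2)⟩)
    (fun z => ⟨(z.2.2.1, l - z.2.2.1), (z.2.1.1 + z.1.1, z.2.2.2), (z.2.1.1, z.1.1)⟩)
    ?_ ?_ ?_ ?_ ?_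
  all_goals
    rintro ⟨⟨a, b⟩, ⟨c, d⟩, ⟨e, f⟩⟩ hz
    simp only [Finset.mem_sigma, Finset.HasAntidiagonal.mem_antidiagonal] at hz ⊢
  · lia
  · lia
  · obtain ⟨rfl, rfl, rfl⟩ := hz
    simp
  · obtain ⟨rfl, rfl, rfl⟩ := hz
    simp

theorem sum_range_antidiagonal_eq_sum_range {G : Type*} [AddCommGroup G] {F : ℕ → ℕ → G} {J : ℕ}
    (hF : ∀ i j, J ≤ i + j → F i j = 0) :
    ∑ n ∈ Finset.range J, ∑ p ∈ Finset.HasAntidiagonal.antidiagonal n, F p.1 p.2 =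
      ∑ i ∈ Finset.range J, ∑ j ∈ Finset.range J, F i j := by
  rw [← sum_range_antidiagonal_eq (Q := J + J) (fun i j h => hF i j (by lia))
    (fun i j h => hF i j (by lia)) (by lia)]
  refine Finset.sum_subset (by simp) fun n _ hn => Finset.sum_eq_zero fun p hp => hF _ _ ?_
  rw [Finset.HasAntidiagonal.mem_antidiagonal.1 hp]
  simpa using hn

/-! ### Moving Δ through an iterate of vertex operators. -/

namespace VertexOperatorAlgebra

open KernelRing

variable {V W : Type*} [AddCommGroup V] [Module ℂ V] [AddCommGroup W] [Module ℂ W]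
  (𝒱 : VertexOperatorAlgebra V)

/-- As `Y_0(u)` is a derivation of every product, `Y_0(u) - (μ + ν)` satisfies a Leibniz rule with
`Y_0(u) - μ` and `Y_0(u) - ν`; in a high enough power, each term contains a vanishing factor. -/
theorem mode_mem_maxGenEigenspace (u : V) {μ ν : ℂ} {a b : V}
    (ha : a ∈ (𝒱.mode u 0).maxGenEigenspace μ) (hb : b ∈ (𝒱.mode u 0).maxGenEigenspace ν) (n : ℤ) :
    𝒱.mode a n b ∈ (𝒱.mode u 0).maxGenEigenspace (μ + ν) := by
  rw [Module.End.mem_maxGenEigenspace] at ha hb ⊢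
  obtain ⟨k, hk⟩ := ha
  obtain ⟨l, hl⟩ := hb
  refine ⟨k + l, ?_⟩
  have h (a b : V) : (𝒱.mode u 0 - (μ + ν) • (1 : Module.End ℂ V)) (𝒱.modeHom n a b) =
      𝒱.modeHom n ((𝒱.mode u 0 - μ • (1 : Module.End ℂ V)) a) b +
      𝒱.modeHom n a ((𝒱.mode u 0 - ν • (1 : Module.End ℂ V)) b) := by
    simp only [LinearMap.sub_apply, LinearMap.smul_apply, Module.End.one_apply, map_sub, map_smul,
      modeHom_apply, 𝒱.mode_zero_derivation]
    module
  refine (LinearMap.pow_apply_leibniz (𝒱.modeHom n) h (k + l) a b).trans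
    (Finset.sum_eq_zero fun x hx => ?_)
  rw [Finset.HasAntidiagonal.mem_antidiagonal] at hx
  rcases le_total k x.1 with h1 | h1
  · rw [Module.End.pow_apply_eq_zero_of_le h1 hk, map_zero, LinearMap.zero_apply, smul_zero]
  · rw [Module.End.pow_apply_eq_zero_of_le (k := l) (by lia) hl, map_zero, smul_zero]

/-- The nilpotent part of a derivation is a derivation. On generalized eigenvectors the eigenvalues
add, so subtracting them preserves the Leibniz rule. -/
theorem nilpotentPart_mode {u : V} (hu : u ∈ 𝒱.grade 1) (a b : V) (n : ℤ) :
    nilpotentPart (𝒱.mode u 0) (𝒱.modeHom n a b) =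
      𝒱.modeHom n (nilpotentPart (𝒱.mode u 0) a) b +
        𝒱.modeHom n a (nilpotentPart (𝒱.mode u 0) b) := by
  have hT := 𝒱.isTriangularizable_zeroMode hu
  refine hT.induction (p := fun a => nilpotentPart (𝒱.mode u 0) (𝒱.modeHom n a b) =
      𝒱.modeHom n (nilpotentPart (𝒱.mode u 0) a) b +
        𝒱.modeHom n a (nilpotentPart (𝒱.mode u 0) b)) (fun μ a ha => ?_) (by simp) ?_ a
  · refine hT.induction (p := fun b => nilpotentPart (𝒱.mode u 0) (𝒱.modeHom n a b) =
      𝒱.modeHom n (nilpotentPart (𝒱.mode u 0) a) b +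
        𝒱.modeHom n a (nilpotentPart (𝒱.mode u 0) b)) (fun ν b hb => ?_) (by simp) ?_ b
    · rw [hT.nilpotentPart_apply ha, hT.nilpotentPart_apply hb, 𝒱.modeHom_apply n a,
        hT.nilpotentPart_apply (𝒱.mode_mem_maxGenEigenspace u ha hb n)]
      simp only [LinearMap.sub_apply, LinearMap.smul_apply, Module.End.one_apply, map_sub, map_smul,
        modeHom_apply, 𝒱.mode_zero_derivation]
      module
    · intro v w hv hw
      simp only [map_add, hv, hw]
      abel
  · intro v w hv hw
    simp only [map_add, LinearMap.add_apply, hv, hw]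
    abel

/-- The family of coefficients of `x₀ ^ (-n-1+j) x₂ ^ (c+j) (log x₂) ^ l` built from a family `Φ` by
composition with `Y(·, x₀) v₂`. -/
noncomputable def iterateFamily (Φ : ℂ → ℕ → V →ₗ[ℂ] W) (n : ℤ) (c : ℂ) (v₂ : V) (j l : ℕ) :
    V →ₗ[ℂ] W :=
  Φ (c + j) l ∘ₗ (𝒱.modeHom (n + j)).flip v₂

theorem iterateFamily_apply (Φ : ℂ → ℕ → V →ₗ[ℂ] W) (n : ℤ) (c : ℂ) (v₂ : V) (j l : ℕ) (t : V) :
    𝒱.iterateFamily Φ n c v₂ j l t = Φ (c + j) l (𝒱.mode t (n + j) v₂) := rfl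

/-- Composition of a family of coefficients with `x ^ (-N)` for a locally nilpotent operator `N`. -/
noncomputable def logTwist (N : Module.End ℂ V) (Φ : ℂ → ℕ → V →ₗ[ℂ] W) (a : ℂ) (l : ℕ) :
    V →ₗ[ℂ] W :=
  ∑ y ∈ Finset.HasAntidiagonal.antidiagonal l,
    ((-1 : ℂ) ^ y.1 * (y.1.factorial : ℂ)⁻¹) • (Φ a y.2 ∘ₗ N ^ y.1)

theorem logTwist_apply (N : Module.End ℂ V) (Φ : ℂ → ℕ → V →ₗ[ℂ] W) (a : ℂ) (l : ℕ) (t : V) :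
    logTwist N Φ a l t = ∑ y ∈ Finset.HasAntidiagonal.antidiagonal l,
      ((-1 : ℂ) ^ y.1 * (y.1.factorial : ℂ)⁻¹) • Φ a y.2 ((N ^ y.1) t) := by
  simp [logTwist, LinearMap.sum_apply]

/-- For a derivation `N`, the operator `x₂^(-N)` distributes over a product: `x₂^(-N) Y(t, x₀) v₂ =
Y(x₂^(-N) t, x₀) x₂^(-N) v₂`. The factor on `t` becomes an exponential on the kernel side. -/
theorem kernelPairing_iterateFamily_logTwist {N : Module.End ℂ V} (hN : IsLocallyNilpotent N)
    (hder : ∀ a b n, N (𝒱.modeHom n a b) = 𝒱.modeHom n (N a) b + 𝒱.modeHom n a (N b))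
    (Φ : ℂ → ℕ → V →ₗ[ℂ] W) (n : ℤ) (c : ℂ) (v₂ : V) (J k l : ℕ) (z : KernelRing ⊗[ℂ] V) :
    kernelPairing J (𝒱.iterateFamily (logTwist N Φ) n c v₂) k l z =
      ∑ q ∈ Finset.HasAntidiagonal.antidiagonal l, ((-1 : ℂ) ^ q.1 * (q.1.factorial : ℂ)⁻¹) •
        kernelPairing J (𝒱.iterateFamily Φ n c ((N ^ q.1) v₂)) k q.2
          (nilExp (kernelMap (-logX₂) N) z) := by
  induction z with
  | zero => simp
  | add x y hx hy => simp only [map_add, hx, hy, smul_add, Finset.sum_add_distrib]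
  | tmul κ t =>
    have hL (p : ℕ) (n : ℤ) : ((-1 : ℂ) ^ p * (p.factorial : ℂ)⁻¹) • (N ^ p) (𝒱.mode t n v₂) =
        ∑ a ∈ Finset.HasAntidiagonal.antidiagonal p,
          (((-1 : ℂ) ^ a.1 * (a.1.factorial : ℂ)⁻¹) * ((-1 : ℂ) ^ a.2 * (a.2.factorial : ℂ)⁻¹)) •
            𝒱.mode ((N ^ a.1) t) n ((N ^ a.2) v₂) := by
      have h := LinearMap.pow_apply_leibniz (𝒱.modeHom n) (fun a b => hder a b n) p t v₂
      rw [← modeHom_apply, h, Finset.smul_sum]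
      refine Finset.sum_congr rfl fun a ha => ?_
      rw [Finset.HasAntidiagonal.mem_antidiagonal] at ha
      subst ha
      rw [← Nat.cast_smul_eq_nsmul ℂ, smul_smul, modeHom_apply, Nat.choose_symm_add, Nat.add_choose,
        Nat.cast_div (Nat.factorial_mul_factorial_dvd_factorial_add _ _)
          (Nat.cast_ne_zero.2 (by positivity))]
      congr 1
      have h1 : ((a.1 + a.2).factorial : ℂ) ≠ 0 := Nat.cast_ne_zero.2 (Nat.factorial_ne_zero _)
      have h2 : (a.1.factorial : ℂ) ≠ 0 := Nat.cast_ne_zero.2 (Nat.factorial_ne_zero _)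
      have h3 : (a.2.factorial : ℂ) ≠ 0 := Nat.cast_ne_zero.2 (Nat.factorial_ne_zero _)
      push_cast
      field_simp
      ring
    simp only [kernelPairing_nilExp_logX₂ hN, kernelMap_tmul, one_mul, kernelPairing_tmul,
      iterateFamily_apply, logTwist_apply, Finset.smul_sum]
    have h1 : ∀ j, ∀ x ∈ Finset.HasAntidiagonal.antidiagonal l,
        ∀ y ∈ Finset.HasAntidiagonal.antidiagonal x.2,
        kcoeff j k x.1 κ • ((-1 : ℂ) ^ y.1 * (y.1.factorial : ℂ)⁻¹) •
          Φ (c + j) y.2 ((N ^ y.1) (𝒱.mode t (n + j) v₂)) =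
        ∑ a ∈ Finset.HasAntidiagonal.antidiagonal y.1,
          (kcoeff j k x.1 κ * (((-1 : ℂ) ^ a.1 * (a.1.factorial : ℂ)⁻¹) *
            ((-1 : ℂ) ^ a.2 * (a.2.factorial : ℂ)⁻¹))) •
            Φ (c + j) y.2 (𝒱.mode ((N ^ a.1) t) (n + j) ((N ^ a.2) v₂)) := by
      intro j x _ y _
      rw [← map_smul, hL, map_sum, Finset.smul_sum]
      simp only [map_smul, smul_smul]
    rw [Finset.sum_congr rfl fun j _ => Finset.sum_congr rfl fun x hx =>
      Finset.sum_congr rfl (h1 j x hx)]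
    rw [Finset.sum_congr rfl fun j _ => sum_antidiagonal_comm₄ l (fun x y a b =>
      (kcoeff j k x κ * (((-1 : ℂ) ^ a * (a.factorial : ℂ)⁻¹) *
        ((-1 : ℂ) ^ b * (b.factorial : ℂ)⁻¹))) •
          Φ (c + j) y (𝒱.mode ((N ^ a) t) (n + j) ((N ^ b) v₂)))]
    rw [Finset.sum_comm]
    refine Finset.sum_congr rfl fun q _ => ?_
    rw [Finset.sum_comm]
    refine Finset.sum_congr rfl fun r _ => Finset.sum_congr rfl fun j _ =>
      Finset.sum_congr rfl fun x _ => ?_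
    rw [smul_smul, smul_smul]
    congr 1
    ring

/-- The pairing with `(1 + y) ^ (-T - m)`, in terms of the coefficients of that series. -/
theorem _root_.IsTriangularizable.kernelPairing_nilExp_log {T : Module.End ℂ V}
    (h : IsTriangularizable T) {μ : ℂ} {s : V} (hs : s ∈ T.maxGenEigenspace μ) (m J k l : ℕ)
    (P : ℕ → ℕ → V →ₗ[ℂ] W)
    (hP : ∀ i l r, J ≤ i → P i l ((nilpotentPart T ^ r) s) = 0) (κ : KernelRing) :
    kernelPairing J P k l (nilExp (kernelMap (-(ofSeries (PowerSeries.log ℂ))) (nilpotentPart T))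
      ((ofSeries (PowerSeries.binomialSeries ℂ (-μ - m)) * κ) ⊗ₜ s)) =
    ∑ j ∈ Finset.range J, ∑ j' ∈ Finset.range J, ∑ x ∈ Finset.HasAntidiagonal.antidiagonal l,
      kcoeff j k x.1 κ • P (j + j') x.2 (Polynomial.aeval T (negBinomial m j') s) := by
  have hN := h.isLocallyNilpotent_nilpotentPart
  obtain ⟨K, hK⟩ := hN s
  have hc (r : ℕ) : (r.factorial : ℂ)⁻¹ • ((-(ofSeries (PowerSeries.log ℂ))) ^ r *
      (ofSeries (PowerSeries.binomialSeries ℂ (-μ - m)) * κ)) =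
      ofSeries (binomialLogSeries (-μ - m) r) * κ := by
    rw [binomialLogSeries, map_smul, map_mul, map_pow, map_neg, smul_mul_assoc]
    congr 1
    ring
  rw [hN.nilExp_kernelMap_tmul _ _ hK]
  simp only [TensorProduct.smul_tmul', hc, map_sum, kernelPairing_tmul, kcoeff_ofSeries_mul,
    h.aeval_negBinomial hs m _ hK, map_smul, Finset.smul_sum, Finset.sum_smul, smul_smul]
  have h1 (r : ℕ) : ∑ j ∈ Finset.range J, ∑ x ∈ Finset.HasAntidiagonal.antidiagonal l,
      ∑ a ∈ Finset.HasAntidiagonal.antidiagonal j,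
        (PowerSeries.coeff a.1 (binomialLogSeries (-μ - m) r) * kcoeff a.2 k x.1 κ) •
          P j x.2 ((nilpotentPart T ^ r) s) =
      ∑ j' ∈ Finset.range J, ∑ j ∈ Finset.range J, ∑ x ∈ Finset.HasAntidiagonal.antidiagonal l,
        (PowerSeries.coeff j' (binomialLogSeries (-μ - m) r) * kcoeff j k x.1 κ) •
          P (j + j') x.2 ((nilpotentPart T ^ r) s) := by
    rw [← sum_range_antidiagonal_eq_sum_range]
    · refine Finset.sum_congr rfl fun j _ => ?_
      rw [Finset.sum_comm]
      refine Finset.sum_congr rfl fun a ha => ?_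
      rw [← Finset.HasAntidiagonal.mem_antidiagonal.1 ha, add_comm a.1]
    · intro i j hij
      refine Finset.sum_eq_zero fun x _ => ?_
      rw [hP _ _ _ (by lia), smul_zero]
  rw [Finset.sum_congr rfl fun r _ => h1 r, Finset.sum_comm]
  conv_rhs => rw [Finset.sum_comm]
  refine Finset.sum_congr rfl fun j' _ => ?_
  rw [Finset.sum_comm]
  refine Finset.sum_congr rfl fun j _ => ?_
  rw [Finset.sum_comm]
  refine Finset.sum_congr rfl fun x _ => Finset.sum_congr rfl fun r _ => ?_
  rw [mul_comm]

end VertexOperatorAlgebra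

theorem Module.End.aeval_apply_mem {V : Type*} [AddCommGroup V] [Module ℂ V] {T : Module.End ℂ V}
    {p : Submodule ℂ V} (h : ∀ v ∈ p, T v ∈ p) (f : Polynomial ℂ) {v : V} (hv : v ∈ p) :
    Polynomial.aeval T f v ∈ p := by
  rw [Polynomial.aeval_eq_sum_range, LinearMap.sum_apply]
  exact sum_mem fun i _ => p.smul_mem _ (Module.End.pow_apply_mem h i v hv)

namespace VertexOperatorAlgebra

open KernelRing

variable {V W : Type*} [AddCommGroup V] [Module ℂ V] [AddCommGroup W] [Module ℂ W]
  (𝒱 : VertexOperatorAlgebra V)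

theorem commute_L_zero {A : Module.End ℂ V} (hA : ∀ n, ∀ v ∈ 𝒱.grade n, A v ∈ 𝒱.grade n) :
    Commute (𝒱.mode 𝒱.omega 1) A := by
  refine 𝒱.grade_ext fun n v hv => ?_
  have h1 : 𝒱.mode 𝒱.omega 1 v = (n : ℂ) • v := 𝒱.L_zero n v hv
  have h2 : 𝒱.mode 𝒱.omega 1 (A v) = (n : ℂ) • A v := 𝒱.L_zero n _ (hA n v hv)
  rw [Module.End.mul_apply, Module.End.mul_apply, h1, h2, map_smul]

theorem apply_mem_filtration_of_commute {A : Module.End ℂ V} (hA : Commute A (𝒱.mode 𝒱.omega 1))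
    {q : ℤ} {v : V} (hv : v ∈ 𝒱.filtration q) : A v ∈ 𝒱.filtration q :=
  𝒱.apply_mem_filtration (fun n _ h => 𝒱.mem_grade_of_commute hA n h) hv

section WeightOne

variable {u : V} (hu : u ∈ 𝒱.grade 1) (hV0 : 𝒱.grade 0 = Submodule.span ℂ {𝒱.vac})
  (hVneg : ∀ n : ℤ, n < 0 → 𝒱.grade n = ⊥)

include hu in
theorem commute_nilpotentPart_L_zero :
    Commute (nilpotentPart (𝒱.mode u 0)) (𝒱.mode 𝒱.omega 1) :=
  ((𝒱.isTriangularizable_zeroMode hu).commute_nilpotentPart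
    (𝒱.commute_L_zero fun _ _ h => 𝒱.zeroMode_mem_grade hu h)).symm

include hu in
theorem aeval_zeroMode_mem_filtration (f : Polynomial ℂ) {q : ℤ} {v : V}
    (hv : v ∈ 𝒱.filtration q) : Polynomial.aeval (𝒱.mode u 0) f v ∈ 𝒱.filtration q :=
  Module.End.aeval_apply_mem
    (fun _ h => 𝒱.apply_mem_filtration (fun _ _ h => 𝒱.zeroMode_mem_grade hu h) h) f hv

include hu hV0 hVneg

theorem deltaExpCoeff_mem_filtration_self (m : ℕ) {q : ℤ} {v : V} (hv : v ∈ 𝒱.filtration q) :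
    𝒱.deltaExpCoeff u m v ∈ 𝒱.filtration q :=
  𝒱.filtration_mono (by lia) (𝒱.deltaExpCoeff_mem_filtration hu hV0 hVneg m hv)

/-- The iterate of a family `Φ'` obtained from `Φ` by the semisimple part of `Δ(x)`. -/
theorem kernelPairing_iterateFamily_delta {Φ Φ' : ℂ → ℕ → V →ₗ[ℂ] W}
    (hΦ : ∀ μ, ∀ v ∈ (𝒱.mode u 0).maxGenEigenspace μ, ∀ q : ℤ, v ∈ 𝒱.filtration q → ∀ Q : ℕ, q < Q →
      ∀ a l, Φ' a l v = ∑ m ∈ Finset.range Q, Φ (a + μ + m) l (𝒱.deltaExpCoeff u m v))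
    {μ ν : ℂ} {t v₂ : V} (ht : t ∈ (𝒱.mode u 0).maxGenEigenspace μ)
    (hv₂ : v₂ ∈ (𝒱.mode u 0).maxGenEigenspace ν) {p q : ℤ} (hp : t ∈ 𝒱.filtration p)
    (hq : v₂ ∈ 𝒱.filtration q) {Q₁ Q₂ : ℕ} (hQ₁ : p < Q₁) (hQ₂ : q < Q₂) (n : ℤ) (c : ℂ) {J : ℕ}
    (hJ : p + q ≤ n + J) (k l : ℕ) (κ : KernelRing) :
    kernelPairing J (𝒱.iterateFamily Φ' n c v₂) k l (κ ⊗ₜ t) =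
      ∑ m₁ ∈ Finset.range Q₁, ∑ m₂ ∈ Finset.range Q₂,
        kernelPairing J (𝒱.iterateFamily Φ n (c + μ + ν + m₁ + m₂) (𝒱.deltaExpCoeff u m₂ v₂)) k l
          (nilExp (kernelMap (-(ofSeries (PowerSeries.log ℂ))) (nilpotentPart (𝒱.mode u 0)))
            ((ofSeries (PowerSeries.binomialSeries ℂ (-μ - m₁)) * κ) ⊗ₜ
              𝒱.deltaExpCoeff u m₁ t)) := by
  have hT := 𝒱.isTriangularizable_zeroMode hu
  have hS (m j : ℕ) : 𝒱.shiftedDeltaCoeff u m j t ∈ 𝒱.filtration p :=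
    𝒱.aeval_zeroMode_mem_filtration hu _ (𝒱.deltaExpCoeff_mem_filtration_self hu hV0 hVneg m hp)
  have hD (m : ℕ) : 𝒱.deltaExpCoeff u m v₂ ∈ 𝒱.filtration q :=
    𝒱.deltaExpCoeff_mem_filtration_self hu hV0 hVneg m hq
  have hR (m₁ m₂ : ℕ) := hT.kernelPairing_nilExp_log
    (𝒱.deltaExpCoeff_mem_maxGenEigenspace hu hV0 hVneg m₁ ht) m₁ J k l
    (𝒱.iterateFamily Φ n (c + μ + ν + m₁ + m₂) (𝒱.deltaExpCoeff u m₂ v₂)) (by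
      intro i l r hi
      rw [iterateFamily_apply, 𝒱.mode_eq_zero hVneg (p := p) (q := q) _ (hD m₂) (by lia), map_zero]
      exact Module.End.pow_apply_mem (fun _ h => 𝒱.apply_mem_filtration_of_commute
        (𝒱.commute_nilpotentPart_L_zero hu) h) r _
        (𝒱.deltaExpCoeff_mem_filtration_self hu hV0 hVneg m₁ hp)) κ
  simp only [hR, kernelPairing_tmul]
  have hL (j l' : ℕ) : 𝒱.iterateFamily Φ' n c v₂ j l' t =
      ∑ m₁ ∈ Finset.range Q₁, ∑ m₂ ∈ Finset.range Q₂, ∑ j' ∈ Finset.range J,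
        𝒱.iterateFamily Φ n (c + μ + ν + m₁ + m₂) (𝒱.deltaExpCoeff u m₂ v₂) (j + j') l'
          (Polynomial.aeval (𝒱.mode u 0) (negBinomial m₁ j') (𝒱.deltaExpCoeff u m₁ t)) := by
    -- The cutoff is chosen to exceed the weight of the product and to contain the whole box `m₁ <
    -- Q₁`, `j' < J`, `m₂ < Q₂` in which the conjugation formula has nonzero terms.
    rw [iterateFamily_apply, hΦ _ _ (𝒱.mode_mem_maxGenEigenspace u ht hv₂ (n + j)) _
      (𝒱.filtration_mono (by lia : p + q - (n + j) - 1 ≤ J) (𝒱.mode_mem_filtration hp hq _))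
      (Q₁ + J + Q₂ + J + 1) (by lia)]
    simp only [𝒱.deltaExpCoeff_mode hu hV0 hVneg, map_sum]
    -- `G` vanishes outside that box: by the weights of `t` and `v₂` in `m₁` and `m₂`, and by
    -- truncation of the mode in `j'`. Hence the nested antidiagonal sums become independent sums.
    set G : ℕ → ℕ → ℕ → W := fun m₁ j' m₂ =>
      𝒱.iterateFamily Φ n (c + μ + ν + m₁ + m₂) (𝒱.deltaExpCoeff u m₂ v₂) (j + j') l'
        (𝒱.shiftedDeltaCoeff u m₁ j' t) with hG
    have hG₁ (m₁ j' m₂ : ℕ) (h : Q₁ ≤ m₁) : G m₁ j' m₂ = 0 := by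
      simp only [hG, shiftedDeltaCoeff, Module.End.mul_apply]
      rw [𝒱.deltaExpCoeff_eq_zero hu hV0 hVneg hp (by lia), map_zero, map_zero]
    have hG₂ (m₁ j' m₂ : ℕ) (h : Q₂ ≤ m₂) : G m₁ j' m₂ = 0 := by
      simp only [hG, iterateFamily_apply]
      rw [𝒱.deltaExpCoeff_eq_zero hu hV0 hVneg hq (by lia), map_zero, map_zero]
    have hGJ (m₁ j' m₂ : ℕ) (h : J ≤ j') : G m₁ j' m₂ = 0 := by
      simp only [hG, iterateFamily_apply]
      rw [𝒱.mode_eq_zero hVneg (hS m₁ j') (hD m₂) (by lia), map_zero]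
    have h1 : ∀ M : ℕ, ∀ x ∈ Finset.HasAntidiagonal.antidiagonal M,
        ∀ r ∈ Finset.HasAntidiagonal.antidiagonal x.1,
        Φ (c + j + (μ + ν) + M) l' (𝒱.mode (𝒱.shiftedDeltaCoeff u r.1 r.2 t) (n + j + r.2)
          (𝒱.deltaExpCoeff u x.2 v₂)) = G r.1 r.2 x.2 := by
      intro M x hx r hr
      rw [Finset.HasAntidiagonal.mem_antidiagonal] at hx hr
      simp only [hG, iterateFamily_apply]
      rw [← hx, ← hr]
      push_cast
      rw [add_assoc n]
      congr 2
      ring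
    rw [Finset.sum_congr rfl fun M _ => Finset.sum_congr rfl fun x hx =>
      Finset.sum_congr rfl (h1 M x hx),
      sum_range_antidiagonal_eq (K := Q₁ + J) (L := Q₂)
        (F := fun a b => ∑ r ∈ Finset.HasAntidiagonal.antidiagonal a, G r.1 r.2 b) _ _ (by lia),
      Finset.sum_comm]
    · rw [Finset.sum_congr rfl fun m₂ _ => sum_range_antidiagonal_eq (K := Q₁) (L := J)
        (F := fun a b => G a b m₂) (fun i j' h => hG₁ i j' m₂ h) (fun i j' h => hGJ i j' m₂ h)
        (by lia), Finset.sum_comm]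
      rfl
    · intro a b hab
      refine Finset.sum_eq_zero fun r hr => ?_
      rw [Finset.HasAntidiagonal.mem_antidiagonal] at hr
      rcases le_total Q₁ r.1 with h | h
      · exact hG₁ _ _ _ h
      · exact hGJ _ _ _ (by lia)
    · exact fun a b hab => Finset.sum_eq_zero fun r _ => hG₂ _ _ _ hab
  simp only [hL, Finset.smul_sum]
  rw [Finset.sum_congr rfl fun j _ => Finset.sum_comm, Finset.sum_comm]
  refine Finset.sum_congr rfl fun m₁ _ => ?_
  rw [Finset.sum_congr rfl fun j _ => Finset.sum_comm, Finset.sum_comm]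
  refine Finset.sum_congr rfl fun m₂ _ => Finset.sum_congr rfl fun j _ => ?_
  rw [Finset.sum_comm]

end WeightOne
end VertexOperatorAlgebra

/-! ### Coefficients of the iterate in the twisted Jacobi identity. -/

namespace VertexOperatorAlgebra

open KernelRing

variable {V W : Type*} [AddCommGroup V] [Module ℂ V] [AddCommGroup W] [Module ℂ W]
  (𝒱 : VertexOperatorAlgebra V)

/-- The coefficient of `x ^ a (log x) ^ l` in `Y(v, x) w` as a linear function of `v`. -/
noncomputable def logCoeffFamily (Y : V →ₗ[ℂ] W →ₗ[ℂ] LogSeries W) (w : W) (a : ℂ) (l : ℕ) :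
    V →ₗ[ℂ] W :=
  LinearMap.proj a ∘ₗ Finsupp.lapply l ∘ₗ Y.flip w

theorem logCoeffFamily_apply (Y : V →ₗ[ℂ] W →ₗ[ℂ] LogSeries W) (w : W) (a : ℂ) (l : ℕ) (v : V) :
    logCoeffFamily Y w a l v = logCoeff Y v a l w := rfl

theorem coeff_Y (t : V) (n : ℤ) (j : ℕ) (v₂ : V) :
    HVertexOperator.coeff (𝒱.Y t) (-n - 1 - j) v₂ = 𝒱.mode t (n + j) v₂ := by
  rw [show -n - 1 - (j : ℤ) = -(n + j) - 1 by ring]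
  rfl

theorem exists_mode_eq_zero (hVneg : ∀ n : ℤ, n < 0 → 𝒱.grade n = ⊥) (t v₂ : V) (n : ℤ) :
    ∃ J : ℕ, ∀ j : ℕ, J ≤ j → 𝒱.mode t (n + j) v₂ = 0 := by
  obtain ⟨p, hp⟩ := 𝒱.exists_mem_filtration t
  obtain ⟨q, hq⟩ := 𝒱.exists_mem_filtration v₂
  exact ⟨(p + q - n).toNat, fun j hj => 𝒱.mode_eq_zero hVneg hp hq (by lia)⟩

/-- The coefficients of the iterate in the twisted Jacobi identity. -/
theorem jacobiIterate_eq {𝓛 : Module.End ℂ V} (h𝓛 : IsTriangularizable 𝓛)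
    (Y : V →ₗ[ℂ] W →ₗ[ℂ] LogSeries W) {α : ℂ} {v₁ : V} (hv : v₁ ∈ 𝓛.maxGenEigenspace α) (v₂ : V)
    (n : ℤ) {J : ℕ} (hJ : ∀ r j : ℕ, J ≤ j → 𝒱.mode ((nilpotentPart 𝓛 ^ r) v₁) (n + j) v₂ = 0)
    (w : W) (b c : ℂ) (k l : ℕ) [Decidable (∃ m : ℤ, b = -1 - (m + α))] :
    jacobiIterate 𝒱 𝓛 Y v₁ v₂ w n b c k l = if ∃ m : ℤ, b = -1 - (m + α) then
      kernelPairing J (𝒱.iterateFamily (logCoeffFamily Y w) n (c - (-1 - b)) v₂) k l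
        (nilExp (kernelMap (logSum - logX₁) (nilpotentPart 𝓛))
          (ofSeries (PowerSeries.binomialSeries ℂ (-1 - b)) ⊗ₜ v₁)) else 0 := by
  classical
  have hN := h𝓛.isLocallyNilpotent_nilpotentPart
  obtain ⟨K, hK⟩ := hN v₁
  rw [jacobiIterate, h𝓛.xPow_apply hv hK, hN.nilExp_kernelMap_tmul _ _ hK, map_sum,
    Finsupp.sum_of_support_subset (s := (Finset.range K).image fun r => (α, r))]
  · rw [Finset.sum_image fun _ _ _ _ h => (Prod.ext_iff.1 h).2]
    have h1 (r : ℕ) (hr : r ∈ Finset.range K) :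
        (∑ i ∈ Finset.range K, Finsupp.single (α, i)
          ((i.factorial : ℂ)⁻¹ • (nilpotentPart 𝓛 ^ i) v₁)) (α, r) =
        (r.factorial : ℂ)⁻¹ • (nilpotentPart 𝓛 ^ r) v₁ := by
      rw [Finsupp.finsetSum_apply, Finset.sum_eq_single r]
      · simp
      · intro i _ hi
        rw [Finsupp.single_apply, if_neg (by simpa using hi)]
      · exact fun h => absurd hr h
    split_ifs with hb
    · obtain ⟨m, hm⟩ := hb
      refine Finset.sum_congr rfl fun r hr => ?_
      -- The exponent `b` of `x₁` determines the summand `m` of the delta function, through `m + α =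
      -- -1 - b`.
      rw [h1 r hr, finsum_eq_single _ m, if_pos hm, finsum_eq_sum_of_support_subset (s := Finset.range J)]
      · rw [map_smul (kernelPairing _ _ _ _), kernelPairing_tmul, Finset.smul_sum]
        refine Finset.sum_congr rfl fun j _ => ?_
        rw [Finset.smul_sum]
        refine Finset.sum_congr rfl fun q _ => ?_
        rw [coeff_Y, mode_smul, jacobiKernel_eq, iterateFamily_apply, ← logCoeffFamily_apply,
          show (m : ℂ) + (α, r).1 = -1 - b by rw [hm]; ring, mul_comm (ofSeries _),
          LinearMap.smul_apply, map_smul, smul_comm]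
      · intro j hj
        rw [Finset.coe_range, Set.mem_Iio]
        by_contra hj'
        refine hj (Finset.sum_eq_zero fun q _ => ?_)
        rw [coeff_Y, mode_smul, LinearMap.smul_apply, hJ r j (by lia), smul_zero,
          ← logCoeffFamily_apply, map_zero, smul_zero]
      · intro m' hm'
        rw [if_neg]
        intro h
        rw [hm] at h
        exact hm' (by exact_mod_cast (by linear_combination h : (m' : ℂ) = m))
    · refine Finset.sum_eq_zero fun r hr => ?_
      refine finsum_eq_zero_of_forall_eq_zero fun m => if_neg fun h => hb ⟨m, h⟩
  · intro p hp
    rw [Finsupp.mem_support_iff, Finsupp.finsetSum_apply] at hp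
    obtain ⟨i, hi, hp⟩ := Finset.exists_ne_zero_of_sum_ne_zero hp
    rw [Finsupp.single_apply_ne_zero] at hp
    simpa using ⟨i, by simpa using hi, hp.1.symm⟩
  · intro p _
    have h0 (a : ℂ) (l : ℕ) : logCoeff Y 0 a l = 0 := by simp [logCoeff]
    simp [h0]

section WeightOne

variable {u : V} (hu : u ∈ 𝒱.grade 1) (hV0 : 𝒱.grade 0 = Submodule.span ℂ {𝒱.vac})
  (hVneg : ∀ n : ℤ, n < 0 → 𝒱.grade n = ⊥)
include hu hV0 hVneg

/-- The powers of `A` preserve the eigenspace and the filtration step of `t` and commute with the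
coefficients of `D`. So the previous formula applies to each term of the exponential with the same
cutoffs. -/
theorem kernelPairing_iterateFamily_delta_nilExp {Φ Φ' : ℂ → ℕ → V →ₗ[ℂ] W}
    (hΦ : ∀ μ, ∀ v ∈ (𝒱.mode u 0).maxGenEigenspace μ, ∀ q : ℤ, v ∈ 𝒱.filtration q → ∀ Q : ℕ, q < Q →
      ∀ a l, Φ' a l v = ∑ m ∈ Finset.range Q, Φ (a + μ + m) l (𝒱.deltaExpCoeff u m v))
    {A : Module.End ℂ V} (hA : IsLocallyNilpotent A) (hAT : ∀ n : ℕ, Commute A (𝒱.mode u n))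
    (hAL : Commute A (𝒱.mode 𝒱.omega 1))
    {μ ν : ℂ} {t v₂ : V} (ht : t ∈ (𝒱.mode u 0).maxGenEigenspace μ)
    (hv₂ : v₂ ∈ (𝒱.mode u 0).maxGenEigenspace ν) {p q : ℤ} (hp : t ∈ 𝒱.filtration p)
    (hq : v₂ ∈ 𝒱.filtration q) {Q₁ Q₂ : ℕ} (hQ₁ : p < Q₁) (hQ₂ : q < Q₂) (n : ℤ) (c : ℂ) {J : ℕ}
    (hJ : p + q ≤ n + J) (k l : ℕ) (d κ : KernelRing) :
    kernelPairing J (𝒱.iterateFamily Φ' n c v₂) k l (nilExp (kernelMap d A) (κ ⊗ₜ t)) =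
      ∑ m₁ ∈ Finset.range Q₁, ∑ m₂ ∈ Finset.range Q₂,
        kernelPairing J (𝒱.iterateFamily Φ n (c + μ + ν + m₁ + m₂) (𝒱.deltaExpCoeff u m₂ v₂)) k l
          (nilExp (kernelMap (-(ofSeries (PowerSeries.log ℂ))) (nilpotentPart (𝒱.mode u 0)))
            (nilExp (kernelMap d A) ((ofSeries (PowerSeries.binomialSeries ℂ (-μ - m₁)) * κ) ⊗ₜ
              𝒱.deltaExpCoeff u m₁ t))) := by
  obtain ⟨K, hK⟩ := hA t
  have hc (i m : ℕ) : (A ^ i) (𝒱.deltaExpCoeff u m t) = 𝒱.deltaExpCoeff u m ((A ^ i) t) :=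
    LinearMap.congr_fun ((𝒱.commute_deltaExpCoeff hAT m).pow_left i).eq t
  have h1 (m : ℕ) := hA.nilExp_kernelMap_tmul d
    (ofSeries (PowerSeries.binomialSeries ℂ (-μ - m)) * κ) (v := 𝒱.deltaExpCoeff u m t) (K := K)
    (by rw [hc, hK, map_zero])
  have h2 (i : ℕ) := 𝒱.kernelPairing_iterateFamily_delta hu hV0 hVneg hΦ (t := (A ^ i) t)
    (Module.End.mem_maxGenEigenspace_of_commute ((hAT 0).pow_left i) ht) hv₂
    (Module.End.pow_apply_mem (fun _ h => 𝒱.apply_mem_filtration_of_commute hAL h) i _ hp)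
    hq hQ₁ hQ₂ n c hJ k l (d ^ i * κ)
  rw [hA.nilExp_kernelMap_tmul d κ hK, map_sum]
  simp only [h1, map_sum, map_smul, h2, hc, Finset.smul_sum]
  rw [Finset.sum_comm]
  refine Finset.sum_congr rfl fun m₁ _ => ?_
  rw [Finset.sum_comm]
  refine Finset.sum_congr rfl fun m₂ _ => Finset.sum_congr rfl fun i _ => ?_
  rw [mul_left_comm]

end WeightOne
end VertexOperatorAlgebra

/-! ### The two products in the Jacobi identity. -/

section Products

variable {V W : Type*} [AddCommGroup V] [Module ℂ V] [AddCommGroup W] [Module ℂ W]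

theorem logCoeff_add (Y : V →ₗ[ℂ] W →ₗ[ℂ] LogSeries W) (v v' : V) (a : ℂ) (k : ℕ) (w : W) :
    logCoeff Y (v + v') a k w = logCoeff Y v a k w + logCoeff Y v' a k w := by
  simp [logCoeff_apply]

theorem logCoeff_zero (Y : V →ₗ[ℂ] W →ₗ[ℂ] LogSeries W) (a : ℂ) (k : ℕ) (w : W) :
    logCoeff Y 0 a k w = 0 := by
  simp [logCoeff_apply]

theorem LowerTruncationProperty.exists_sub_eq_zero {Y : V →ₗ[ℂ] W →ₗ[ℂ] LogSeries W}
    (hY : LowerTruncationProperty Y) (v : V) (w : W) (c : ℂ) (l : ℕ) :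
    ∃ J : ℕ, ∀ j : ℕ, J ≤ j → logCoeff Y v (c - j) l w = 0 := by
  obtain ⟨N, hN⟩ := hY v w
  obtain ⟨J, hJ⟩ := exists_nat_gt (c.re - N)
  refine ⟨J, fun j hj => hN _ ?_ l⟩
  have : (J : ℝ) ≤ j := Nat.cast_le.2 hj
  simp only [Complex.sub_re, Complex.natCast_re]
  linarith

theorem Finset.exists_nat_forall_of_le {ι : Type*} (s : Finset ι) {p : ι → ℕ → Prop}
    (h : ∀ i ∈ s, ∃ J : ℕ, ∀ j, J ≤ j → p i j) : ∃ J : ℕ, ∀ i ∈ s, ∀ j, J ≤ j → p i j := by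
  choose! f hf using h
  exact ⟨s.sup f, fun i hi j hj => hf i hi j ((Finset.le_sup hi).trans hj)⟩

theorem jacobiProduct_eq_sum (Y : V →ₗ[ℂ] W →ₗ[ℂ] LogSeries W) (v₁ v₂ : V) (w : W)
    (n : ℤ) (b c : ℂ) (k l : ℕ) {J : ℕ} (hJ : ∀ j : ℕ, J ≤ j → logCoeff Y v₂ (c - j) l w = 0) :
    jacobiProduct Y v₁ v₂ w n b c k l =
      ∑ j ∈ Finset.range J, ((-1 : ℂ) ^ j * ((Ring.choose n j : ℤ) : ℂ)) •
        logCoeff Y v₁ (b - n + j) k (logCoeff Y v₂ (c - j) l w) := by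
  refine finsum_eq_sum_of_support_subset _ fun j hj => ?_
  rw [Finset.coe_range, Set.mem_Iio]
  by_contra h
  exact hj (by dsimp only; rw [hJ j (not_lt.1 h), map_zero, smul_zero])

theorem jacobiOppositeProduct_eq_sum (Y : V →ₗ[ℂ] W →ₗ[ℂ] LogSeries W) (v₁ v₂ : V) (w : W)
    (n : ℤ) (b c : ℂ) (k l : ℕ) {J : ℕ} (hJ : ∀ j : ℕ, J ≤ j → logCoeff Y v₁ (b - j) k w = 0) :
    jacobiOppositeProduct Y v₁ v₂ w n b c k l =
      ∑ j ∈ Finset.range J, ((-1 : ℂ) ^ (n - j) * ((Ring.choose n j : ℤ) : ℂ)) •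
        logCoeff Y v₂ (c - n + j) l (logCoeff Y v₁ (b - j) k w) := by
  refine finsum_eq_sum_of_support_subset _ fun j hj => ?_
  rw [Finset.coe_range, Set.mem_Iio]
  by_contra h
  exact hj (by dsimp only; rw [hJ j (not_lt.1 h), map_zero, smul_zero])

section Expansion

variable {Y Y' : V →ₗ[ℂ] W →ₗ[ℂ] LogSeries W} (hY : LowerTruncationProperty Y) {ι ι' : Type*}
  {s : Finset ι} {s' : Finset ι'} {C : ι → ℂ} {C' : ι' → ℂ} {x : ι → V} {x' : ι' → V}
  {d : ι → ℂ} {d' : ι' → ℂ} {κ : ι → ℕ} {κ' : ι' → ℕ} {v₁ v₂ : V} {k l : ℕ}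
  (h₁ : ∀ a w, logCoeff Y' v₁ a k w = ∑ i ∈ s, C i • logCoeff Y (x i) (a + d i) (κ i) w)
  (h₂ : ∀ a w, logCoeff Y' v₂ a l w = ∑ i ∈ s', C' i • logCoeff Y (x' i) (a + d' i) (κ' i) w)
include hY h₁ h₂

/-- The delta factor does not involve the operators, so a finite expansion with fixed shifts of
exponents can be taken out of both factors. Lower truncation gives one range of summation for all
terms. -/
theorem jacobiProduct_expansion (w : W) (n : ℤ) (b c : ℂ) :
    jacobiProduct Y' v₁ v₂ w n b c k l = ∑ i ∈ s, ∑ i' ∈ s', (C i * C' i') •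
      jacobiProduct Y (x i) (x' i') w n (b + d i) (c + d' i') (κ i) (κ' i') := by
  obtain ⟨J, hJ⟩ := s'.exists_nat_forall_of_le fun i' _ =>
    hY.exists_sub_eq_zero (x' i') w (c + d' i') (κ' i')
  have e1 (i' : ι') (j : ℕ) : c - j + d' i' = c + d' i' - j := by ring
  have e2 (i : ι) (j : ℕ) : b - n + j + d i = b + d i - n + j := by ring
  rw [jacobiProduct_eq_sum (J := J)]
  · rw [Finset.sum_congr rfl fun i _ => Finset.sum_congr rfl fun i' hi' => by
      rw [jacobiProduct_eq_sum (hJ := hJ i' hi')]]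
    simp only [h₁, h₂, map_sum, map_smul, Finset.smul_sum, e1, e2]
    rw [Finset.sum_comm]
    refine Finset.sum_congr rfl fun i _ => ?_
    rw [Finset.sum_comm]
    refine Finset.sum_congr rfl fun i' _ => Finset.sum_congr rfl fun j _ => ?_
    simp only [smul_smul]
    congr 1
    ring
  · intro j hj
    rw [h₂]
    exact Finset.sum_eq_zero fun i' hi' => by rw [e1, hJ i' hi' j hj, smul_zero]

theorem jacobiOppositeProduct_expansion (w : W) (n : ℤ) (b c : ℂ) :
    jacobiOppositeProduct Y' v₁ v₂ w n b c k l = ∑ i ∈ s, ∑ i' ∈ s', (C i * C' i') •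
      jacobiOppositeProduct Y (x i) (x' i') w n (b + d i) (c + d' i') (κ i) (κ' i') := by
  obtain ⟨J, hJ⟩ := s.exists_nat_forall_of_le fun i _ =>
    hY.exists_sub_eq_zero (x i) w (b + d i) (κ i)
  have e1 (i' : ι') (j : ℕ) : c - n + j + d' i' = c + d' i' - n + j := by ring
  have e2 (i : ι) (j : ℕ) : b - j + d i = b + d i - j := by ring
  rw [jacobiOppositeProduct_eq_sum (J := J)]
  · rw [Finset.sum_congr rfl fun i hi => Finset.sum_congr rfl fun i' _ => by
      rw [jacobiOppositeProduct_eq_sum (hJ := hJ i hi)]]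
    simp only [h₁, h₂, map_sum, map_smul, Finset.smul_sum, e1, e2]
    rw [Finset.sum_congr rfl fun j _ => Finset.sum_comm, Finset.sum_comm]
    refine Finset.sum_congr rfl fun i _ => ?_
    rw [Finset.sum_comm]
    refine Finset.sum_congr rfl fun i' _ => Finset.sum_congr rfl fun j _ => ?_
    simp only [smul_smul]
    congr 1
    ring
  · intro j hj
    rw [h₁]
    exact Finset.sum_eq_zero fun i hi => by rw [e2, hJ i hi j hj, smul_zero]

end Expansion

section Additivity

variable {Y : V →ₗ[ℂ] W →ₗ[ℂ] LogSeries W} (hY : LowerTruncationProperty Y)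
  (v v' v₁ v₂ : V) (w : W) (n : ℤ) (b c : ℂ) (k l : ℕ)

/-- With the version over `Bool`, this makes additivity a case of the expansion formulas, with zero
shifts; the finiteness required by the infinite sums is handled there. -/
theorem logCoeff_eq_sum_unit (v : V) (k : ℕ) (a : ℂ) (w : W) : logCoeff Y v a k w =
    ∑ _i ∈ (Finset.univ : Finset Unit), (1 : ℂ) • logCoeff Y v (a + 0) k w := by
  simp

theorem logCoeff_add_eq_sum_bool (v v' : V) (k : ℕ) (a : ℂ) (w : W) : logCoeff Y (v + v') a k w =
    ∑ i ∈ (Finset.univ : Finset Bool),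
      (1 : ℂ) • logCoeff Y (bif i then v else v') (a + 0) k w := by
  simp [logCoeff_add]

include hY

theorem jacobiProduct_add_left : jacobiProduct Y (v + v') v₂ w n b c k l =
    jacobiProduct Y v v₂ w n b c k l + jacobiProduct Y v' v₂ w n b c k l := by
  simpa using jacobiProduct_expansion hY (logCoeff_add_eq_sum_bool v v' k)
    (logCoeff_eq_sum_unit v₂ l) w n b c

theorem jacobiProduct_add_right : jacobiProduct Y v₁ (v + v') w n b c k l =
    jacobiProduct Y v₁ v w n b c k l + jacobiProduct Y v₁ v' w n b c k l := by
  simpa using jacobiProduct_expansion hY (logCoeff_eq_sum_unit v₁ k)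
    (logCoeff_add_eq_sum_bool v v' l) w n b c

theorem jacobiOppositeProduct_add_left : jacobiOppositeProduct Y (v + v') v₂ w n b c k l =
    jacobiOppositeProduct Y v v₂ w n b c k l + jacobiOppositeProduct Y v' v₂ w n b c k l := by
  simpa using jacobiOppositeProduct_expansion hY (logCoeff_add_eq_sum_bool v v' k)
    (logCoeff_eq_sum_unit v₂ l) w n b c

theorem jacobiOppositeProduct_add_right : jacobiOppositeProduct Y v₁ (v + v') w n b c k l =
    jacobiOppositeProduct Y v₁ v w n b c k l + jacobiOppositeProduct Y v₁ v' w n b c k l := by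
  simpa using jacobiOppositeProduct_expansion hY (logCoeff_eq_sum_unit v₁ k)
    (logCoeff_add_eq_sum_bool v v' l) w n b c

end Additivity

end Products

/-! ### Additivity of the iterate. -/

section Iterates

variable {V W : Type*} [AddCommGroup V] [Module ℂ V] [AddCommGroup W] [Module ℂ W]
  (𝒱 : VertexOperatorAlgebra V) (hVneg : ∀ n : ℤ, n < 0 → 𝒱.grade n = ⊥)
  (Y : V →ₗ[ℂ] W →ₗ[ℂ] LogSeries W)

/-- `finsum` is additive only on finitely supported families; here the support is finite because the
modes of `t` on `v₂` vanish eventually. -/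
theorem finite_support_iterate (hVneg : ∀ n : ℤ, n < 0 → 𝒱.grade n = ⊥) (t v₂ : V) (w : W) (n : ℤ)
    (β c : ℂ) (r k l : ℕ) :
    (Function.support fun j : ℕ => ∑ q ∈ Finset.HasAntidiagonal.antidiagonal l,
        jacobiKernel β r j k q.1 •
          logCoeff Y (HVertexOperator.coeff (𝒱.Y t) (-n - 1 - j) v₂) (c - β + j) q.2 w).Finite := by
  obtain ⟨J, hJ⟩ := 𝒱.exists_mode_eq_zero hVneg t v₂ n
  refine (Set.finite_Iio J).subset fun j hj => ?_
  by_contra h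
  refine hj (Finset.sum_eq_zero fun q _ => ?_)
  rw [𝒱.coeff_Y, hJ j (by simpa using h), logCoeff_zero, smul_zero]

open scoped Classical in
theorem finite_support_ite_eq {M : Type*} [Zero M] (b α : ℂ) (F : ℤ → M) :
    (Function.support fun m : ℤ => if b = -1 - (m + α) then F m else 0).Finite := by
  refine Set.Subsingleton.finite fun m hm m' hm' => ?_
  have h : b = -1 - (m + α) := by
    by_contra h
    exact hm (if_neg h)
  have h' : b = -1 - (m' + α) := by
    by_contra h'
    exact hm' (if_neg h')
  exact_mod_cast (by linear_combination h - h' : (m : ℂ) = m')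

include hVneg

theorem jacobiIterate_add_left (𝓛 : Module.End ℂ V) (v v' v₂ : V) (w : W) (n : ℤ) (b c : ℂ)
    (k l : ℕ) : jacobiIterate 𝒱 𝓛 Y (v + v') v₂ w n b c k l =
      jacobiIterate 𝒱 𝓛 Y v v₂ w n b c k l + jacobiIterate 𝒱 𝓛 Y v' v₂ w n b c k l := by
  classical
  rw [jacobiIterate, map_add, Finsupp.sum_add_index']
  · rfl
  · intro p
    simp [logCoeff_zero]
  · intro p t t'
    rw [← finsum_add_distrib (finite_support_ite_eq _ _ _) (finite_support_ite_eq _ _ _)]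
    refine finsum_congr fun m => ?_
    split_ifs
    · rw [← finsum_add_distrib (finite_support_iterate 𝒱 Y hVneg _ _ _ _ _ _ _ _ _)
        (finite_support_iterate 𝒱 Y hVneg _ _ _ _ _ _ _ _ _)]
      refine finsum_congr fun j => ?_
      simp only [𝒱.coeff_Y, VertexOperatorAlgebra.mode_add, LinearMap.add_apply, logCoeff_add,
        smul_add, Finset.sum_add_distrib]
    · rw [add_zero]

theorem jacobiIterate_add_right (𝓛 : Module.End ℂ V) (v₁ v v' : V) (w : W) (n : ℤ) (b c : ℂ)
    (k l : ℕ) : jacobiIterate 𝒱 𝓛 Y v₁ (v + v') w n b c k l =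
      jacobiIterate 𝒱 𝓛 Y v₁ v w n b c k l + jacobiIterate 𝒱 𝓛 Y v₁ v' w n b c k l := by
  classical
  rw [jacobiIterate, jacobiIterate, jacobiIterate, ← Finsupp.sum_add]
  refine Finsupp.sum_congr fun p _ => ?_
  rw [← finsum_add_distrib (finite_support_ite_eq _ _ _) (finite_support_ite_eq _ _ _)]
  refine finsum_congr fun m => ?_
  split_ifs
  · rw [← finsum_add_distrib (finite_support_iterate 𝒱 Y hVneg _ _ _ _ _ _ _ _ _)
      (finite_support_iterate 𝒱 Y hVneg _ _ _ _ _ _ _ _ _)]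
    refine finsum_congr fun j => ?_
    simp only [map_add, logCoeff_add, smul_add, Finset.sum_add_distrib]
  · rw [add_zero]

omit hVneg in
theorem jacobiIterate_zero_left (𝓛 : Module.End ℂ V) (v₂ : V) (w : W) (n : ℤ) (b c : ℂ)
    (k l : ℕ) : jacobiIterate 𝒱 𝓛 Y 0 v₂ w n b c k l = 0 := by
  rw [jacobiIterate, map_zero, Finsupp.sum_zero_index]

omit hVneg in
theorem jacobiIterate_zero_right (𝓛 : Module.End ℂ V) (v₁ : V) (w : W) (n : ℤ) (b c : ℂ)
    (k l : ℕ) : jacobiIterate 𝒱 𝓛 Y v₁ 0 w n b c k l = 0 := by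
  simp [jacobiIterate, logCoeff_zero]

end Iterates

/-! ### The twisted Jacobi identity for the deformed operators. -/

namespace VertexOperatorAlgebra

open KernelRing

variable {V W : Type*} [AddCommGroup V] [Module ℂ V] [AddCommGroup W] [Module ℂ W]
  (𝒱 : VertexOperatorAlgebra V)

/-- The factors `log (x₂ + x₀)` of the operators `x ^ N` cancel. -/
theorem _root_.nilExp_kernelMap_cancel {G N : Module.End ℂ V} (hG : IsLocallyNilpotent G)
    (hN : IsLocallyNilpotent N) (hGN : Commute G N) (z : KernelRing ⊗[ℂ] V) :
    nilExp (kernelMap (-logX₂) N) (nilExp (kernelMap (-(ofSeries (PowerSeries.log ℂ))) N)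
      (nilExp (kernelMap (logSum - logX₁) (G + N)) z)) =
    nilExp (kernelMap (-logX₁) N) (nilExp (kernelMap (logSum - logX₁) G) z) := by
  have hNN := Commute.refl N
  have hNA : Commute N (G + N) := hGN.symm.add_right hNN
  have h1 : nilExp (kernelMap (-(ofSeries (PowerSeries.log ℂ))) N) *
      nilExp (kernelMap (logSum - logX₁) (G + N)) =
      nilExp (kernelMap (-(ofSeries (PowerSeries.log ℂ))) N +
        kernelMap (logSum - logX₁) (G + N)) :=
    (nilExp_add (hN.kernelMap _) ((hG.add hN hGN).kernelMap _) (commute_kernelMap _ _ hNA)).symm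
  have h2 : nilExp (kernelMap (-logX₂) N) * nilExp (kernelMap (-(ofSeries (PowerSeries.log ℂ))) N +
        kernelMap (logSum - logX₁) (G + N)) =
      nilExp (kernelMap (-logX₂) N + (kernelMap (-(ofSeries (PowerSeries.log ℂ))) N +
        kernelMap (logSum - logX₁) (G + N))) :=
    (nilExp_add (hN.kernelMap _) ((hN.kernelMap _).add ((hG.add hN hGN).kernelMap _)
      (commute_kernelMap _ _ hNA))
      ((commute_kernelMap _ _ hNN).add_right (commute_kernelMap _ _ hNA))).symm
  have h3 : nilExp (kernelMap (-logX₁) N) * nilExp (kernelMap (logSum - logX₁) G) =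
      nilExp (kernelMap (-logX₁) N + kernelMap (logSum - logX₁) G) :=
    (nilExp_add (hN.kernelMap _) (hG.kernelMap _) (commute_kernelMap _ _ hGN.symm)).symm
  have h4 : kernelMap (-logX₂) N + (kernelMap (-(ofSeries (PowerSeries.log ℂ))) N +
        kernelMap (logSum - logX₁) (G + N)) =
      kernelMap (-logX₁) N + kernelMap (logSum - logX₁) G := by
    have h5 : -logX₁ = -logX₂ + (-(ofSeries (PowerSeries.log ℂ)) + (logSum - logX₁)) := by
      rw [logSum]
      ring
    rw [h5, kernelMap_add_left, kernelMap_add_left, map_add]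
    abel
  simp only [← Module.End.mul_apply]
  rw [h1, h2, h3, h4]

section WeightOne

variable {u : V} (hu : u ∈ 𝒱.grade 1) (hV0 : 𝒱.grade 0 = Submodule.span ℂ {𝒱.vac})
  (hVneg : ∀ n : ℤ, n < 0 → 𝒱.grade n = ⊥)
include hu hV0 hVneg

/-- The formal version of replacing `Δ(x₂+x₀) ((x₂+x₀)/x₁)^(𝓛_g + Y_0(u))` by `((x₂+x₀)/x₁)^𝓛_g
Δ(x₁)`. Eigenvalues combine through `binomialSeries_add`; the nilpotent logarithms cancel, leaving
`-log x₁` on `v₁` and `-log x₂` on `v₂`. -/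
theorem kernelPairing_iterateFamily_deltaTwist (Y : V →ₗ[ℂ] W →ₗ[ℂ] LogSeries W)
    {G : Module.End ℂ V} (hG : IsLocallyNilpotent G) (hGu : ∀ n : ℕ, Commute G (𝒱.mode u n))
    (hGL : Commute G (𝒱.mode 𝒱.omega 1))
    {μ ν : ℂ} {v₁ v₂ : V} (hv₁ : v₁ ∈ (𝒱.mode u 0).maxGenEigenspace μ)
    (hv₂ : v₂ ∈ (𝒱.mode u 0).maxGenEigenspace ν) {p q : ℤ} (hp : v₁ ∈ 𝒱.filtration p)
    (hq : v₂ ∈ 𝒱.filtration q) {Q₁ Q₂ : ℕ} (hQ₁ : p < Q₁) (hQ₂ : q < Q₂) (n : ℤ) (w : W) (β c : ℂ)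
    {J : ℕ} (hJ : p + q ≤ n + J) (k l : ℕ) :
    kernelPairing J (𝒱.iterateFamily (logCoeffFamily (deltaTwist 𝒱 u Y) w) n c v₂) k l
      (nilExp (kernelMap (logSum - logX₁) (G + nilpotentPart (𝒱.mode u 0)))
        (ofSeries (PowerSeries.binomialSeries ℂ β) ⊗ₜ v₁)) =
    ∑ i ∈ Finset.range Q₁ ×ˢ Finset.HasAntidiagonal.antidiagonal k,
      ∑ i' ∈ Finset.range Q₂ ×ˢ Finset.HasAntidiagonal.antidiagonal l,
        (((-1 : ℂ) ^ i.2.1 * (i.2.1.factorial : ℂ)⁻¹) *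
          ((-1 : ℂ) ^ i'.2.1 * (i'.2.1.factorial : ℂ)⁻¹)) •
        kernelPairing J (𝒱.iterateFamily (logCoeffFamily Y w) n (c + μ + ν + i.1 + i'.1)
          ((nilpotentPart (𝒱.mode u 0) ^ i'.2.1) (𝒱.deltaExpCoeff u i'.1 v₂))) i.2.2 i'.2.2
          (nilExp (kernelMap (logSum - logX₁) G)
            (ofSeries (PowerSeries.binomialSeries ℂ (-μ - i.1 + β)) ⊗ₜ
              ((nilpotentPart (𝒱.mode u 0) ^ i.2.1) (𝒱.deltaExpCoeff u i.1 v₁)))) := by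
  have hT := 𝒱.isTriangularizable_zeroMode hu
  set N := nilpotentPart (𝒱.mode u 0) with hNdef
  have hN : IsLocallyNilpotent N := hT.isLocallyNilpotent_nilpotentPart
  have hGN : Commute G N := hT.commute_nilpotentPart (by simpa using hGu 0)
  have hNu (n : ℕ) : Commute N (𝒱.mode u n) :=
    (hT.commute_nilpotentPart (by simpa using 𝒱.commute_mode_nonneg hu hV0 hVneg n 0)).symm
  -- The coefficients of `Y(Δ(x) v, x) w` separate into the factor `x^(-N)`, hidden in `logTwist`,
  -- and the exponent shifts by `μ + m`.
  have hΦ := fun μ v (hv : v ∈ (𝒱.mode u 0).maxGenEigenspace μ) (q : ℤ) (hq : v ∈ 𝒱.filtration q)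
      (Q : ℕ) (hQ : q < Q) a l =>
    (𝒱.logCoeff_deltaTwist hu hV0 hVneg Y hv hq hQ a l w).trans
      (Finset.sum_congr rfl fun m _ => (logTwist_apply N (logCoeffFamily Y w) _ _ _).symm)
  have key := 𝒱.kernelPairing_iterateFamily_delta_nilExp hu hV0 hVneg
    (Φ' := logCoeffFamily (deltaTwist 𝒱 u Y) w) hΦ (hG.add hN hGN)
    (fun n => (hGu n).add_left (hNu n)) (hGL.add_left (𝒱.commute_nilpotentPart_L_zero hu))
    hv₁ hv₂ hp hq hQ₁ hQ₂ n c hJ k l (logSum - logX₁) (ofSeries (PowerSeries.binomialSeries ℂ β))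
  simp only [← hNdef] at key
  rw [key]
  have hX (i : ℕ) (κ : KernelRing) (t : V) :
      kernelMap 1 (N ^ i) (nilExp (kernelMap (logSum - logX₁) G) (κ ⊗ₜ t)) =
        nilExp (kernelMap (logSum - logX₁) G) (κ ⊗ₜ ((N ^ i) t)) := by
    have hc : Commute (kernelMap 1 (N ^ i)) (nilExp (kernelMap (logSum - logX₁) G)) :=
      (hG.kernelMap (logSum - logX₁)).commute_nilSeries
        (commute_kernelMap 1 (logSum - logX₁) (hGN.symm.pow_left i)) _
    have h := LinearMap.congr_fun hc.eq (κ ⊗ₜ[ℂ] t)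
    rw [Module.End.mul_apply, Module.End.mul_apply, kernelMap_tmul, one_mul] at h
    exact h
  simp only [𝒱.kernelPairing_iterateFamily_logTwist hN (fun a b n => 𝒱.nilpotentPart_mode hu a b n),
    nilExp_kernelMap_cancel hG hN hGN, kernelPairing_nilExp_logX₁ hN, hX, ← map_mul,
    ← PowerSeries.binomialSeries_add, Finset.sum_product, Finset.smul_sum, smul_smul]
  refine Finset.sum_congr rfl fun m₁ _ => ?_
  conv_rhs => rw [Finset.sum_comm]
  refine Finset.sum_congr rfl fun m₂ _ => ?_
  conv_rhs => rw [Finset.sum_comm]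
  refine Finset.sum_congr rfl fun y _ => Finset.sum_congr rfl fun y' _ => ?_
  rw [mul_comm]

end WeightOne
end VertexOperatorAlgebra

namespace VertexOperatorAlgebra

variable {V W : Type*} [AddCommGroup V] [Module ℂ V] [AddCommGroup W] [Module ℂ W]
  (𝒱 : VertexOperatorAlgebra V)

section WeightOne

variable {u : V} (hu : u ∈ 𝒱.grade 1) (hV0 : 𝒱.grade 0 = Submodule.span ℂ {𝒱.vac})
  (hVneg : ∀ n : ℤ, n < 0 → 𝒱.grade n = ⊥) (g : 𝒱.Automorphism) (hgu : g.op u = u)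
include hu hV0 hVneg hgu

/-- The iterate side of the Jacobi identity for `Y(Δ(x) v, x)` in terms of iterates for `Y`. -/
theorem jacobiIterate_deltaTwist (Y : V →ₗ[ℂ] W →ₗ[ℂ] LogSeries W) {ρ μ ν : ℂ} {v₁ v₂ : V}
    (hρ : ρ ≠ 0) (hgv₁ : v₁ ∈ g.op.maxGenEigenspace ρ)
    (hv₁ : v₁ ∈ (𝒱.mode u 0).maxGenEigenspace μ) (hv₂ : v₂ ∈ (𝒱.mode u 0).maxGenEigenspace ν)
    {p q : ℤ} (hp : v₁ ∈ 𝒱.filtration p) (hq : v₂ ∈ 𝒱.filtration q) {Q₁ Q₂ : ℕ} (hQ₁ : p < Q₁)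
    (hQ₂ : q < Q₂) (w : W) (n : ℤ) (b c : ℂ) (k l : ℕ) :
    jacobiIterate 𝒱 (twistLog (g.twist u)) (deltaTwist 𝒱 u Y) v₁ v₂ w n b c k l =
    ∑ i ∈ Finset.range Q₁ ×ˢ Finset.HasAntidiagonal.antidiagonal k,
      ∑ i' ∈ Finset.range Q₂ ×ˢ Finset.HasAntidiagonal.antidiagonal l,
        (((-1 : ℂ) ^ i.2.1 * (i.2.1.factorial : ℂ)⁻¹) *
          ((-1 : ℂ) ^ i'.2.1 * (i'.2.1.factorial : ℂ)⁻¹)) •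
        jacobiIterate 𝒱 (twistLog g.op) Y
          ((nilpotentPart (𝒱.mode u 0) ^ i.2.1) (𝒱.deltaExpCoeff u i.1 v₁))
          ((nilpotentPart (𝒱.mode u 0) ^ i'.2.1) (𝒱.deltaExpCoeff u i'.1 v₂)) w n
          (b + (μ + i.1)) (c + (ν + i'.1)) i.2.2 i'.2.2 := by
  classical
  have hT := 𝒱.isTriangularizable_zeroMode hu
  have hg := g.isTriangularizable_op
  have hinj := g.injective_op
  have hgT : Commute g.op (𝒱.mode u 0) := g.commute_op_mode hgu 0
  have hGu (n : ℤ) : Commute (nilpotentLog g.op) (𝒱.mode u n) :=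
    (hg.commute_nilpotentLog hinj (g.commute_op_mode hgu n).symm).symm
  have hGL : Commute (nilpotentLog g.op) (𝒱.mode 𝒱.omega 1) :=
    (hg.commute_nilpotentLog hinj (g.commute_op_mode g.map_omega 1).symm).symm
  have hNL := 𝒱.commute_nilpotentPart_L_zero hu
  have hh : IsTriangularizable (g.twist u) := hg.mul_expTwoPiI hT hgT hinj
  have hhinj : Function.Injective (g.twist u) := IsTriangularizable.injective_mul_expTwoPiI hT hinj
  have hGN : nilpotentPart (twistLog (g.twist u)) =
      nilpotentLog g.op + nilpotentPart (𝒱.mode u 0) := by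
    rw [hh.nilpotentPart_twistLog hhinj]
    exact hg.nilpotentLog_mul_expTwoPiI hT hgT hinj
  obtain ⟨n₀, hn₀⟩ := exists_unitStripLog_eq hρ μ
  have hα := hh.maxGenEigenspace_le_twistLog hhinj _
    (hg.mem_maxGenEigenspace_mul_expTwoPiI hT hgT hinj hgv₁ hv₁)
  obtain ⟨J, hJ⟩ : ∃ J : ℕ, p + q ≤ n + J := ⟨(p + q - n).toNat, by lia⟩
  have hpow {A : Module.End ℂ V} (hA : Commute A (𝒱.mode 𝒱.omega 1)) (r : ℕ) {q : ℤ} {v : V}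
      (hv : v ∈ 𝒱.filtration q) : (A ^ r) v ∈ 𝒱.filtration q :=
    𝒱.apply_mem_filtration_of_commute (hA.pow_left r) hv
  have hD {q : ℤ} {v : V} (hv : v ∈ 𝒱.filtration q) (i m : ℕ) :
      (nilpotentPart (𝒱.mode u 0) ^ i) (𝒱.deltaExpCoeff u m v) ∈ 𝒱.filtration q :=
    hpow hNL i (𝒱.deltaExpCoeff_mem_filtration_self hu hV0 hVneg m hv)
  have hgN : Commute (nilpotentPart (𝒱.mode u 0)) g.op := (hT.commute_nilpotentPart hgT).symm
  have hR (i i' : ℕ × ℕ × ℕ) := 𝒱.jacobiIterate_eq (hg.twistLog hinj) Y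
    (hg.maxGenEigenspace_le_twistLog hinj ρ
      (Module.End.mem_maxGenEigenspace_of_commute (hgN.pow_left i.2.1)
        (Module.End.mem_maxGenEigenspace_of_commute
          (𝒱.commute_deltaExpCoeff (fun n => g.commute_op_mode hgu n) i.1).symm hgv₁)))
    ((nilpotentPart (𝒱.mode u 0) ^ i'.2.1) (𝒱.deltaExpCoeff u i'.1 v₂)) n (J := J)
    (fun r j hj => 𝒱.mode_eq_zero hVneg
      (by rw [hg.nilpotentPart_twistLog hinj]; exact hpow hGL r (hD hp i.2.1 i.1))
      (hD hq i'.2.1 i'.1) (by lia)) w (b + (μ + i.1)) (c + (ν + i'.1)) i.2.2 i'.2.2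
  have hL := 𝒱.jacobiIterate_eq (hh.twistLog hhinj) (deltaTwist 𝒱 u Y) hα v₂ n (J := J)
    (fun r j hj => 𝒱.mode_eq_zero hVneg
      (by rw [hGN]; exact hpow (hGL.add_left hNL) r hp) hq (by lia)) w b c k l
  -- The exponents of `x₁` allowed on the two sides differ by the weight shift `m` and the strip
  -- correction `n₀`; both are integers, so the sum over the delta function is only reindexed.
  have hiff (m : ℕ) : (∃ z : ℤ, b + (μ + m) = -1 - (z + unitStripLog ρ)) ↔
      ∃ z : ℤ, b = -1 - (z + unitStripLog (ρ * Complex.exp (2 * Real.pi * Complex.I * μ))) := by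
    rw [hn₀]
    constructor
    · rintro ⟨z, hz⟩
      refine ⟨z + m - n₀, ?_⟩
      push_cast
      linear_combination hz
    · rintro ⟨z, hz⟩
      refine ⟨z - m + n₀, ?_⟩
      push_cast
      linear_combination hz
  simp only [hL, hR, hiff, hGN, hg.nilpotentPart_twistLog hinj]
  split_ifs with hb
  · rw [𝒱.kernelPairing_iterateFamily_deltaTwist hu hV0 hVneg Y
      (hg.isLocallyNilpotent_nilpotentLog hinj) (fun n => hGu n) hGL hv₁ hv₂ hp hq hQ₁ hQ₂ n w
      (-1 - b) (c - (-1 - b)) hJ k l]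
    refine Finset.sum_congr rfl fun i _ => Finset.sum_congr rfl fun i' _ => ?_
    -- The old identity is read at the exponent `b + μ + m₁` of `x₁`, so its binomial exponent is
    -- the new one, `-1 - b`, lowered by `μ + m₁`.
    rw [show -1 - (b + (μ + i.1)) = -μ - (i.1 : ℂ) + (-1 - b) by ring,
      show c + (ν + i'.1) - (-μ - (i.1 : ℂ) + (-1 - b)) = c - (-1 - b) + μ + ν + i.1 + i'.1 by ring]
  · simp

/-- By additivity, `v₁` may be taken a joint generalized eigenvector of `g` and `Y_0(u)`, and `v₂`
one of `Y_0(u)`. Then all three terms are the same finite combination of terms of the given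
identity, which applies summand by summand. -/
theorem twistedJacobiIdentity_deltaTwist {Y : V →ₗ[ℂ] W →ₗ[ℂ] LogSeries W}
    (hY : LowerTruncationProperty Y) (hJ : TwistedJacobiIdentity 𝒱 (twistLog g.op) Y) :
    TwistedJacobiIdentity 𝒱 (twistLog (g.twist u)) (deltaTwist 𝒱 u Y) := by
  intro v₁ v₂ w n b c k l
  have hT := 𝒱.isTriangularizable_zeroMode hu
  have hg := g.isTriangularizable_op
  have hY' := 𝒱.lowerTruncationProperty_deltaTwist u hY
  have h0l (Z : V →ₗ[ℂ] W →ₗ[ℂ] LogSeries W) (v : V) : jacobiProduct Z 0 v w n b c k l = 0 := by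
    simp [jacobiProduct, logCoeff_zero]
  have h0r (Z : V →ₗ[ℂ] W →ₗ[ℂ] LogSeries W) (v : V) : jacobiProduct Z v 0 w n b c k l = 0 := by
    simp [jacobiProduct, logCoeff_zero]
  have h0l' (Z : V →ₗ[ℂ] W →ₗ[ℂ] LogSeries W) (v : V) :
      jacobiOppositeProduct Z 0 v w n b c k l = 0 := by
    simp [jacobiOppositeProduct, logCoeff_zero]
  have h0r' (Z : V →ₗ[ℂ] W →ₗ[ℂ] LogSeries W) (v : V) :
      jacobiOppositeProduct Z v 0 w n b c k l = 0 := by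
    simp [jacobiOppositeProduct, logCoeff_zero]
  refine hg.joint_induction hT (g.commute_op_mode hgu 0) (p := fun v => jacobiProduct (deltaTwist 𝒱 u Y) v v₂ w n b c k l -
      jacobiOppositeProduct (deltaTwist 𝒱 u Y) v v₂ w n b c k l =
        jacobiIterate 𝒱 (twistLog (g.twist u)) (deltaTwist 𝒱 u Y) v v₂ w n b c k l)
    (fun ρ μ v₁ hgv₁ hv₁ => ?_)
    (by rw [h0l, h0l', jacobiIterate_zero_left, sub_zero]) (fun v v' hv hv' => ?_) v₁
  · refine hT.induction (p := fun v => jacobiProduct (deltaTwist 𝒱 u Y) v₁ v w n b c k l -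
      jacobiOppositeProduct (deltaTwist 𝒱 u Y) v₁ v w n b c k l =
        jacobiIterate 𝒱 (twistLog (g.twist u)) (deltaTwist 𝒱 u Y) v₁ v w n b c k l)
      (fun ν v₂ hv₂ => ?_)
      (by rw [h0r, h0r', jacobiIterate_zero_right, sub_zero]) (fun v v' hv hv' => ?_) v₂
    -- An automorphism has no generalized eigenvectors for `0`, so this case is trivial; otherwise
    -- `ρ` has a logarithm.
    · rcases eq_or_ne ρ 0 with rfl | hρ
      · rw [Module.End.eq_zero_of_mem_maxGenEigenspace_zero g.injective_op hgv₁, h0l, h0l',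
          jacobiIterate_zero_left, sub_zero]
      obtain ⟨p, hp⟩ := 𝒱.exists_mem_filtration v₁
      obtain ⟨q, hq⟩ := 𝒱.exists_mem_filtration v₂
      have hDT {μ : ℂ} {v : V} (hv : v ∈ (𝒱.mode u 0).maxGenEigenspace μ) {p : ℕ}
          (hp : v ∈ 𝒱.filtration p) (k : ℕ) (a : ℂ) (w : W) :
          logCoeff (deltaTwist 𝒱 u Y) v a k w =
          ∑ i ∈ Finset.range (p + 1) ×ˢ Finset.HasAntidiagonal.antidiagonal k,
            ((-1 : ℂ) ^ i.2.1 * (i.2.1.factorial : ℂ)⁻¹) • logCoeff Y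
              ((nilpotentPart (𝒱.mode u 0) ^ i.2.1) (𝒱.deltaExpCoeff u i.1 v)) (a + (μ + i.1))
                i.2.2 w := by
        rw [𝒱.logCoeff_deltaTwist hu hV0 hVneg Y hv hp (Q := p + 1) (by lia), Finset.sum_product]
        simp only [add_assoc]
      rw [jacobiProduct_expansion hY (hDT hv₁ hp k) (hDT hv₂ hq l),
        jacobiOppositeProduct_expansion hY (hDT hv₁ hp k) (hDT hv₂ hq l),
        𝒱.jacobiIterate_deltaTwist hu hV0 hVneg g hgu Y hρ hgv₁ hv₁ hv₂ hp hq (Q₁ := p + 1)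
          (Q₂ := q + 1) (by lia) (by lia), ← Finset.sum_sub_distrib]
      refine Finset.sum_congr rfl fun i _ => ?_
      rw [← Finset.sum_sub_distrib]
      refine Finset.sum_congr rfl fun i' _ => ?_
      rw [← smul_sub, hJ]
    · rw [jacobiProduct_add_right hY', jacobiOppositeProduct_add_right hY',
        jacobiIterate_add_right 𝒱 hVneg, ← hv, ← hv']
      abel
  · rw [jacobiProduct_add_left hY', jacobiOppositeProduct_add_left hY',
      jacobiIterate_add_left 𝒱 hVneg, ← hv, ← hv']
    abel

theorem hasTwistedProperties_deltaTwist {π : ℂ → W →ₗ[ℂ] W} {Y : V →ₗ[ℂ] W →ₗ[ℂ] LogSeries W}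
    (hY : HasTwistedProperties 𝒱 g.op π Y) :
    HasTwistedProperties 𝒱 (g.twist u) π (deltaTwist 𝒱 u Y) where
  identity := 𝒱.identityProperty_deltaTwist hu hV0 hVneg hY.identity
  lower_truncation := 𝒱.lowerTruncationProperty_deltaTwist u hY.lower_truncation
  L_derivative := 𝒱.lDerivativeProperty_deltaTwist hu hV0 hVneg hY.L_derivative
  equivariance := 𝒱.equivarianceProperty_deltaTwist hu hV0 hVneg g hgu hY.equivariance
  jacobi := 𝒱.twistedJacobiIdentity_deltaTwist hu hV0 hVneg g hgu hY.lower_truncation hY.jacobi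

end WeightOne

end VertexOperatorAlgebra

/-- The second grading enters these properties only through the projections onto `W_[n]`, so the
`ℂ/ℤ`-graded and the `ℂ`-graded case have a common proof. -/
theorem GeneralizedTwistedModule.hasTwistedProperties {V W : Type*} [AddCommGroup V] [Module ℂ V]
    [AddCommGroup W] [Module ℂ W] {𝒱 : VertexOperatorAlgebra V} {g : 𝒱.Automorphism} {A : Type}
    {cls : ℂ → A} (M : GeneralizedTwistedModule 𝒱 g A cls W) :
    HasTwistedProperties 𝒱 g.op (weightProj M.grade M.grade_internal) M.Y :=
  ⟨M.identity, M.lower_truncation, M.L_derivative, M.equivariance, M.jacobi⟩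

theorem theorem4p1 {V : Type*} [AddCommGroup V] [Module ℂ V]
    (𝒱 : VertexOperatorAlgebra V)
    (hV0 : 𝒱.grade 0 = Submodule.span ℂ {𝒱.vac})
    (hVneg : ∀ n : ℤ, n < 0 → 𝒱.grade n = ⊥)
    (g : 𝒱.Automorphism) (u : V) (hu : u ∈ 𝒱.grade 1) (hLu : 𝒱.L 1 u = 0)
    (hgu : g.op u = u)
    {W : Type*} [AddCommGroup W] [Module ℂ W] :
    (∀ M : CModZGradedTwistedModule 𝒱 g W,
      HasTwistedProperties 𝒱 (g.twist u) (weightProj M.grade M.grade_internal)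
        (deltaTwist 𝒱 u M.Y)) ∧
    (∀ (𝒢 : CompatibleCGrading 𝒱 g) (M : CGradedTwistedModule 𝒱 g 𝒢 W),
      HasTwistedProperties 𝒱 (g.twist u) (weightProj M.grade M.grade_internal)
        (deltaTwist 𝒱 u M.Y)) :=
  ⟨fun M => 𝒱.hasTwistedProperties_deltaTwist hu hV0 hVneg g hgu M.hasTwistedProperties,
    fun _ M => 𝒱.hasTwistedProperties_deltaTwist hu hV0 hVneg g hgu
      M.toGeneralizedTwistedModule.hasTwistedProperties⟩
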